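/- Let $(X,\mathfrak B,\mu)$ and $(Y,\mathfrak C,\nu)$ be strictly localisable measure spaces: the space is partitioned into measurable pieces $X_i$ of finite measure such that a set $A$ is measurable if and only if all $A\cap X_i$ are, and then $\mu(A)=\sum_i\mu(A\cap X_i)$; such a family $(X_i)$ is called a witness. Let $p:X\to[1,\infty)$ and $q:Y\to[1,\infty)$ be measurable and essentially bounded. Let $L_0(X,\mu)$ denote the vector lattice of measurable real functions on $X$ modulo equality almost everywhere. The Nakano space $N=L_{p(\cdot)}(X,\mu)$ is the Banach lattice of all $f\in L_0(X,\mu)$ with $\int|f(x)|^{p(x)}\,d\mu<\infty$, with the pointwise lattice operations and with the norm for which $\|f\|$, $f\neq0$, is the unique $c>0$ such that $\int|f(x)/c|^{p(x)}\,d\mu=1$; similarly for $N'=L_{q(\cdot)}(Y,\nu)$. Suppose that $\dim N\ge2$ and let $\theta:N\to N'$ be an isometric embedding of Banach lattices, that is, a linear map which preserves the lattice operations and the norm. Then there is a measure $\nu'$ on $(Y,\mathfrak C)$ which is equivalent to $\nu$ (the two measures have a common witness of strict localisability and the same null sets), with a finite and strictly positive density $\frac{d\nu}{d\nu'}$, such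 that the map $$\theta'=D\circ\theta:\ N\to L_{q(\cdot)}(Y,\nu'),\qquad Df=\Bigl(\frac{d\nu}{d\nu'}\Bigr)^{1/q}f,$$ has the following properties. 1. For every $A\in\mathfrak B$ with $\mu(A)<\infty$ there is $B\in\mathfrak C$ with $\theta'(\chi_A)=\chi_B$ almost everywhere; write $\theta A=B$ (defined up to a null set). 2. $\theta'$ has a unique extension to a linear map $\hat\theta:L_0(X,\mu)\to L_0(Y,\nu')$ which preserves the lattice operations and all existing suprema of non-empty sets. Moreover $\hat\theta(\chi_X)=\chi_{\hat\theta X}$ for some $\hat\theta X\in\mathfrak C$, and $\hat\theta(p)=q\cdot\chi_{\hat\theta X}$. 3. $\nu'(\theta A)=\mu(A)$ for every $A\in\mathfrak B$ with $\mu(A)<\infty$. -/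

import Mathlib

open MeasureTheory
open scoped ENNReal

universe u v

namespace NakanoSpace

/-! ### Strictly localisable measures, absolute continuity and equivalence of measures -/

/-- The family `s` is a partition of `X` into measurable sets of finite measure which witnesses
that the measure space `(X, μ)` is strictly localisable. -/
structure IsWitness {X : Type u} [MeasurableSpace X] (μ : Measure X) {ι : Type u}
    (s : ι → Set X) : Prop where
  disjoint : Pairwise (fun i j => Disjoint (s i) (s j))
  iUnion_eq : (⋃ i, s i) = Set.univ
  measurable : ∀ i, MeasurableSet (s i)
  finite : ∀ i, μ (s i) < ∞
  measurable_of_inter : ∀ A : Set X, (∀ i, MeasurableSet (A ∩ s i)) → MeasurableSet A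
  measure_eq_tsum : ∀ A : Set X, MeasurableSet A → μ A = ∑' i, μ (A ∩ s i)

/-- The measure space `(X, μ)` is a disjoint union of measure spaces of finite measure. (The empty
pieces of a partition of `X` are irrelevant and the other ones inject into `X`, so index types
from the universe of `X` suffice.) -/
def StrictlyLocalisable {X : Type u} [MeasurableSpace X] (μ : Measure X) : Prop :=
  ∃ (ι : Type u) (s : ι → Set X), IsWitness μ s

/-- Absolute continuity of `ν` with respect to `μ` in the class of strictly localisable measures:
there is a common witness of strict localisability, on each piece of which `ν` is absolutely
continuous with respect to `μ`. -/
def AbsCont {X : Type u} [MeasurableSpace X] (ν μ : Measure X) : Prop :=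
  ∃ (ι : Type u) (s : ι → Set X), IsWitness μ s ∧ IsWitness ν s ∧
    ∀ i, (ν.restrict (s i)).AbsolutelyContinuous (μ.restrict (s i))

/-- Equivalence of measures. -/
def Equivalent {X : Type u} [MeasurableSpace X] (μ ν : Measure X) : Prop :=
  AbsCont μ ν ∧ AbsCont ν μ

/-- `ζ` is a (finite, strictly positive) version of the Radon-Nikodym derivative `dμ/dν`. -/
structure IsDensity {X : Type u} [MeasurableSpace X] (μ ν : Measure X) (ζ : X → ℝ) : Prop where
  measurable : Measurable ζ
  pos : ∀ x, 0 < ζ x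
  eq_withDensity : μ = ν.withDensity (fun x => ENNReal.ofReal (ζ x))

/-- A measure is absolutely continuous with respect to those for which it has a density. -/
theorem IsDensity.ac {X : Type u} [MeasurableSpace X] {μ ν : Measure X} {ζ : X → ℝ}
    (h : IsDensity μ ν ζ) : μ ≪ ν := by
  rw [h.eq_withDensity]; exact withDensity_absolutelyContinuous _ _

/-- Since the density does not vanish, absolute continuity holds in the other direction too. -/
theorem IsDensity.ac' {X : Type u} [MeasurableSpace X] {μ ν : Measure X} {ζ : X → ℝ}
    (h : IsDensity μ ν ζ) : ν ≪ μ := by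
  rw [h.eq_withDensity]
  refine withDensity_absolutelyContinuous' h.measurable.ennreal_ofReal.aemeasurable ?_
  exact Filter.Eventually.of_forall fun x => by simpa using h.pos x

/-! ### Nakano spaces -/

/-- `p : X → [1, ∞)` is measurable and essentially bounded. -/
structure IsExponent {X : Type u} [MeasurableSpace X] (μ : Measure X) (p : X → ℝ) : Prop where
  measurable : Measurable p
  one_le : ∀ x, 1 ≤ p x
  essBdd : ∃ r : ℝ, ∀ᵐ x ∂μ, p x ≤ r

/-- An exponent function remains one after a density change. -/
theorem IsExponent.of_isDensity {X : Type u} [MeasurableSpace X] {μ ν : Measure X} {ζ p : X → ℝ}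
    (hp : IsExponent μ p) (h : IsDensity μ ν ζ) : IsExponent ν p :=
  ⟨hp.measurable, hp.one_le, hp.essBdd.imp fun _ hr => h.ac'.ae_le hr⟩

/-- The modular functional `Θ f = ∫ |f x| ^ p x dμ`, with values in `[0, ∞]`. -/
noncomputable def modular {X : Type u} [MeasurableSpace X] {μ : Measure X} (p : X → ℝ)
    (f : X →ₘ[μ] ℝ) : ℝ≥0∞ :=
  ∫⁻ x, ENNReal.ofReal (|f x| ^ p x) ∂μ

theorem rpow_bound {a b c p r : ℝ} (hp : 1 ≤ p) (hr : p ≤ r) (ha : 0 ≤ a) (hb : 0 ≤ b)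
    (hc : 0 ≤ c) (hcab : c ≤ a + b) :
    ENNReal.ofReal (c ^ p) ≤
      ENNReal.ofReal (2 ^ r) * (ENNReal.ofReal (a ^ p) + ENNReal.ofReal (b ^ p)) := by
  have hp0 : 0 ≤ p := by linarith
  have h2 : c ≤ 2 * max a b := by
    have := le_max_left a b
    have := le_max_right a b
    linarith
  rw [← ENNReal.ofReal_add (by positivity) (by positivity), ← ENNReal.ofReal_mul (by positivity)]
  apply ENNReal.ofReal_le_ofReal
  calc c ^ p ≤ (2 * max a b) ^ p := Real.rpow_le_rpow hc h2 hp0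
    _ = 2 ^ p * (max a b) ^ p := Real.mul_rpow (by norm_num) (le_max_of_le_left ha)
    _ ≤ 2 ^ r * (a ^ p + b ^ p) := by
      have h3 : (2 : ℝ) ^ p ≤ 2 ^ r := Real.rpow_le_rpow_of_exponent_le (by norm_num) hr
      have h4 : (max a b) ^ p ≤ a ^ p + b ^ p := by
        have := Real.rpow_nonneg ha p
        have := Real.rpow_nonneg hb p
        rcases max_cases a b with h | h <;> rw [h.1] <;> linarith
      have h5 : 0 ≤ (max a b) ^ p := Real.rpow_nonneg (le_max_of_le_left ha) p
      exact mul_le_mul h3 h4 h5 (by positivity)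

section

variable {X : Type u} [MeasurableSpace X] {μ : Measure X} {p : X → ℝ}

theorem measurable_modular_integrand (hp : Measurable p) (f : X →ₘ[μ] ℝ) :
    Measurable fun x => ENNReal.ofReal (|f x| ^ p x) := by
  have hf : Measurable (f : X → ℝ) := f.stronglyMeasurable.measurable
  exact ((measurable_abs.comp hf).pow hp).ennreal_ofReal

theorem modular_lt_top_of_le_add (hp : IsExponent μ p) {f g h : X →ₘ[μ] ℝ}
    (hf : modular p f < ∞) (hg : modular p g < ∞) (hh : ∀ᵐ x ∂μ, |h x| ≤ |f x| + |g x|) :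
    modular p h < ∞ := by
  obtain ⟨r, hr⟩ := hp.essBdd
  have hle : modular p h ≤ ENNReal.ofReal (2 ^ r) * (modular p f + modular p g) := by
    unfold modular
    rw [← lintegral_add_left (measurable_modular_integrand hp.measurable f),
      ← lintegral_const_mul (ENNReal.ofReal (2 ^ r))
        (f := fun x => ENNReal.ofReal (|f x| ^ p x) + ENNReal.ofReal (|g x| ^ p x))
        ((measurable_modular_integrand hp.measurable f).add
          (measurable_modular_integrand hp.measurable g))]
    apply lintegral_mono_ae
    filter_upwards [hr, hh] with x hx hx'
    exact rpow_bound (hp.one_le x) hx (abs_nonneg _) (abs_nonneg _) (abs_nonneg _) hx'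
  exact lt_of_le_of_lt hle (ENNReal.mul_lt_top ENNReal.ofReal_lt_top (ENNReal.add_lt_top.2 ⟨hf, hg⟩))

theorem modular_zero (hp : IsExponent μ p) : modular p (0 : X →ₘ[μ] ℝ) = 0 := by
  unfold modular
  rw [lintegral_eq_zero_iff (measurable_modular_integrand hp.measurable _)]
  filter_upwards [AEEqFun.coeFn_zero (α := X) (β := ℝ) (μ := μ)] with x hx
  have h1 : p x ≠ 0 := by linarith [hp.one_le x]
  simp [hx, Real.zero_rpow h1]

theorem modular_smul_lt_top (hp : IsExponent μ p) (c : ℝ) {f : X →ₘ[μ] ℝ}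
    (hf : modular p f < ∞) : modular p (c • f) < ∞ := by
  obtain ⟨r, hr⟩ := hp.essBdd
  have hle : modular p (c • f) ≤ ENNReal.ofReal ((max 1 |c|) ^ r) * modular p f := by
    unfold modular
    rw [← lintegral_const_mul _ (measurable_modular_integrand hp.measurable f)]
    apply lintegral_mono_ae
    filter_upwards [hr, AEEqFun.coeFn_smul c f] with x hx hx'
    rw [hx', ← ENNReal.ofReal_mul (by positivity)]
    apply ENNReal.ofReal_le_ofReal
    rw [Pi.smul_apply, smul_eq_mul, abs_mul, Real.mul_rpow (abs_nonneg _) (abs_nonneg _)]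
    have h1 := hp.one_le x
    gcongr
    calc |c| ^ p x ≤ (max 1 |c|) ^ p x :=
          Real.rpow_le_rpow (abs_nonneg _) (le_max_right _ _) (by linarith)
      _ ≤ (max 1 |c|) ^ r := Real.rpow_le_rpow_of_exponent_le (le_max_left _ _) hx
  exact lt_of_le_of_lt hle (ENNReal.mul_lt_top ENNReal.ofReal_lt_top hf)

/-- The Nakano space `L_{p(·)}(X, μ)`, a linear subspace of the space `X →ₘ[μ] ℝ` of all measurable
real functions up to equality almost everywhere. -/
def nakano (hp : IsExponent μ p) : Submodule ℝ (X →ₘ[μ] ℝ) where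
  carrier := {f | modular p f < ∞}
  zero_mem' := by
    change modular p 0 < ∞
    rw [modular_zero hp]
    exact ENNReal.zero_lt_top
  add_mem' := by
    intro f g hf hg
    refine modular_lt_top_of_le_add hp hf hg ?_
    filter_upwards [AEEqFun.coeFn_add f g] with x hx
    rw [hx]
    exact abs_add_le _ _
  smul_mem' := fun c _ hf => modular_smul_lt_top hp c hf

theorem mem_nakano {hp : IsExponent μ p} {f : X →ₘ[μ] ℝ} : f ∈ nakano hp ↔ modular p f < ∞ :=
  Iff.rfl

theorem sup_mem_nakano {hp : IsExponent μ p} {f g : X →ₘ[μ] ℝ} (hf : f ∈ nakano hp)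
    (hg : g ∈ nakano hp) : f ⊔ g ∈ nakano hp := by
  refine modular_lt_top_of_le_add hp hf hg ?_
  filter_upwards [AEEqFun.coeFn_sup f g] with x hx
  rw [hx]
  have := abs_nonneg (f x)
  have := abs_nonneg (g x)
  rcases max_cases (f x) (g x) with h | h <;> rw [h.1] <;> linarith

theorem inf_mem_nakano {hp : IsExponent μ p} {f g : X →ₘ[μ] ℝ} (hf : f ∈ nakano hp)
    (hg : g ∈ nakano hp) : f ⊓ g ∈ nakano hp := by
  refine modular_lt_top_of_le_add hp hf hg ?_
  filter_upwards [AEEqFun.coeFn_inf f g] with x hx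
  rw [hx]
  have := abs_nonneg (f x)
  have := abs_nonneg (g x)
  rcases min_cases (f x) (g x) with h | h <;> rw [h.1] <;> linarith

/-- The lattice operations of a Nakano space are the point-wise ones. -/
instance instLatticeNakano (hp : IsExponent μ p) : Lattice (nakano hp) :=
  Subtype.lattice (fun {_ _} hf hg => sup_mem_nakano hf hg) (fun {_ _} hf hg => inf_mem_nakano hf hg)

/-- The norm of a Nakano space. For `f ≠ 0` it is the unique `c > 0` with `Θ (f / c) = 1`, see
`norm_eq_of_modular_eq_one`. -/
noncomputable instance instNormNakano (hp : IsExponent μ p) : Norm (nakano hp) where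
  norm f := sInf {c : ℝ | 0 < c ∧ modular p (c⁻¹ • (f : X →ₘ[μ] ℝ)) ≤ 1}

theorem norm_def (hp : IsExponent μ p) (f : nakano hp) :
    ‖f‖ = sInf {c : ℝ | 0 < c ∧ modular p (c⁻¹ • (f : X →ₘ[μ] ℝ)) ≤ 1} := rfl

theorem mul_modular_le (hp : IsExponent μ p) {a : ℝ} (ha : 1 ≤ a) (f : X →ₘ[μ] ℝ) :
    ENNReal.ofReal a * modular p f ≤ modular p (a • f) := by
  unfold modular
  rw [← lintegral_const_mul _ (measurable_modular_integrand hp.measurable f)]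
  apply lintegral_mono_ae
  filter_upwards [AEEqFun.coeFn_smul a f] with x hx
  rw [hx, ← ENNReal.ofReal_mul (by positivity)]
  apply ENNReal.ofReal_le_ofReal
  rw [Pi.smul_apply, smul_eq_mul, abs_mul, Real.mul_rpow (abs_nonneg _) (abs_nonneg _),
    abs_of_nonneg (by linarith : (0 : ℝ) ≤ a)]
  gcongr
  exact Real.self_le_rpow_of_one_le ha (hp.one_le x)

theorem norm_eq_of_modular_eq_one (hp : IsExponent μ p) (f : nakano hp) {c : ℝ} (hc : 0 < c)
    (h : modular p (c⁻¹ • (f : X →ₘ[μ] ℝ)) = 1) : ‖f‖ = c := by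
  rw [norm_def]
  refine IsLeast.csInf_eq ⟨⟨hc, h.le⟩, ?_⟩
  rintro d ⟨hd, hd1⟩
  by_contra hlt
  have hlt : d < c := not_le.1 hlt
  have hone : 1 < d⁻¹ * c := by
    rw [inv_mul_eq_div]
    exact (one_lt_div hd).2 hlt
  have h1 := mul_modular_le hp hone.le (c⁻¹ • (f : X →ₘ[μ] ℝ))
  rw [h, mul_one, smul_smul, mul_assoc, mul_inv_cancel₀ hc.ne', mul_one] at h1
  have h2 := h1.trans hd1
  rw [ENNReal.ofReal_le_one] at h2
  linarith

/-- The class of the characteristic function of a measurable set. -/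
noncomputable def charFn (μ : Measure X) (A : Set X) (hA : MeasurableSet A) : X →ₘ[μ] ℝ :=
  AEEqFun.mk (A.indicator fun _ => (1 : ℝ))
    (stronglyMeasurable_const.indicator hA).aestronglyMeasurable

theorem modular_charFn (hp : IsExponent μ p) {A : Set X} (hA : MeasurableSet A) :
    modular p (charFn μ A hA) = μ A := by
  rw [← lintegral_indicator_one hA]
  apply lintegral_congr_ae
  filter_upwards [AEEqFun.coeFn_mk (A.indicator fun _ => (1 : ℝ))
    (stronglyMeasurable_const.indicator hA).aestronglyMeasurable (μ := μ)] with x hx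
  have h1 : p x ≠ 0 := by linarith [hp.one_le x]
  unfold charFn
  rw [hx]
  by_cases hxA : x ∈ A <;> simp [hxA, Real.zero_rpow h1]

/-- The characteristic function of a set of finite measure, as a member of a Nakano space. -/
noncomputable def charN (hp : IsExponent μ p) (A : Set X) (hA : MeasurableSet A)
    (hfin : μ A < ∞) : nakano hp :=
  ⟨charFn μ A hA, by rw [mem_nakano, modular_charFn hp hA]; exact hfin⟩

end

/-- Isometric embeddings of Banach lattices between Nakano spaces: linear mappings which respect
the lattice operations and the norm. -/
structure IsometricLatticeEmbedding {X : Type u} {Y : Type v} [MeasurableSpace X]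
    [MeasurableSpace Y] {μ : Measure X} {ν : Measure Y} {p : X → ℝ} {q : Y → ℝ}
    (hp : IsExponent μ p) (hq : IsExponent ν q) extends nakano hp →ₗ[ℝ] nakano hq where
  map_sup' : ∀ f g : nakano hp, toFun (f ⊔ g) = toFun f ⊔ toFun g
  map_inf' : ∀ f g : nakano hp, toFun (f ⊓ g) = toFun f ⊓ toFun g
  norm_map' : ∀ f : nakano hp, ‖toFun f‖ = ‖f‖

/-! ### Density changes -/

section

variable {Y : Type v} [MeasurableSpace Y] {ν ν' : Measure Y} {q ζ : Y → ℝ}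

/-- The class, for the measure `ν'`, of the function `(dν/dν')^{1/q} f`, where `ζ = dν/dν'`. -/
noncomputable def densityChangeFn (hq : IsExponent ν q) (hζ : IsDensity ν ν' ζ)
    (f : Y →ₘ[ν] ℝ) : Y →ₘ[ν'] ℝ :=
  AEEqFun.mk (fun y => ζ y ^ (1 / q y) * f y)
    ((hζ.measurable.pow (measurable_const.div hq.measurable)).mul
      f.stronglyMeasurable.measurable).aestronglyMeasurable

theorem densityChangeFn_coe (hq : IsExponent ν q) (hζ : IsDensity ν ν' ζ) (f : Y →ₘ[ν] ℝ) :
    densityChangeFn hq hζ f =ᵐ[ν'] fun y => ζ y ^ (1 / q y) * f y :=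
  AEEqFun.coeFn_mk _ _

theorem modular_densityChangeFn (hq : IsExponent ν q) (hζ : IsDensity ν ν' ζ) (f : Y →ₘ[ν] ℝ) :
    modular q (densityChangeFn hq hζ f) = modular q f := by
  have h : ∀ g : Y → ℝ≥0∞, Measurable g →
      ∫⁻ y, g y ∂ν = ∫⁻ y, ((fun y => ENNReal.ofReal (ζ y)) * g) y ∂ν' := by
    intro g hg
    rw [hζ.eq_withDensity,
      lintegral_withDensity_eq_lintegral_mul _ hζ.measurable.ennreal_ofReal hg]
  unfold modular
  rw [h _ (measurable_modular_integrand hq.measurable f)]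
  apply lintegral_congr_ae
  filter_upwards [densityChangeFn_coe hq hζ f] with y hy
  have h0 := hζ.pos y
  have h1 : q y ≠ 0 := by linarith [hq.one_le y]
  rw [hy, Pi.mul_apply, ← ENNReal.ofReal_mul h0.le, abs_mul,
    Real.mul_rpow (abs_nonneg _) (abs_nonneg _), abs_of_nonneg (Real.rpow_nonneg h0.le _),
    ← Real.rpow_mul h0.le, one_div_mul_cancel h1, Real.rpow_one]

/-- The density change isomorphism `D f = (dν/dν')^{1/q} f` from `L_{q(·)}(Y, ν)` to
`L_{q(·)}(Y, ν')`, where `ζ = dν/dν'`. -/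
noncomputable def densityChange (hq : IsExponent ν q) (hζ : IsDensity ν ν' ζ) :
    nakano hq →ₗ[ℝ] nakano (hq.of_isDensity hζ) where
  toFun f := ⟨densityChangeFn hq hζ f, by
    rw [mem_nakano, modular_densityChangeFn]; exact f.2⟩
  map_add' f g := by
    apply Subtype.ext
    apply AEEqFun.ext
    filter_upwards [densityChangeFn_coe hq hζ (f + g : nakano hq), densityChangeFn_coe hq hζ f,
      densityChangeFn_coe hq hζ g, hζ.ac'.ae_le (AEEqFun.coeFn_add (f : Y →ₘ[ν] ℝ) g),
      AEEqFun.coeFn_add (densityChangeFn hq hζ f) (densityChangeFn hq hζ g)]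
      with y h1 h2 h3 h4 h5
    simp only [Submodule.coe_add] at h1 ⊢
    rw [h1, h5, Pi.add_apply, h2, h3, h4, Pi.add_apply, mul_add]
  map_smul' c f := by
    apply Subtype.ext
    apply AEEqFun.ext
    filter_upwards [densityChangeFn_coe hq hζ (c • f : nakano hq), densityChangeFn_coe hq hζ f,
      hζ.ac'.ae_le (AEEqFun.coeFn_smul c (f : Y →ₘ[ν] ℝ)),
      AEEqFun.coeFn_smul c (densityChangeFn hq hζ f)] with y h1 h2 h3 h4
    simp only [Submodule.coe_smul, RingHom.id_apply] at h1 ⊢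
    rw [h1, h4, Pi.smul_apply, h2, h3, Pi.smul_apply, smul_eq_mul, smul_eq_mul]
    ring

end

/-! ### The extension to the space of all measurable functions -/

/-- `T` is the extension to `L_0(X, μ)` of the mapping `θ` on `L_{p(·)}(X, μ)`: a vector lattice
homomorphism which respects suprema and which agrees with `θ` on `L_{p(·)}(X, μ)`. All existing
suprema are meant here. If `X` is `σ`-finite, these reduce to countable ones; in general, whether
respecting countable suprema alone determines `T` depends on the existence of measurable
cardinals. -/
structure IsExtension {X : Type u} {Y : Type v} [MeasurableSpace X] [MeasurableSpace Y]
    {μ : Measure X} {ν : Measure Y} {p : X → ℝ} {q : Y → ℝ} {hp : IsExponent μ p}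
    {hq : IsExponent ν q} (θ : nakano hp →ₗ[ℝ] nakano hq)
    (T : (X →ₘ[μ] ℝ) →ₗ[ℝ] (Y →ₘ[ν] ℝ)) : Prop where
  extends_map : ∀ f : nakano hp, T f = θ f
  map_sup : ∀ f g, T (f ⊔ g) = T f ⊔ T g
  map_inf : ∀ f g, T (f ⊓ g) = T f ⊓ T g
  map_isLUB : ∀ (S : Set (X →ₘ[μ] ℝ)) (f : X →ₘ[μ] ℝ), S.Nonempty → IsLUB S f →
    IsLUB (T '' S) (T f)

end NakanoSpace

/-! A lattice homomorphism preserves disjointness, and the modular is additive on disjoint elements.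
The isometry contributes that elements of modular 1 go to elements of modular 1. For three disjoint
non-zero elements this is enough: in terms of the values x, y, z of the modular on the three rays,
the image modulars satisfy φ(x) + ψ(y) + χ(z) = 1 whenever x + y + z = 1, which forces φ = ψ and φ
additive, hence φ the identity on [0, 1] (`eq_of_sum_eq_one`). If there are no three disjoint
non-null sets, dimension at least two leaves two atoms, on each of which p is constant; there a
comparison of growth near 0 replaces the functional equation (`modular_map_le_of_two`). In all cases
the modulars of a f and a θ f agree for small a > 0.

As a function of log a, the modular of a f is the moment generating function of p under the finite
measure |f|^p dμ. By analytic continuation the laws of p under |f|^p dμ and of q under |θ f|^q dν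
coincide (`map_energy_eq`). Total masses give preservation of the modular; supports show that θ
carries functions living where p ∈ C to functions living where q ∈ C
(`PreservesEnergy.exponent_mem`).

The images of the characteristic functions of the witness pieces are non-negative and disjoint.
Dividing by them is a density change, after which they are characteristic functions. Preservation of
the modular makes the embedding continuous along a possibly uncountable witness
(`PreservesEnergy.mul_map_eq_zero`), so that all sets of finite measure inherit this property and
χ_A f is sent to χ_{θA} θ f. Since the modular of χ_A is μ(A), measures are preserved.

The extension cuts a measurable function into bounded pieces of finite measure and glues their
images. That p goes to q is seen on the level sets kε ≤ p < (k+1)ε. -/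

namespace NakanoSpace

/-! ### Decompositions along a witness -/

section Witness

variable {X : Type u} [MeasurableSpace X] {μ : Measure X} {ι : Type u} {s : ι → Set X}

theorem IsWitness.exists_mem (hs : IsWitness μ s) (x : X) : ∃ i, x ∈ s i := by
  have : x ∈ ⋃ i, s i := by rw [hs.iUnion_eq]; trivial
  simpa using this

theorem IsWitness.eq_of_mem (hs : IsWitness μ s) {x : X} {i j : ι} (hi : x ∈ s i)
    (hj : x ∈ s j) : i = j := by
  by_contra h
  exact Set.disjoint_left.1 (hs.disjoint h) hi hj

theorem IsWitness.measure_eq_sum (hs : IsWitness μ s) :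
    μ = Measure.sum fun i => μ.restrict (s i) := by
  ext A hA
  rw [Measure.sum_apply _ hA, hs.measure_eq_tsum A hA]
  simp_rw [Measure.restrict_apply hA]

theorem IsWitness.lintegral_eq_tsum (hs : IsWitness μ s) (f : X → ℝ≥0∞) :
    ∫⁻ x, f x ∂μ = ∑' i, ∫⁻ x in s i, f x ∂μ := by
  conv_lhs => rw [hs.measure_eq_sum]
  rw [lintegral_sum_measure]

/-- The sum formula of a witness speaks of measurable sets only. Taking measurable hulls inside each
piece and uniting them gives a measurable null set containing A, however many pieces there are. -/
theorem IsWitness.measure_eq_zero (hs : IsWitness μ s) {A : Set X}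
    (hA : ∀ i, μ (A ∩ s i) = 0) : μ A = 0 := by
  have key : ∀ i, (⋃ j, toMeasurable μ (A ∩ s j) ∩ s j) ∩ s i = toMeasurable μ (A ∩ s i) ∩ s i := by
    intro i
    ext x
    simp only [Set.mem_inter_iff, Set.mem_iUnion]
    constructor
    · rintro ⟨⟨j, h1, h2⟩, h3⟩
      obtain rfl := hs.eq_of_mem h2 h3
      exact ⟨h1, h2⟩
    · rintro ⟨h1, h2⟩
      exact ⟨⟨i, h1, h2⟩, h2⟩
  have hmeas : MeasurableSet (⋃ j, toMeasurable μ (A ∩ s j) ∩ s j) := by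
    refine hs.measurable_of_inter _ fun i => ?_
    rw [key]
    exact (measurableSet_toMeasurable _ _).inter (hs.measurable i)
  have h0 : μ (⋃ j, toMeasurable μ (A ∩ s j) ∩ s j) = 0 := by
    rw [hs.measure_eq_tsum _ hmeas]
    simp_rw [key]
    refine ENNReal.tsum_eq_zero.2 fun i => ?_
    refine measure_mono_null Set.inter_subset_left ?_
    rw [measure_toMeasurable, hA]
  refine measure_mono_null (fun x hx => ?_) h0
  obtain ⟨i, hi⟩ := hs.exists_mem x
  exact Set.mem_iUnion.2 ⟨i, subset_toMeasurable _ _ ⟨hx, hi⟩, hi⟩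

theorem IsWitness.ae_of_forall (hs : IsWitness μ s) {P : X → Prop}
    (h : ∀ i, ∀ᵐ x ∂μ, x ∈ s i → P x) : ∀ᵐ x ∂μ, P x := by
  rw [ae_iff]
  refine hs.measure_eq_zero fun i => ?_
  refine measure_mono_null ?_ (ae_iff.1 (h i))
  rintro x ⟨hx, hxi⟩
  exact fun h' => hx (h' hxi)

/-- A finite sum over any index set, countable or not, has arbitrarily small tails. Applied to |f|^p
this approximates f in the modular by its restrictions to finitely many pieces. -/
theorem IsWitness.exists_finset_lintegral_lt (hs : IsWitness μ s) {f : X → ℝ≥0∞}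
    (hf : ∫⁻ x, f x ∂μ ≠ ∞) {ε : ℝ≥0∞} (hε : 0 < ε) :
    ∃ F : Finset ι, ∫⁻ x in (⋃ i ∈ F, s i)ᶜ, f x ∂μ < ε := by
  rw [hs.lintegral_eq_tsum] at hf
  have ht := ENNReal.tendsto_tsum_compl_atTop_zero hf
  obtain ⟨F, hF⟩ := ((tendsto_order.1 ht).2 ε hε).exists
  refine ⟨F, ?_⟩
  have hm : MeasurableSet (⋃ i ∈ F, s i) := F.measurableSet_biUnion fun i _ => hs.measurable i
  refine lt_of_le_of_lt (le_of_eq ?_) hF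
  have hg : ∀ A : Set X, MeasurableSet A → ∫⁻ x in A, f x ∂μ = ∑' i, ∫⁻ x in A ∩ s i, f x ∂μ := by
    intro A hA
    have : μ.restrict A = Measure.sum fun i => μ.restrict (A ∩ s i) := by
      conv_lhs => rw [hs.measure_eq_sum]
      rw [Measure.restrict_sum _ hA]
      congr 1
      ext1 i
      rw [Measure.restrict_restrict hA]
    rw [this, lintegral_sum_measure]
  rw [hg _ hm.compl]
  have : ∀ i, ∫⁻ x in (⋃ i ∈ F, s i)ᶜ ∩ s i, f x ∂μ
      = ({i | i ∉ F} : Set ι).indicator (fun i => ∫⁻ x in s i, f x ∂μ) i := by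
    intro i
    by_cases hi : i ∈ F
    · rw [Set.indicator_of_notMem (by simpa using hi)]
      have : (⋃ i ∈ F, s i)ᶜ ∩ s i = ∅ := by
        ext x
        simp only [Set.mem_inter_iff, Set.mem_compl_iff, Set.mem_iUnion, Set.mem_empty_iff_false,
          iff_false, not_and]
        exact fun h hx => h ⟨i, hi, hx⟩
      rw [this]; simp
    · rw [Set.indicator_of_mem (by simpa using hi)]
      have : (⋃ i ∈ F, s i)ᶜ ∩ s i = s i := by
        refine Set.inter_eq_right.2 fun x hx => ?_
        simp only [Set.mem_compl_iff, Set.mem_iUnion, not_exists]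
        intro j hj hxj
        exact hi (hs.eq_of_mem hx hxj ▸ hj)
      rw [this]
  simp_rw [this]
  exact (tsum_subtype {i | i ∉ F} _).symm

theorem IsWitness.exists_measure_inter_pos (hs : IsWitness μ s) {A : Set X} (hA : μ A ≠ 0) :
    ∃ i, 0 < μ (A ∩ s i) := by
  by_contra! h
  exact hA (hs.measure_eq_zero fun i => le_antisymm (h i) bot_le)

theorem IsWitness.measurable_of_forall {β : Type*} [MeasurableSpace β] (hs : IsWitness μ s)
    {f : X → β} {g : ι → X → β} (hg : ∀ i, Measurable (g i)) (h : ∀ i, ∀ x ∈ s i, f x = g i x) :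
    Measurable f := by
  intro B hB
  refine hs.measurable_of_inter _ fun i => ?_
  have : f ⁻¹' B ∩ s i = g i ⁻¹' B ∩ s i := by
    ext x
    simp only [Set.mem_inter_iff, Set.mem_preimage]
    constructor <;> rintro ⟨h1, h2⟩ <;> refine ⟨?_, h2⟩
    · rwa [← h i x h2]
    · rwa [h i x h2]
  rw [this]
  exact (hg i hB).inter (hs.measurable i)

theorem IsWitness.exists_measurable_glue {β : Type*} [MeasurableSpace β] (hs : IsWitness μ s)
    (g : ι → X → β) (hg : ∀ i, Measurable (g i)) :
    ∃ f : X → β, Measurable f ∧ ∀ i, ∀ x ∈ s i, f x = g i x := by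
  choose k hk using hs.exists_mem
  have h : ∀ i, ∀ x ∈ s i, g (k x) x = g i x := fun i x hx => by
    rw [hs.eq_of_mem (hk x) hx]
  exact ⟨fun x => g (k x) x, hs.measurable_of_forall hg h, h⟩

/-- A witness can be subdivided by countable measurable partitions of its pieces. -/
theorem IsWitness.subdivide (hs : IsWitness μ s) (k : ι → X → ℕ) (hk : ∀ i, Measurable (k i)) :
    IsWitness μ (fun z : ι × ℕ => s z.1 ∩ k z.1 ⁻¹' {z.2}) where
  disjoint := by
    rintro ⟨i, m⟩ ⟨j, n⟩ hne
    rw [Set.disjoint_left]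
    rintro x ⟨h1, h2⟩ ⟨h3, h4⟩
    obtain rfl := hs.eq_of_mem h1 h3
    have h2 : k i x = m := h2
    have h4 : k i x = n := h4
    exact hne (by rw [← h2, ← h4])
  iUnion_eq := by
    refine Set.eq_univ_of_forall fun x => ?_
    obtain ⟨i, hi⟩ := hs.exists_mem x
    exact Set.mem_iUnion.2 ⟨(i, k i x), hi, rfl⟩
  measurable z := (hs.measurable _).inter (hk _ (measurableSet_singleton _))
  finite z := (measure_mono Set.inter_subset_left).trans_lt (hs.finite z.1)
  measurable_of_inter A hA := by
    refine hs.measurable_of_inter A fun i => ?_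
    have : A ∩ s i = ⋃ n, A ∩ (s i ∩ k i ⁻¹' {n}) := by
      ext x; simp
    rw [this]
    exact MeasurableSet.iUnion fun n => hA (i, n)
  measure_eq_tsum A hA := by
    rw [hs.measure_eq_tsum A hA,
      ENNReal.tsum_prod (f := fun i n => μ (A ∩ (s i ∩ k i ⁻¹' {n})))]
    refine tsum_congr fun i => ?_
    have : A ∩ s i = ⋃ n, A ∩ (s i ∩ k i ⁻¹' {n}) := by
      ext x; simp
    rw [this, measure_iUnion]
    · intro m n hmn
      rw [Function.onFun, Set.disjoint_left]
      rintro x ⟨-, -, h2⟩ ⟨-, -, h4⟩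
      exact hmn (by rw [← (h2 : k i x = m), ← (h4 : k i x = n)])
    · exact fun n => hA.inter ((hs.measurable _).inter (hk _ (measurableSet_singleton _)))

/-- In a finite measure space, functions defined on essentially disjoint sets have a common
extension. -/
theorem exists_glue_of_finite [IsFiniteMeasure μ] {K : Type*} (S : K → Set X)
    (hS : ∀ k, MeasurableSet (S k)) (hd : Pairwise fun k l => μ (S k ∩ S l) = 0)
    (g : K → X → ℝ) (hg : ∀ k, Measurable (g k)) :
    ∃ (U : Set X) (f : X → ℝ), MeasurableSet U ∧ Measurable f ∧
      (∀ k, ∀ᵐ x ∂μ, x ∈ S k → x ∈ U ∧ f x = g k x) ∧ (∀ x ∉ U, f x = 0) ∧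
      ∀ B : Set X, (∀ k, μ (B ∩ S k) = 0) → μ (B ∩ U) = 0 := by
  -- A finite measure admits only countably many essentially disjoint sets of positive measure; the
  -- other `S k` impose no condition.
  set C : Set K := {k | 0 < μ (S k)} with hC
  have hcount : C.Countable :=
    Measure.countable_meas_pos_of_disjoint_iUnion₀ (fun k => (hS k).nullMeasurableSet) hd
  have : Countable C := hcount.to_subtype
  -- Removing the countably many null overlaps makes the sets disjoint everywhere.
  let N : C → Set X := fun k => S k \ ⋃ l : {l : C // l ≠ k}, S l.1
  have hN : ∀ k, MeasurableSet (N k) := fun k => (hS k).diff (MeasurableSet.iUnion fun l => hS _)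
  have hdis : ∀ k l : C, k ≠ l → ∀ x, x ∈ N k → x ∉ N l := by
    intro k l hkl x hx hx'
    exact hx.2 (Set.mem_iUnion.2 ⟨⟨l, hkl.symm⟩, hx'.1⟩)
  -- `none` stands for the remainder of the space, where the glued function is 0.
  let t : Option C → Set X := fun o => o.elim (⋃ k, N k)ᶜ N
  obtain ⟨f, hf, hft⟩ := exists_measurable_piecewise t
    (by rintro (_ | k); exacts [(MeasurableSet.iUnion hN).compl, hN k])
    (fun o => o.elim (fun _ => (0 : ℝ)) fun k => g k)
    (by
      rintro (_ | k)
      · exact (measurable_const : Measurable fun _ : X => (0 : ℝ))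
      · exact hg k)
    (by
      rintro (_ | k) (_ | l) hne x ⟨h1, h2⟩
      · exact absurd rfl hne
      · exact absurd (Set.mem_iUnion.2 ⟨l, h2⟩) h1
      · exact absurd (Set.mem_iUnion.2 ⟨k, h1⟩) h2
      · exact absurd h2 (hdis k l (fun h => hne (by rw [h])) x h1))
  refine ⟨⋃ k, N k, f, MeasurableSet.iUnion hN, hf, fun k => ?_, fun x hx => hft none hx, ?_⟩
  · by_cases hk : k ∈ C
    · have h0 : μ (⋃ l : {l : C // l ≠ ⟨k, hk⟩}, S k ∩ S l.1) = 0 := by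
        refine measure_iUnion_null fun l => hd ?_
        intro h
        exact l.2 (Subtype.ext h.symm)
      filter_upwards [measure_eq_zero_iff_ae_notMem.1 h0] with x hx hxk
      have hxN : x ∈ N ⟨k, hk⟩ := by
        refine ⟨hxk, fun h => hx ?_⟩
        rw [← Set.inter_iUnion]
        exact ⟨hxk, h⟩
      exact ⟨Set.mem_iUnion.2 ⟨_, hxN⟩, hft (some ⟨k, hk⟩) hxN⟩
    · have h0 : μ (S k) = 0 := by simpa [hC] using hk
      filter_upwards [measure_eq_zero_iff_ae_notMem.1 h0] with x hx hxk
      exact absurd hxk hx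
  · intro B hB
    rw [Set.inter_iUnion]
    exact measure_iUnion_null fun k =>
      measure_mono_null (Set.inter_subset_inter_right _ Set.sdiff_subset) (hB k)

/-- In a strictly localisable measure space, functions defined on essentially disjoint sets have a
common extension. -/
theorem IsWitness.exists_glue (hs : IsWitness μ s) {K : Type*} (S : K → Set X)
    (hS : ∀ k, MeasurableSet (S k)) (hd : Pairwise fun k l => μ (S k ∩ S l) = 0)
    (g : K → X → ℝ) (hg : ∀ k, Measurable (g k)) :
    ∃ (U : Set X) (f : X → ℝ), MeasurableSet U ∧ Measurable f ∧
      (∀ k, ∀ᵐ x ∂μ, x ∈ S k → x ∈ U ∧ f x = g k x) ∧ (∀ x ∉ U, f x = 0) ∧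
      ∀ B : Set X, (∀ k, μ (B ∩ S k) = 0) → μ (B ∩ U) = 0 := by
  have hloc : ∀ i, ∃ (U : Set X) (f : X → ℝ), MeasurableSet U ∧ Measurable f ∧
      (∀ k, ∀ᵐ x ∂μ.restrict (s i), x ∈ S k → x ∈ U ∧ f x = g k x) ∧ (∀ x ∉ U, f x = 0) ∧
      ∀ B : Set X, (∀ k, μ.restrict (s i) (B ∩ S k) = 0) → μ.restrict (s i) (B ∩ U) = 0 := by
    intro i
    have : IsFiniteMeasure (μ.restrict (s i)) := ⟨by simpa using hs.finite i⟩
    refine exists_glue_of_finite S hS (fun k l hkl => ?_) g hg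
    exact le_antisymm ((Measure.restrict_apply_le _ _).trans (hd hkl).le) bot_le
  choose U f hU hf h1 h2 h3 using hloc
  obtain ⟨F, hF, hFi⟩ := hs.exists_measurable_glue f hf
  have hVi : ∀ i, (⋃ j, U j ∩ s j) ∩ s i = U i ∩ s i := by
    intro i
    ext x
    simp only [Set.mem_inter_iff, Set.mem_iUnion]
    constructor
    · rintro ⟨⟨j, h4, h5⟩, h6⟩
      obtain rfl := hs.eq_of_mem h5 h6
      exact ⟨h4, h5⟩
    · rintro ⟨h4, h5⟩
      exact ⟨⟨i, h4, h5⟩, h5⟩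
  have hV : MeasurableSet (⋃ j, U j ∩ s j) := by
    refine hs.measurable_of_inter _ fun i => ?_
    rw [hVi]
    exact (hU i).inter (hs.measurable i)
  refine ⟨⋃ j, U j ∩ s j, F, hV, hF, fun k => ?_, fun x hx => ?_, fun B hB => ?_⟩
  · refine hs.ae_of_forall fun i => ?_
    filter_upwards [(ae_restrict_iff' (hs.measurable i)).1 (h1 i k)] with x hx hxi hxk
    obtain ⟨h4, h5⟩ := hx hxi hxk
    exact ⟨Set.mem_iUnion.2 ⟨i, h4, hxi⟩, by rw [hFi i x hxi, h5]⟩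
  · obtain ⟨i, hi⟩ := hs.exists_mem x
    rw [hFi i x hi]
    exact h2 i x fun h => hx (Set.mem_iUnion.2 ⟨i, h, hi⟩)
  · refine hs.measure_eq_zero fun i => ?_
    rw [Set.inter_assoc, hVi, ← Set.inter_assoc, ← Measure.restrict_apply' (hs.measurable i)]
    refine h3 i B fun k => ?_
    exact le_antisymm ((Measure.restrict_apply_le _ _).trans (hB k).le) bot_le

end Witness

/-! ### Finite measures with equal Laplace transforms -/

/-- With all exponential moments finite, both complex moment generating functions are entire. They
agree on a real half-line, hence everywhere by the identity theorem, and they determine the laws. -/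
theorem map_eq_of_mgf_eqOn_Iio {Ω Ω' : Type*} [MeasurableSpace Ω] [MeasurableSpace Ω']
    {m : Measure Ω} {m' : Measure Ω'} [IsFiniteMeasure m] [IsFiniteMeasure m'] {f : Ω → ℝ}
    {g : Ω' → ℝ} (hf : Measurable f) (hg : Measurable g)
    (hfi : ∀ t : ℝ, Integrable (fun ω => Real.exp (t * f ω)) m)
    (hgi : ∀ t : ℝ, Integrable (fun ω => Real.exp (t * g ω)) m') {t₀ : ℝ}
    (h : ∀ t < t₀, ProbabilityTheory.mgf f m t = ProbabilityTheory.mgf g m' t) :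
    m.map f = m'.map g := by
  have hfu : ProbabilityTheory.integrableExpSet f m = Set.univ := Set.eq_univ_of_forall hfi
  have hgu : ProbabilityTheory.integrableExpSet g m' = Set.univ := Set.eq_univ_of_forall hgi
  refine Measure.ext_of_complexMGF_eq hf.aemeasurable hg.aemeasurable ?_
  have hX : AnalyticOnNhd ℂ (ProbabilityTheory.complexMGF f m) Set.univ := by
    have := ProbabilityTheory.analyticOnNhd_complexMGF (X := f) (μ := m)
    simpa [hfu] using this
  have hY : AnalyticOnNhd ℂ (ProbabilityTheory.complexMGF g m') Set.univ := by
    have := ProbabilityTheory.analyticOnNhd_complexMGF (X := g) (μ := m')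
    simpa [hgu] using this
  refine hX.eq_of_frequently_eq hY (z₀ := ((t₀ - 1 : ℝ) : ℂ)) ?_
  have hreal : ∃ᶠ x : ℝ in nhdsWithin (t₀ - 1) {t₀ - 1}ᶜ,
      ProbabilityTheory.complexMGF f m x = ProbabilityTheory.complexMGF g m' x := by
    refine Filter.Eventually.frequently ?_
    have : ∀ᶠ x : ℝ in nhds (t₀ - 1), x < t₀ := eventually_lt_nhds (by linarith)
    filter_upwards [nhdsWithin_le_nhds this] with x hx
    rw [ProbabilityTheory.complexMGF_ofReal, ProbabilityTheory.complexMGF_ofReal, h x hx]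
  have ht : Filter.Tendsto (fun x : ℝ => (x : ℂ)) (nhdsWithin (t₀ - 1) {t₀ - 1}ᶜ)
      (nhdsWithin ((t₀ - 1 : ℝ) : ℂ) {((t₀ - 1 : ℝ) : ℂ)}ᶜ) := by
    refine Complex.continuous_ofReal.continuousWithinAt.tendsto_nhdsWithin ?_
    intro x hx
    simpa only [Set.mem_compl_iff, Set.mem_singleton_iff, Complex.ofReal_inj] using hx
  exact ht.frequently hreal

/-! ### The modular functional -/

section Modular

variable {X : Type u} [MeasurableSpace X] {μ : Measure X} {p : X → ℝ}

/-- The measure with density `|f| ^ p`. -/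
noncomputable def energy (p : X → ℝ) (f : X →ₘ[μ] ℝ) : Measure X :=
  μ.withDensity fun x => ENNReal.ofReal (|f x| ^ p x)

theorem energy_univ (f : X →ₘ[μ] ℝ) : energy p f Set.univ = modular p f := by
  rw [energy, withDensity_apply _ MeasurableSet.univ, Measure.restrict_univ, modular]

theorem energy_absolutelyContinuous (f : X →ₘ[μ] ℝ) : energy p f ≪ μ :=
  withDensity_absolutelyContinuous _ _

theorem isFiniteMeasure_energy {hp : IsExponent μ p} (f : nakano hp) :
    IsFiniteMeasure (energy p (f : X →ₘ[μ] ℝ)) :=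
  ⟨by rw [energy_univ]; exact f.2⟩

theorem modular_mono (hp : IsExponent μ p) {f g : X →ₘ[μ] ℝ} (h : ∀ᵐ x ∂μ, |f x| ≤ |g x|) :
    modular p f ≤ modular p g := by
  refine lintegral_mono_ae ?_
  filter_upwards [h] with x hx
  exact ENNReal.ofReal_le_ofReal
    (Real.rpow_le_rpow (abs_nonneg _) hx (zero_le_one.trans (hp.one_le x)))

theorem modular_eq_zero (hp : IsExponent μ p) {f : X →ₘ[μ] ℝ} (h : modular p f = 0) :
    ∀ᵐ x ∂μ, f x = 0 := by
  rw [modular, lintegral_eq_zero_iff (measurable_modular_integrand hp.measurable f)] at h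
  filter_upwards [h] with x hx
  by_contra hne
  have : 0 < |f x| ^ p x := Real.rpow_pos_of_pos (abs_pos.2 hne) _
  simp only [Pi.zero_apply, ENNReal.ofReal_eq_zero] at hx
  linarith

theorem eq_zero_of_modular_eq_zero (hp : IsExponent μ p) {f : X →ₘ[μ] ℝ} (h : modular p f = 0) :
    f = 0 := by
  refine AEEqFun.ext ?_
  filter_upwards [modular_eq_zero hp h, AEEqFun.coeFn_zero (α := X) (β := ℝ) (μ := μ)]
    with x hx h0
  rw [hx, h0, Pi.zero_apply]

theorem modular_add_of_disjoint (hp : IsExponent μ p) {f g : X →ₘ[μ] ℝ}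
    (h : ∀ᵐ x ∂μ, f x * g x = 0) : modular p (f + g) = modular p f + modular p g := by
  unfold modular
  rw [← lintegral_add_left (measurable_modular_integrand hp.measurable f)]
  refine lintegral_congr_ae ?_
  filter_upwards [h, AEEqFun.coeFn_add f g] with x hx hfg
  have hp0 : p x ≠ 0 := by linarith [hp.one_le x]
  rw [hfg, Pi.add_apply]
  rcases mul_eq_zero.1 hx with h0 | h0 <;> simp [h0, Real.zero_rpow hp0]

theorem lintegral_energy (hp : IsExponent μ p) (f : X →ₘ[μ] ℝ) {g : X → ℝ≥0∞}
    (hg : Measurable g) :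
    ∫⁻ x, g x ∂energy p f = ∫⁻ x, ENNReal.ofReal (|f x| ^ p x) * g x ∂μ := by
  rw [energy, lintegral_withDensity_eq_lintegral_mul _
    (measurable_modular_integrand hp.measurable f) hg]
  rfl

theorem modular_smul (hp : IsExponent μ p) (a : ℝ) (f : X →ₘ[μ] ℝ) :
    modular p (a • f) = ∫⁻ x, ENNReal.ofReal (|a| ^ p x) ∂energy p f := by
  rw [lintegral_energy hp f ((measurable_const.pow hp.measurable).ennreal_ofReal), modular]
  refine lintegral_congr_ae ?_
  filter_upwards [AEEqFun.coeFn_smul a f] with x hx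
  rw [hx, Pi.smul_apply, smul_eq_mul, abs_mul, Real.mul_rpow (abs_nonneg _) (abs_nonneg _),
    mul_comm, ENNReal.ofReal_mul (Real.rpow_nonneg (abs_nonneg _) _)]

theorem ae_energy_le (hp : IsExponent μ p) :
    ∃ r : ℝ, 1 ≤ r ∧ ∀ f : X →ₘ[μ] ℝ, ∀ᵐ x ∂energy p f, p x ≤ r := by
  obtain ⟨r, hr⟩ := hp.essBdd
  refine ⟨max 1 r, le_max_left _ _, fun f => ?_⟩
  filter_upwards [(energy_absolutelyContinuous f).ae_le hr] with x hx
  exact hx.trans (le_max_right _ _)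

theorem integrable_exp_energy (hp : IsExponent μ p) (f : nakano hp) (t : ℝ) :
    Integrable (fun x => Real.exp (t * p x)) (energy p (f : X →ₘ[μ] ℝ)) := by
  have := isFiniteMeasure_energy f
  obtain ⟨r, hr1, hr⟩ := ae_energy_le hp
  refine Integrable.of_bound (C := Real.exp (|t| * r))
    (Real.measurable_exp.comp (measurable_const.mul hp.measurable)).aestronglyMeasurable ?_
  filter_upwards [hr f] with x hx
  rw [Real.norm_eq_abs, Real.abs_exp]
  refine Real.exp_le_exp.2 ?_
  have h1 := hp.one_le x
  calc t * p x ≤ |t| * p x := by gcongr; exact le_abs_self t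
    _ ≤ |t| * r := by gcongr

/-- Since (e^t |f|)^p = e^{tp} |f|^p, the modular along a ray is a Laplace transform of the law of
p. This is the bridge from norms to the distribution of the exponent. -/
theorem modular_exp_smul (hp : IsExponent μ p) (f : nakano hp) (t : ℝ) :
    modular p (Real.exp t • (f : X →ₘ[μ] ℝ))
      = ENNReal.ofReal (ProbabilityTheory.mgf p (energy p (f : X →ₘ[μ] ℝ)) t) := by
  rw [modular_smul hp, ProbabilityTheory.mgf, ofReal_integral_eq_lintegral_ofReal
    (integrable_exp_energy hp f t) (Filter.Eventually.of_forall fun _ => (Real.exp_pos _).le)]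
  simp_rw [Real.abs_exp, ← Real.exp_mul]

/-- The modular functional takes all positive values on each ray of a Nakano space. -/
theorem exists_modular_smul_eq (hp : IsExponent μ p) {f : nakano hp}
    (hf : (f : X →ₘ[μ] ℝ) ≠ 0) {c : ℝ} (hc : 0 < c) :
    ∃ a : ℝ, 0 < a ∧ modular p (a • (f : X →ₘ[μ] ℝ)) = ENNReal.ofReal c := by
  have hfin := isFiniteMeasure_energy f
  set m := energy p (f : X →ₘ[μ] ℝ) with hm
  have hcont : Continuous (ProbabilityTheory.mgf p m) :=
    ProbabilityTheory.continuous_mgf (integrable_exp_energy hp f)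
  set M := ProbabilityTheory.mgf p m 0 with hM
  have hM0 : 0 < M := by
    have h0 : m ≠ 0 := by
      intro h
      refine hf (eq_zero_of_modular_eq_zero hp ?_)
      rw [← energy_univ, ← hm, h]; simp
    exact ProbabilityTheory.mgf_pos' h0 (integrable_exp_energy hp f 0)
  -- Here p ≥ 1 is used: comparison with e^t M makes the modular unbounded as t → ∞, and the reverse
  -- comparison below makes it tend to 0 as t → -∞.
  have hup : ∀ t, 0 ≤ t → Real.exp t * M ≤ ProbabilityTheory.mgf p m t := by
    intro t ht
    rw [hM, ProbabilityTheory.mgf, ProbabilityTheory.mgf, ← integral_const_mul]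
    refine integral_mono ((integrable_exp_energy hp f 0).const_mul _)
      (integrable_exp_energy hp f t) fun x => ?_
    simp only [zero_mul, Real.exp_zero, mul_one]
    exact Real.exp_le_exp.2 (le_mul_of_one_le_right ht (hp.one_le x))
  have hdown : ∀ t, t ≤ 0 → ProbabilityTheory.mgf p m t ≤ Real.exp t * M := by
    intro t ht
    rw [hM, ProbabilityTheory.mgf, ProbabilityTheory.mgf, ← integral_const_mul]
    refine integral_mono (integrable_exp_energy hp f t)
      ((integrable_exp_energy hp f 0).const_mul _) fun x => ?_
    simp only [zero_mul, Real.exp_zero, mul_one]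
    refine Real.exp_le_exp.2 ?_
    nlinarith [hp.one_le x]
  -- Intermediate values: e^t M equals c at t = log (c / M), and truncating this t at 0 keeps it in
  -- the range of the relevant comparison.
  obtain ⟨t, ht⟩ : ∃ t, ProbabilityTheory.mgf p m t = c := by
    refine mem_range_of_exists_le_of_exists_ge hcont
      ⟨min 0 (Real.log (c / M)), ?_⟩ ⟨max 0 (Real.log (c / M)), ?_⟩
    · refine (hdown _ (min_le_left _ _)).trans ?_
      have : Real.exp (min 0 (Real.log (c / M))) ≤ c / M := by
        calc _ ≤ Real.exp (Real.log (c / M)) := Real.exp_le_exp.2 (min_le_right _ _)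
          _ = c / M := Real.exp_log (div_pos hc hM0)
      calc _ ≤ c / M * M := by gcongr
        _ = c := div_mul_cancel₀ _ hM0.ne'
    · refine le_trans ?_ (hup _ (le_max_left _ _))
      have : c / M ≤ Real.exp (max 0 (Real.log (c / M))) := by
        calc c / M = Real.exp (Real.log (c / M)) := (Real.exp_log (div_pos hc hM0)).symm
          _ ≤ _ := Real.exp_le_exp.2 (le_max_right _ _)
      calc c = c / M * M := (div_mul_cancel₀ _ hM0.ne').symm
        _ ≤ _ := by gcongr
  exact ⟨Real.exp t, Real.exp_pos t, by rw [modular_exp_smul, ← hm, ht]⟩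

/-- The distributions of the exponents with respect to `|f| ^ p dμ` and `|g| ^ q dν` agree as soon
as the modular functionals agree on small multiples of `f` and `g`. -/
theorem map_energy_eq {Y : Type v} [MeasurableSpace Y] {ν : Measure Y} {q : Y → ℝ}
    (hp : IsExponent μ p) (hq : IsExponent ν q) (f : nakano hp) (g : nakano hq) {a₀ : ℝ}
    (ha₀ : 0 < a₀) (h : ∀ a : ℝ, 0 < a → a < a₀ →
      modular q (a • (g : Y →ₘ[ν] ℝ)) = modular p (a • (f : X →ₘ[μ] ℝ))) :
    (energy p (f : X →ₘ[μ] ℝ)).map p = (energy q (g : Y →ₘ[ν] ℝ)).map q := by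
  have := isFiniteMeasure_energy f
  have := isFiniteMeasure_energy g
  refine map_eq_of_mgf_eqOn_Iio hp.measurable hq.measurable (integrable_exp_energy hp f)
    (integrable_exp_energy hq g) (t₀ := Real.log a₀) fun t ht => ?_
  have h1 := h (Real.exp t) (Real.exp_pos t) ((Real.lt_log_iff_exp_lt ha₀).1 ht)
  rw [modular_exp_smul, modular_exp_smul,
    ENNReal.ofReal_eq_ofReal_iff ProbabilityTheory.mgf_nonneg ProbabilityTheory.mgf_nonneg] at h1
  exact h1.symm

end Modular

/-! ### Band projections and elementary properties of embeddings -/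

section Band

variable {X : Type u} [MeasurableSpace X] {μ : Measure X} {p : X → ℝ}

theorem charFn_coe {A : Set X} (hA : MeasurableSet A) :
    ∀ᵐ x ∂μ, charFn μ A hA x = A.indicator (fun _ => (1 : ℝ)) x :=
  AEEqFun.coeFn_mk _ _

theorem charFn_mul_coe {A : Set X} (hA : MeasurableSet A) (f : X →ₘ[μ] ℝ) :
    ∀ᵐ x ∂μ, (charFn μ A hA * f : X →ₘ[μ] ℝ) x = A.indicator f x := by
  filter_upwards [charFn_coe (μ := μ) hA, AEEqFun.coeFn_mul (charFn μ A hA) f] with x h1 h2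
  rw [h2, Pi.mul_apply, h1]
  by_cases hx : x ∈ A <;> simp [hx]

theorem mem_nakano_of_abs_le {hp : IsExponent μ p} {f g : X →ₘ[μ] ℝ} (hg : g ∈ nakano hp)
    (h : ∀ᵐ x ∂μ, |f x| ≤ |g x|) : f ∈ nakano hp :=
  lt_of_le_of_lt (modular_mono hp h) hg

/-- Multiplication with a characteristic function, as an operator on a Nakano space. -/
noncomputable def band {hp : IsExponent μ p} (A : Set X) (hA : MeasurableSet A)
    (f : nakano hp) : nakano hp :=
  ⟨charFn μ A hA * (f : X →ₘ[μ] ℝ), mem_nakano_of_abs_le f.2 (by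
    filter_upwards [charFn_mul_coe hA (f : X →ₘ[μ] ℝ)] with x hx
    rw [hx]
    by_cases h : x ∈ A <;> simp [h])⟩

theorem band_coe {hp : IsExponent μ p} {A : Set X} (hA : MeasurableSet A) (f : nakano hp) :
    ∀ᵐ x ∂μ, (band A hA f : X →ₘ[μ] ℝ) x = A.indicator (f : X →ₘ[μ] ℝ) x :=
  charFn_mul_coe hA _

theorem add_coe {hp : IsExponent μ p} (f g : nakano hp) :
    ∀ᵐ x ∂μ, ((f + g : nakano hp) : X →ₘ[μ] ℝ) x = (f : X →ₘ[μ] ℝ) x + (g : X →ₘ[μ] ℝ) x := by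
  filter_upwards [AEEqFun.coeFn_add (f : X →ₘ[μ] ℝ) g] with x hx
  rw [Submodule.coe_add, hx, Pi.add_apply]

theorem smul_coe {hp : IsExponent μ p} (a : ℝ) (f : nakano hp) :
    ∀ᵐ x ∂μ, ((a • f : nakano hp) : X →ₘ[μ] ℝ) x = a * (f : X →ₘ[μ] ℝ) x := by
  filter_upwards [AEEqFun.coeFn_smul a (f : X →ₘ[μ] ℝ)] with x hx
  rw [Submodule.coe_smul, hx, Pi.smul_apply, smul_eq_mul]

theorem sup_coe {hp : IsExponent μ p} (f g : nakano hp) :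
    ∀ᵐ x ∂μ, ((f ⊔ g : nakano hp) : X →ₘ[μ] ℝ) x = (f : X →ₘ[μ] ℝ) x ⊔ (g : X →ₘ[μ] ℝ) x :=
  AEEqFun.coeFn_sup (f : X →ₘ[μ] ℝ) g

theorem inf_coe {hp : IsExponent μ p} (f g : nakano hp) :
    ∀ᵐ x ∂μ, ((f ⊓ g : nakano hp) : X →ₘ[μ] ℝ) x = (f : X →ₘ[μ] ℝ) x ⊓ (g : X →ₘ[μ] ℝ) x :=
  AEEqFun.coeFn_inf (f : X →ₘ[μ] ℝ) g

theorem zero_coe {hp : IsExponent μ p} :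
    ∀ᵐ x ∂μ, ((0 : nakano hp) : X →ₘ[μ] ℝ) x = 0 :=
  AEEqFun.coeFn_zero (α := X) (β := ℝ) (μ := μ)

theorem ext_ae {hp : IsExponent μ p} {f g : nakano hp}
    (h : ∀ᵐ x ∂μ, (f : X →ₘ[μ] ℝ) x = (g : X →ₘ[μ] ℝ) x) : f = g :=
  Subtype.ext (AEEqFun.ext h)

theorem ae_eq_of_eq {hp : IsExponent μ p} {f g : nakano hp} (h : f = g) :
    ∀ᵐ x ∂μ, (f : X →ₘ[μ] ℝ) x = (g : X →ₘ[μ] ℝ) x := by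
  rw [h]; exact Filter.Eventually.of_forall fun _ => rfl

theorem sup_neg_coe {hp : IsExponent μ p} (f : nakano hp) :
    ∀ᵐ x ∂μ, ((f ⊔ (-1 : ℝ) • f : nakano hp) : X →ₘ[μ] ℝ) x = |(f : X →ₘ[μ] ℝ) x| := by
  filter_upwards [sup_coe f ((-1 : ℝ) • f), smul_coe (-1) f] with x h1 h2
  rw [h1, h2, neg_one_mul, abs]

theorem le_iff_ae {hp : IsExponent μ p} {f g : nakano hp} :
    f ≤ g ↔ ∀ᵐ x ∂μ, (f : X →ₘ[μ] ℝ) x ≤ (g : X →ₘ[μ] ℝ) x :=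
  (AEEqFun.coeFn_le (f := (f : X →ₘ[μ] ℝ)) (g := (g : X →ₘ[μ] ℝ))).symm

/-- Some multiple a f has modular exactly 1, so the norm of f is 1/a and a = 1. For f = 0 the norm
is the infimum of all positive numbers, that is 0. -/
theorem modular_eq_one_of_norm_eq_one (hp : IsExponent μ p) {f : nakano hp} (h : ‖f‖ = 1) :
    modular p (f : X →ₘ[μ] ℝ) = 1 := by
  by_cases hf : (f : X →ₘ[μ] ℝ) = 0
  · exfalso
    have : {c : ℝ | 0 < c ∧ modular p (c⁻¹ • (f : X →ₘ[μ] ℝ)) ≤ 1} = Set.Ioi 0 := by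
      ext c
      simp [hf, modular_zero hp]
    rw [norm_def, this, csInf_Ioi] at h
    exact zero_ne_one h
  · obtain ⟨a, ha, h1⟩ := exists_modular_smul_eq hp hf one_pos
    have := norm_eq_of_modular_eq_one hp f (inv_pos.2 ha)
      (by rw [inv_inv, h1, ENNReal.ofReal_one])
    rw [h] at this
    have ha1 : a = 1 := inv_eq_one.1 this.symm
    rwa [ha1, one_smul, ENNReal.ofReal_one] at h1

end Band

/-! ### Order, disjointness and the unit sphere under an embedding -/

namespace IsometricLatticeEmbedding

variable {X : Type u} {Y : Type v} [MeasurableSpace X] [MeasurableSpace Y] {μ : Measure X}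
  {ν : Measure Y} {p : X → ℝ} {q : Y → ℝ} {hp : IsExponent μ p} {hq : IsExponent ν q}

instance : CoeFun (IsometricLatticeEmbedding hp hq) fun _ => nakano hp → nakano hq :=
  ⟨fun θ => θ.toLinearMap⟩

variable (θ : IsometricLatticeEmbedding hp hq)

theorem map_sup (f g : nakano hp) : θ (f ⊔ g) = θ f ⊔ θ g := θ.map_sup' f g

theorem map_inf (f g : nakano hp) : θ (f ⊓ g) = θ f ⊓ θ g := θ.map_inf' f g

theorem map_mono {f g : nakano hp} (h : f ≤ g) : θ f ≤ θ g := by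
  rw [← sup_eq_right, ← θ.map_sup, sup_eq_right.2 h]

theorem map_mono_ae {f g : nakano hp} (h : ∀ᵐ x ∂μ, (f : X →ₘ[μ] ℝ) x ≤ (g : X →ₘ[μ] ℝ) x) :
    ∀ᵐ y ∂ν, (θ f : Y →ₘ[ν] ℝ) y ≤ (θ g : Y →ₘ[ν] ℝ) y :=
  le_iff_ae.1 (θ.map_mono (le_iff_ae.2 h))

theorem map_nonneg_ae {f : nakano hp} (h : ∀ᵐ x ∂μ, 0 ≤ (f : X →ₘ[μ] ℝ) x) :
    ∀ᵐ y ∂ν, 0 ≤ (θ f : Y →ₘ[ν] ℝ) y := by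
  have h1 : ∀ᵐ x ∂μ, ((0 : nakano hp) : X →ₘ[μ] ℝ) x ≤ (f : X →ₘ[μ] ℝ) x := by
    filter_upwards [h, zero_coe (hp := hp)] with x h2 h3
    rwa [h3]
  filter_upwards [θ.map_mono_ae h1, zero_coe (hp := hq)] with y h2 h3
  rw [map_zero] at h2
  rwa [h3] at h2

theorem map_abs_ae (f : nakano hp) :
    ∀ᵐ y ∂ν, (θ (f ⊔ (-1 : ℝ) • f) : Y →ₘ[ν] ℝ) y = |(θ f : Y →ₘ[ν] ℝ) y| := by
  rw [θ.map_sup, map_smul]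
  exact sup_neg_coe _

/-- Disjointness is the lattice identity |f| ⊓ |g| = 0, where |f| is f ⊔ (-f). -/
theorem map_disjoint_ae {f g : nakano hp}
    (h : ∀ᵐ x ∂μ, (f : X →ₘ[μ] ℝ) x * (g : X →ₘ[μ] ℝ) x = 0) :
    ∀ᵐ y ∂ν, (θ f : Y →ₘ[ν] ℝ) y * (θ g : Y →ₘ[ν] ℝ) y = 0 := by
  have h0 : (f ⊔ (-1 : ℝ) • f) ⊓ (g ⊔ (-1 : ℝ) • g) = 0 := by
    refine ext_ae ?_
    filter_upwards [h, inf_coe (f ⊔ (-1 : ℝ) • f) (g ⊔ (-1 : ℝ) • g), sup_neg_coe f,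
      sup_neg_coe g, zero_coe (hp := hp)] with x h1 h2 h3 h4 h5
    rw [h2, h3, h4, h5]
    rcases mul_eq_zero.1 h1 with h6 | h6 <;> simp [h6]
  have h1 := congrArg (fun u => (θ u)) h0
  simp only [θ.map_inf, map_zero] at h1
  filter_upwards [ae_eq_of_eq h1, inf_coe (θ (f ⊔ (-1 : ℝ) • f)) (θ (g ⊔ (-1 : ℝ) • g)),
    θ.map_abs_ae f, θ.map_abs_ae g, zero_coe (hp := hq)] with y h2 h3 h4 h5 h6
  rw [h3, h4, h5, h6] at h2
  rcases min_choice |(θ f : Y →ₘ[ν] ℝ) y| |(θ g : Y →ₘ[ν] ℝ) y| with h7 | h7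
  · rw [mul_eq_zero]; left
    exact abs_eq_zero.1 (h7.symm.trans h2)
  · rw [mul_eq_zero]; right
    exact abs_eq_zero.1 (h7.symm.trans h2)

theorem map_abs_le_ae {f g : nakano hp}
    (h : ∀ᵐ x ∂μ, |(f : X →ₘ[μ] ℝ) x| ≤ (g : X →ₘ[μ] ℝ) x) :
    ∀ᵐ y ∂ν, |(θ f : Y →ₘ[ν] ℝ) y| ≤ (θ g : Y →ₘ[ν] ℝ) y := by
  have h1 : ∀ᵐ x ∂μ, ((f ⊔ (-1 : ℝ) • f : nakano hp) : X →ₘ[μ] ℝ) x ≤ (g : X →ₘ[μ] ℝ) x := by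
    filter_upwards [h, sup_neg_coe f] with x h2 h3
    rwa [h3]
  filter_upwards [θ.map_mono_ae h1, θ.map_abs_ae f] with y h2 h3
  rwa [h3] at h2

/-- The form in which isometry is used: the unit sphere is the set of elements of modular 1 on both
sides. -/
theorem modular_map_eq_one {f : nakano hp} (h : modular p (f : X →ₘ[μ] ℝ) = 1) :
    modular q (θ f : Y →ₘ[ν] ℝ) = 1 := by
  refine modular_eq_one_of_norm_eq_one hq ?_
  rw [show ‖θ f‖ = ‖f‖ from θ.norm_map' f]
  exact norm_eq_of_modular_eq_one hp f one_pos (by rw [inv_one, one_smul, h])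

end IsometricLatticeEmbedding

/-! ### A functional equation -/

/-- Cauchy's equation on [0, 1]: positivity makes φ monotone, additivity fixes the rational points,
and x is squeezed between neighbouring multiples of 1/n. -/
theorem eq_self_of_additive {φ : ℝ → ℝ} (h0 : ∀ x, 0 ≤ x → x ≤ 1 → 0 ≤ φ x) (h1 : φ 1 = 1)
    (hadd : ∀ x y, 0 ≤ x → 0 ≤ y → x + y ≤ 1 → φ (x + y) = φ x + φ y) {x : ℝ} (hx : 0 ≤ x)
    (hx1 : x ≤ 1) : φ x = x := by
  have hmono : ∀ a b, 0 ≤ a → a ≤ b → b ≤ 1 → φ a ≤ φ b := by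
    intro a b ha hab hb
    have := hadd a (b - a) ha (by linarith) (by linarith)
    rw [add_sub_cancel] at this
    linarith [h0 (b - a) (by linarith) (by linarith)]
  have hφ0 : φ 0 = 0 := by
    have := hadd 0 0 le_rfl le_rfl (by norm_num)
    rw [add_zero] at this
    linarith
  have hk : ∀ n : ℕ, 0 < n → ∀ k : ℕ, k ≤ n → φ (k / n) = k * φ (1 / n) := by
    intro n hn k
    have hn' : (0 : ℝ) < n := by exact_mod_cast hn
    induction k with
    | zero => intro _; simp [hφ0]
    | succ k ih =>
      intro hkn
      have hkn' : ((k : ℝ) + 1) ≤ n := by exact_mod_cast hkn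
      have e : ((k + 1 : ℕ) : ℝ) / n = k / n + 1 / n := by push_cast; ring
      rw [e, hadd _ _ (by positivity) (by positivity), ih (by omega)]
      · push_cast; ring
      · rw [← add_div]
        exact (div_le_one hn').2 hkn'
  have hrat : ∀ n : ℕ, 0 < n → ∀ k : ℕ, k ≤ n → φ (k / n) = k / n := by
    intro n hn k hkn
    have hn' : (n : ℝ) ≠ 0 := by exact_mod_cast hn.ne'
    have h2 := hk n hn n le_rfl
    rw [div_self hn', h1] at h2
    have h3 : φ (1 / n) = 1 / n := by field_simp; linarith
    rw [hk n hn k hkn, h3]; ring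
  have hclose : ∀ n : ℕ, 0 < n → |φ x - x| ≤ 1 / n := by
    intro n hn
    have hn' : (0 : ℝ) < n := by exact_mod_cast hn
    -- For x = 1 the upper neighbour (⌊n x⌋ + 1) / n would leave [0, 1].
    rcases hx1.eq_or_lt with rfl | hx1
    · rw [h1]; simp
    have hfl : (⌊n * x⌋₊ : ℝ) ≤ n * x := Nat.floor_le (by positivity)
    have hfu : n * x < ⌊n * x⌋₊ + 1 := Nat.lt_floor_add_one _
    have hkn : ⌊n * x⌋₊ + 1 ≤ n := by
      have : (⌊n * x⌋₊ : ℝ) < n := by nlinarith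
      have : ⌊n * x⌋₊ < n := by exact_mod_cast this
      omega
    have e1 := hrat n hn ⌊n * x⌋₊ (by omega)
    have e2 := hrat n hn (⌊n * x⌋₊ + 1) hkn
    push_cast at e2
    have l1 : (⌊n * x⌋₊ : ℝ) / n ≤ x := by rw [div_le_iff₀ hn']; linarith
    have l2 : x ≤ ((⌊n * x⌋₊ : ℝ) + 1) / n := by rw [le_div_iff₀ hn']; linarith
    have l3 : ((⌊n * x⌋₊ : ℝ) + 1) / n ≤ 1 := by
      rw [div_le_one hn']; exact_mod_cast hkn
    have m1 := hmono _ _ (by positivity) l1 hx1.le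
    have m2 := hmono _ _ hx l2 l3
    rw [e1] at m1
    rw [e2] at m2
    have e3 : ((⌊n * x⌋₊ : ℝ) + 1) / n = ⌊n * x⌋₊ / n + 1 / n := add_div _ _ _
    rw [abs_le]
    constructor <;> linarith
  have hlim : |φ x - x| ≤ 0 := by
    refine ge_of_tendsto' (tendsto_one_div_add_atTop_nhds_zero_nat (𝕜 := ℝ)) fun n => ?_
    exact_mod_cast hclose (n + 1) n.succ_pos
  exact sub_eq_zero.1 (abs_nonpos_iff.1 hlim)

/-- F, G, H are to be the modulars along three disjoint rays and F', G', H' those along their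
images. In terms of values, F' becomes φ = F' ∘ α with α a right inverse of F. Trading the mass y
between the second and the first ray while the third is kept fixed gives additivity of φ; two rays
alone would only yield φ(x) + ψ(1 - x) = 1. -/
theorem eq_of_sum_eq_one {F G H F' G' H' : ℝ → ℝ} (hF0 : F 0 = 0) (hG0 : G 0 = 0) (hH0 : H 0 = 0)
    (hF'0 : F' 0 = 0) (hG'0 : G' 0 = 0) (hH'0 : H' 0 = 0) (hF' : ∀ a, 0 ≤ F' a)
    (hF : ∀ c, 0 ≤ c → ∃ a, 0 ≤ a ∧ F a = c) (hG : ∀ c, 0 ≤ c → ∃ a, 0 ≤ a ∧ G a = c)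
    (hH : ∀ c, 0 ≤ c → ∃ a, 0 ≤ a ∧ H a = c)
    (h : ∀ a b c, 0 ≤ a → 0 ≤ b → 0 ≤ c → F a + G b + H c = 1 → F' a + G' b + H' c = 1)
    {a : ℝ} (ha : 0 ≤ a) (ha1 : F a ≤ 1) (ha0 : 0 ≤ F a) : F' a = F a := by
  choose! α hα0 hα using hF
  choose! β hβ0 hβ using hG
  choose! γ hγ0 hγ using hH
  have key : ∀ x y z, 0 ≤ x → 0 ≤ y → 0 ≤ z → x + y + z = 1 →
      F' (α x) + G' (β y) + H' (γ z) = 1 := by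
    intro x y z hx hy hz hs
    exact h _ _ _ (hα0 x hx) (hβ0 y hy) (hγ0 z hz) (by rw [hα x hx, hβ y hy, hγ z hz, hs])
  -- The chosen preimage of 0 need not be 0, so it is compared with the argument 0.
  have hφ0 : F' (α 0) = 0 := by
    have h1 := h (α 0) (β 1) 0 (hα0 0 le_rfl) (hβ0 1 zero_le_one) le_rfl
      (by rw [hα 0 le_rfl, hβ 1 zero_le_one, hH0]; norm_num)
    have h2 := h 0 (β 1) 0 le_rfl (hβ0 1 zero_le_one) le_rfl
      (by rw [hF0, hβ 1 zero_le_one, hH0]; norm_num)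
    linarith
  have hψ0 : G' (β 0) = 0 := by
    have h1 := h (α 1) (β 0) 0 (hα0 1 zero_le_one) (hβ0 0 le_rfl) le_rfl
      (by rw [hα 1 zero_le_one, hβ 0 le_rfl, hH0]; norm_num)
    have h2 := h (α 1) 0 0 (hα0 1 zero_le_one) le_rfl le_rfl
      (by rw [hα 1 zero_le_one, hG0, hH0]; norm_num)
    linarith
  have hχ0 : H' (γ 0) = 0 := by
    have h1 := h (α 1) 0 (γ 0) (hα0 1 zero_le_one) le_rfl (hγ0 0 le_rfl)
      (by rw [hα 1 zero_le_one, hγ 0 le_rfl, hG0]; norm_num)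
    have h2 := h (α 1) 0 0 (hα0 1 zero_le_one) le_rfl le_rfl
      (by rw [hα 1 zero_le_one, hG0, hH0]; norm_num)
    linarith
  have hψφ : ∀ x, 0 ≤ x → x ≤ 1 → G' (β x) = F' (α x) := by
    intro x hx hx1
    have h1 := key x 0 (1 - x) hx le_rfl (by linarith) (by ring)
    have h2 := key 0 x (1 - x) le_rfl hx (by linarith) (by ring)
    linarith
  have hself : F' (α (F a)) = F a := by
    refine eq_self_of_additive (φ := fun x => F' (α x)) (fun x _ _ => hF' _) ?_ ?_ ha0 ha1
    · have := key 1 0 0 zero_le_one le_rfl le_rfl (by ring)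
      linarith
    · intro x y hx hy hxy
      have h1 := key x y (1 - x - y) hx hy (by linarith) (by ring)
      have h2 := key (x + y) 0 (1 - x - y) (by linarith) le_rfl (by linarith) (by ring)
      have h3 := hψφ y hy (by linarith)
      linarith
  -- Both a and α (F a) are completed to total 1 by the same β (1 - F a), so F' takes the same value
  -- at both.
  have h1 := h a (β (1 - F a)) 0 ha (hβ0 _ (by linarith)) le_rfl
    (by rw [hβ _ (by linarith), hH0]; ring)
  have h2 := h (α (F a)) (β (1 - F a)) 0 (hα0 _ ha0) (hβ0 _ (by linarith)) le_rfl
    (by rw [hβ _ (by linarith), hα _ ha0, hH0]; ring)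
  linarith

/-! ### Isometric embeddings preserve the modular functional -/

section Agreement

variable {X : Type u} {Y : Type v} [MeasurableSpace X] [MeasurableSpace Y] {μ : Measure X}
  {ν : Measure Y} {p : X → ℝ} {q : Y → ℝ} {hp : IsExponent μ p} {hq : IsExponent ν q}

/-- The modular functionals agree on small positive multiples of `f` and `θ f`. -/
def ModularAgree (θ : IsometricLatticeEmbedding hp hq) (f : nakano hp) : Prop :=
  ∃ a₀ : ℝ, 0 < a₀ ∧ ∀ a : ℝ, 0 < a → a < a₀ →
    modular q (a • (θ f : Y →ₘ[ν] ℝ)) = modular p (a • (f : X →ₘ[μ] ℝ))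

variable {θ : IsometricLatticeEmbedding hp hq}

theorem ae_smul_mul_smul {f g : X →ₘ[μ] ℝ} (h : ∀ᵐ x ∂μ, f x * g x = 0) (a b : ℝ) :
    ∀ᵐ x ∂μ, (a • f : X →ₘ[μ] ℝ) x * (b • g : X →ₘ[μ] ℝ) x = 0 := by
  filter_upwards [h, AEEqFun.coeFn_smul a f, AEEqFun.coeFn_smul b g] with x h1 h2 h3
  rw [h2, h3, Pi.smul_apply, Pi.smul_apply, smul_eq_mul, smul_eq_mul, mul_mul_mul_comm, h1,
    mul_zero]

theorem ModularAgree.zero : ModularAgree θ 0 :=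
  ⟨1, one_pos, fun a _ _ => by simp [modular_zero hp, modular_zero hq]⟩

theorem ModularAgree.add {f g : nakano hp} (hf : ModularAgree θ f) (hg : ModularAgree θ g)
    (h : ∀ᵐ x ∂μ, (f : X →ₘ[μ] ℝ) x * (g : X →ₘ[μ] ℝ) x = 0) : ModularAgree θ (f + g) := by
  obtain ⟨a₁, h1, h1'⟩ := hf
  obtain ⟨a₂, h2, h2'⟩ := hg
  refine ⟨min a₁ a₂, lt_min h1 h2, fun a ha hlt => ?_⟩
  rw [map_add, Submodule.coe_add, Submodule.coe_add, smul_add, smul_add,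
    modular_add_of_disjoint hp (ae_smul_mul_smul h a a),
    modular_add_of_disjoint hq (ae_smul_mul_smul (θ.map_disjoint_ae h) a a),
    h1' a ha (hlt.trans_le (min_le_left _ _)), h2' a ha (hlt.trans_le (min_le_right _ _))]

theorem ModularAgree.of_smul {f : nakano hp} {b : ℝ} (hb : 0 < b)
    (h : ModularAgree θ (b • f)) : ModularAgree θ f := by
  obtain ⟨a₁, h1, h1'⟩ := h
  refine ⟨b * a₁, mul_pos hb h1, fun a ha hlt => ?_⟩
  have := h1' (a / b) (div_pos ha hb) (by rw [div_lt_iff₀ hb]; linarith)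
  rwa [map_smul, Submodule.coe_smul, Submodule.coe_smul, smul_smul, smul_smul,
    div_mul_cancel₀ _ hb.ne'] at this

theorem modular_toReal_smul_surj (f : nakano hp) (hf : (f : X →ₘ[μ] ℝ) ≠ 0) (c : ℝ) (hc : 0 ≤ c) :
    ∃ a : ℝ, 0 ≤ a ∧ (modular p (a • (f : X →ₘ[μ] ℝ))).toReal = c := by
  rcases hc.eq_or_lt with rfl | hc
  · exact ⟨0, le_rfl, by rw [zero_smul, modular_zero hp]; rfl⟩
  · obtain ⟨a, ha, h⟩ := exists_modular_smul_eq hp hf hc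
    exact ⟨a, ha.le, by rw [h, ENNReal.toReal_ofReal hc.le]⟩

theorem modular_smul_mono (hp : IsExponent μ p) {a b : ℝ} (ha : 0 ≤ a) (hab : a ≤ b)
    (f : X →ₘ[μ] ℝ) : modular p (a • f) ≤ modular p (b • f) := by
  refine modular_mono hp ?_
  filter_upwards [AEEqFun.coeFn_smul a f, AEEqFun.coeFn_smul b f] with x h1 h2
  rw [h1, h2, Pi.smul_apply, Pi.smul_apply, smul_eq_mul, smul_eq_mul, abs_mul, abs_mul,
    abs_of_nonneg ha, abs_of_nonneg (ha.trans hab)]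
  gcongr

theorem modular_toReal_smul_add_three {f g h : nakano hp}
    (hfg : ∀ᵐ x ∂μ, (f : X →ₘ[μ] ℝ) x * (g : X →ₘ[μ] ℝ) x = 0)
    (hfh : ∀ᵐ x ∂μ, (f : X →ₘ[μ] ℝ) x * (h : X →ₘ[μ] ℝ) x = 0)
    (hgh : ∀ᵐ x ∂μ, (g : X →ₘ[μ] ℝ) x * (h : X →ₘ[μ] ℝ) x = 0) (a b c : ℝ) :
    (modular p ((a • f + b • g + c • h : nakano hp) : X →ₘ[μ] ℝ)).toReal =
      (modular p (a • (f : X →ₘ[μ] ℝ))).toReal + (modular p (b • (g : X →ₘ[μ] ℝ))).toReal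
        + (modular p (c • (h : X →ₘ[μ] ℝ))).toReal := by
  have hd : ∀ᵐ x ∂μ, ((a • f + b • g : nakano hp) : X →ₘ[μ] ℝ) x
      * (c • (h : X →ₘ[μ] ℝ)) x = 0 := by
    filter_upwards [ae_smul_mul_smul hfh a c, ae_smul_mul_smul hgh b c,
      AEEqFun.coeFn_add (a • (f : X →ₘ[μ] ℝ)) (b • (g : X →ₘ[μ] ℝ))] with x h1 h2 h3
    rw [Submodule.coe_add, Submodule.coe_smul, Submodule.coe_smul, h3, Pi.add_apply, add_mul,
      h1, h2, add_zero]
  rw [Submodule.coe_add, Submodule.coe_smul c h, modular_add_of_disjoint hp hd, Submodule.coe_add,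
    Submodule.coe_smul, Submodule.coe_smul,
    modular_add_of_disjoint hp (ae_smul_mul_smul hfg a b), ENNReal.toReal_add, ENNReal.toReal_add]
  · exact (a • f).2.ne
  · exact (b • g).2.ne
  · exact ENNReal.add_ne_top.2 ⟨(a • f).2.ne, (b • g).2.ne⟩
  · exact (c • h).2.ne

/-- The modular functional is determined by the norm on elements with two disjoint partners. -/
theorem ModularAgree.of_three {f g h : nakano hp} (hf : (f : X →ₘ[μ] ℝ) ≠ 0)
    (hg : (g : X →ₘ[μ] ℝ) ≠ 0) (hh : (h : X →ₘ[μ] ℝ) ≠ 0)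
    (hfg : ∀ᵐ x ∂μ, (f : X →ₘ[μ] ℝ) x * (g : X →ₘ[μ] ℝ) x = 0)
    (hfh : ∀ᵐ x ∂μ, (f : X →ₘ[μ] ℝ) x * (h : X →ₘ[μ] ℝ) x = 0)
    (hgh : ∀ᵐ x ∂μ, (g : X →ₘ[μ] ℝ) x * (h : X →ₘ[μ] ℝ) x = 0) : ModularAgree θ f := by
  -- The functional equation reaches exactly the multiples of modular at most 1.
  obtain ⟨a₀, ha₀, h1⟩ := exists_modular_smul_eq hp hf one_pos
  refine ⟨a₀, ha₀, fun a ha hlt => ?_⟩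
  have hle : modular p (a • (f : X →ₘ[μ] ℝ)) ≤ 1 := by
    rw [← ENNReal.ofReal_one, ← h1]
    exact modular_smul_mono hp ha.le hlt.le _
  have hfin : modular q (a • (θ f : Y →ₘ[ν] ℝ)) ≠ ∞ := (a • θ f).2.ne
  have hfin' : modular p (a • (f : X →ₘ[μ] ℝ)) ≠ ∞ := (a • f).2.ne
  rw [← ENNReal.toReal_eq_toReal_iff' hfin hfin']
  refine eq_of_sum_eq_one (F := fun a => (modular p (a • (f : X →ₘ[μ] ℝ))).toReal)
    (G := fun a => (modular p (a • (g : X →ₘ[μ] ℝ))).toReal)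
    (H := fun a => (modular p (a • (h : X →ₘ[μ] ℝ))).toReal)
    (F' := fun a => (modular q (a • (θ f : Y →ₘ[ν] ℝ))).toReal)
    (G' := fun a => (modular q (a • (θ g : Y →ₘ[ν] ℝ))).toReal)
    (H' := fun a => (modular q (a • (θ h : Y →ₘ[ν] ℝ))).toReal)
    (by simp [modular_zero hp]) (by simp [modular_zero hp]) (by simp [modular_zero hp])
    (by simp [modular_zero hq]) (by simp [modular_zero hq]) (by simp [modular_zero hq])
    (fun _ => ENNReal.toReal_nonneg) (modular_toReal_smul_surj f hf)
    (modular_toReal_smul_surj g hg) (modular_toReal_smul_surj h hh) ?_ ha.le ?_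
    ENNReal.toReal_nonneg
  · intro a b c _ _ _ hsum
    rw [← modular_toReal_smul_add_three hfg hfh hgh] at hsum
    rw [← modular_toReal_smul_add_three (θ.map_disjoint_ae hfg) (θ.map_disjoint_ae hfh)
      (θ.map_disjoint_ae hgh)]
    have : modular p ((a • f + b • g + c • h : nakano hp) : X →ₘ[μ] ℝ) = 1 := by
      rwa [ENNReal.toReal_eq_one_iff] at hsum
    have := θ.modular_map_eq_one this
    rw [map_add, map_add, map_smul, map_smul, map_smul] at this
    rw [this]; rfl
  · have := ENNReal.toReal_mono ENNReal.one_ne_top hle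
    simpa using this

/-- If g ≤ α - δ on a set of measure c, the integral is at least c u^{1 - δ/α}. The assumed bound
then gives c ≤ r u^{δ/α}, which tends to 0 with u. -/
theorem le_ae_of_lintegral_rpow_le {Ω : Type*} [MeasurableSpace Ω] {m : Measure Ω}
    {g : Ω → ℝ} (hg : Measurable g) {α r : ℝ} (hα : 0 < α)
    (h : ∀ u : ℝ, 0 < u → u < 1 →
      ∫⁻ ω, ENNReal.ofReal (u ^ (g ω / α)) ∂m ≤ ENNReal.ofReal (r * u)) :
    ∀ᵐ ω ∂m, α ≤ g ω := by
  have hδ : ∀ δ : ℝ, 0 < δ → m {ω | g ω ≤ α - δ} = 0 := by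
    intro δ hδ
    have hle : ∀ u : ℝ, 0 < u → u < 1 →
        m {ω | g ω ≤ α - δ} ≤ ENNReal.ofReal (r * u ^ (δ / α)) := by
      intro u hu hu1
      have h1 : ENNReal.ofReal (u ^ ((α - δ) / α)) * m {ω | g ω ≤ α - δ}
          ≤ ENNReal.ofReal (r * u) := by
        rw [← setLIntegral_const]
        refine (setLIntegral_mono_ae' (measurableSet_le hg measurable_const)
          (Filter.Eventually.of_forall fun ω hω => ?_)).trans
          ((setLIntegral_le_lintegral _ _).trans (h u hu hu1))
        exact ENNReal.ofReal_le_ofReal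
          (Real.rpow_le_rpow_of_exponent_ge hu hu1.le (div_le_div_of_nonneg_right hω hα.le))
      have h2 : ENNReal.ofReal (r * u ^ (δ / α))
          = ENNReal.ofReal (r * u) / ENNReal.ofReal (u ^ ((α - δ) / α)) := by
        rw [← ENNReal.ofReal_div_of_pos (Real.rpow_pos_of_pos hu _)]
        congr 1
        rw [mul_div_assoc]
        congr 1
        rw [eq_div_iff (Real.rpow_pos_of_pos hu _).ne', ← Real.rpow_add hu]
        rw [← add_div, add_sub_cancel, div_self hα.ne', Real.rpow_one]
      rw [h2, ENNReal.le_div_iff_mul_le (Or.inl (by simpa using Real.rpow_pos_of_pos hu _))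
        (Or.inl ENNReal.ofReal_ne_top), mul_comm]
      exact h1
    -- The test points u = 1/(n + 2) stay strictly below 1 also for n = 0.
    have hlim : Filter.Tendsto (fun n : ℕ => ENNReal.ofReal (r * (1 / ((n : ℝ) + 2)) ^ (δ / α)))
        Filter.atTop (nhds 0) := by
      have h1 : Filter.Tendsto (fun n : ℕ => 1 / ((n : ℝ) + 2)) Filter.atTop (nhds 0) := by
        have := (Filter.tendsto_add_atTop_iff_nat 1).2
          (tendsto_one_div_add_atTop_nhds_zero_nat (𝕜 := ℝ))
        refine this.congr fun n => ?_
        push_cast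
        ring
      have h2 := (h1.rpow_const (p := δ / α) (Or.inr (by positivity))).const_mul r
      rw [Real.zero_rpow (by positivity), mul_zero] at h2
      simpa using ENNReal.tendsto_ofReal h2
    refine le_antisymm (ge_of_tendsto' hlim fun n => hle _ (by positivity) ?_) bot_le
    rw [div_lt_one (by positivity)]
    linarith [(Nat.cast_nonneg n : (0 : ℝ) ≤ n)]
  have h0 : m (⋃ n : ℕ, {ω | g ω ≤ α - 1 / ((n : ℝ) + 1)}) = 0 :=
    measure_iUnion_null fun n => hδ _ (by positivity)
  filter_upwards [measure_eq_zero_iff_ae_notMem.1 h0] with ω hω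
  by_contra hlt
  obtain ⟨n, hn⟩ := exists_nat_one_div_lt (sub_pos.2 (not_le.1 hlt))
  exact hω (Set.mem_iUnion.2 ⟨n, by simp only [Set.mem_ofPred_eq]; linarith⟩)

theorem modular_rpow_smul_of_const {f : nakano hp} {α : ℝ}
    (hpα : ∀ᵐ x ∂μ, (f : X →ₘ[μ] ℝ) x ≠ 0 → p x = α) {a : ℝ} (ha : 0 ≤ a) :
    modular p (a • (f : X →ₘ[μ] ℝ)) = ENNReal.ofReal (a ^ α) * modular p (f : X →ₘ[μ] ℝ) := by
  rw [modular, modular,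
    ← lintegral_const_mul _ (measurable_modular_integrand hp.measurable _)]
  refine lintegral_congr_ae ?_
  filter_upwards [hpα, AEEqFun.coeFn_smul a (f : X →ₘ[μ] ℝ)] with x h1 h2
  have hp0 : p x ≠ 0 := by linarith [hp.one_le x]
  rw [h2, Pi.smul_apply, smul_eq_mul, abs_mul, Real.mul_rpow (abs_nonneg _) (abs_nonneg _),
    abs_of_nonneg ha]
  by_cases h3 : (f : X →ₘ[μ] ℝ) x = 0
  · simp [h3, Real.zero_rpow hp0]
  · rw [h1 h3, ENNReal.ofReal_mul (Real.rpow_nonneg ha _)]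

/-- With constant exponents, u^{1/α} f + (1-u)^{1/β} g runs through the unit sphere. Bernoulli's
inequality and the bound q ≤ r show that the image of the second summand has modular at least 1 - r
u, leaving at most r u for the first. This linear decay forces q ≥ α where θ f lives, which improves
the bound to u. -/
theorem modular_map_le_of_two {f g : nakano hp} {α β : ℝ} (hα : 1 ≤ α) (hβ : 1 ≤ β)
    (hf : modular p (f : X →ₘ[μ] ℝ) = 1) (hg : modular p (g : X →ₘ[μ] ℝ) = 1)
    (hfg : ∀ᵐ x ∂μ, (f : X →ₘ[μ] ℝ) x * (g : X →ₘ[μ] ℝ) x = 0)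
    (hpα : ∀ᵐ x ∂μ, (f : X →ₘ[μ] ℝ) x ≠ 0 → p x = α)
    (hpβ : ∀ᵐ x ∂μ, (g : X →ₘ[μ] ℝ) x ≠ 0 → p x = β) :
    (∀ u : ℝ, 0 ≤ u → u ≤ 1 → modular q (u ^ (1 / α) • (θ f : Y →ₘ[ν] ℝ)) +
      modular q ((1 - u) ^ (1 / β) • (θ g : Y →ₘ[ν] ℝ)) = 1) ∧
    ∀ u : ℝ, 0 < u → u < 1 →
      modular q (u ^ (1 / α) • (θ f : Y →ₘ[ν] ℝ)) ≤ ENNReal.ofReal u := by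
  have hα0 : 0 < α := by linarith
  have hβ0 : 0 < β := by linarith
  have hsum : ∀ u : ℝ, 0 ≤ u → u ≤ 1 → modular q (u ^ (1 / α) • (θ f : Y →ₘ[ν] ℝ)) +
      modular q ((1 - u) ^ (1 / β) • (θ g : Y →ₘ[ν] ℝ)) = 1 := by
    intro u hu hu1
    rw [← modular_add_of_disjoint hq (ae_smul_mul_smul (θ.map_disjoint_ae hfg) _ _)]
    have h1 : modular p ((u ^ (1 / α) • f + (1 - u) ^ (1 / β) • g : nakano hp) : X →ₘ[μ] ℝ)
        = 1 := by
      rw [Submodule.coe_add, Submodule.coe_smul, Submodule.coe_smul,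
        modular_add_of_disjoint hp (ae_smul_mul_smul hfg _ _),
        modular_rpow_smul_of_const hpα (Real.rpow_nonneg hu _),
        modular_rpow_smul_of_const hpβ (Real.rpow_nonneg (sub_nonneg.2 hu1) _), hf, hg,
        mul_one, mul_one, ← Real.rpow_mul hu, ← Real.rpow_mul (sub_nonneg.2 hu1),
        one_div_mul_cancel hα0.ne', one_div_mul_cancel hβ0.ne', Real.rpow_one, Real.rpow_one,
        ← ENNReal.ofReal_add hu (sub_nonneg.2 hu1), add_sub_cancel, ENNReal.ofReal_one]
    have := θ.modular_map_eq_one h1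
    rwa [map_add, map_smul, map_smul] at this
  refine ⟨hsum, ?_⟩
  obtain ⟨r, hr1, hr⟩ := ae_energy_le hq
  have hfin := isFiniteMeasure_energy (θ f)
  have hA : ∀ u : ℝ, 0 < u → modular q (u ^ (1 / α) • (θ f : Y →ₘ[ν] ℝ))
      = ∫⁻ y, ENNReal.ofReal (u ^ (q y / α)) ∂energy q (θ f : Y →ₘ[ν] ℝ) := by
    intro u hu
    rw [modular_smul hq]
    refine lintegral_congr fun y => ?_
    rw [abs_of_pos (Real.rpow_pos_of_pos hu _), ← Real.rpow_mul hu.le, one_div_mul_eq_div]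
  have hmg : modular q (θ g : Y →ₘ[ν] ℝ) = 1 := θ.modular_map_eq_one hg
  have hmf : modular q (θ f : Y →ₘ[ν] ℝ) = 1 := θ.modular_map_eq_one hf
  have hB : ∀ u : ℝ, 0 < u → u < 1 → ENNReal.ofReal (1 - r * u) ≤
      modular q ((1 - u) ^ (1 / β) • (θ g : Y →ₘ[ν] ℝ)) := by
    intro u hu hu1
    have h1u : 0 < 1 - u := by linarith
    rw [modular_smul hq, ← mul_one (ENNReal.ofReal (1 - r * u)), ← hmg, ← energy_univ,
      ← setLIntegral_const, Measure.restrict_univ]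
    refine lintegral_mono_ae ?_
    filter_upwards [hr (θ g : Y →ₘ[ν] ℝ)] with y hy
    refine ENNReal.ofReal_le_ofReal ?_
    rw [abs_of_pos (Real.rpow_pos_of_pos h1u _), ← Real.rpow_mul h1u.le]
    have h2 : 1 / β * q y ≤ r := by
      have : 1 / β ≤ 1 := by rw [div_le_one hβ0]; exact hβ
      have := hq.one_le y
      nlinarith
    calc 1 - r * u = 1 + r * (-u) := by ring
      _ ≤ (1 + -u) ^ r := one_add_mul_self_le_rpow_one_add (by linarith) hr1
      _ = (1 - u) ^ r := by rw [sub_eq_add_neg]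
      _ ≤ _ := Real.rpow_le_rpow_of_exponent_ge h1u (by linarith) h2
  have hq_ge : ∀ᵐ y ∂energy q (θ f : Y →ₘ[ν] ℝ), α ≤ q y := by
    refine le_ae_of_lintegral_rpow_le hq.measurable hα0 (r := r) fun u hu hu1 => ?_
    rw [← hA u hu]
    have h1 := hsum u hu.le hu1.le
    have h2 := hB u hu hu1
    -- For r u > 1 the subtraction from 1 is unavailable, but then the trivial bound 1 suffices.
    by_cases h3 : r * u ≤ 1
    · have h4 : ENNReal.ofReal (r * u) + ENNReal.ofReal (1 - r * u) = 1 := by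
        rw [← ENNReal.ofReal_add (by positivity) (by linarith), add_sub_cancel,
          ENNReal.ofReal_one]
      refine ENNReal.le_of_add_le_add_right (a := ENNReal.ofReal (1 - r * u))
        ENNReal.ofReal_ne_top ?_
      rw [h4, ← h1]
      gcongr
    · calc _ ≤ (1 : ℝ≥0∞) := by rw [← h1]; exact le_self_add
        _ ≤ _ := by rw [ENNReal.one_le_ofReal]; linarith
  intro u hu hu1
  rw [hA u hu, ← mul_one (ENNReal.ofReal u), ← hmf, ← energy_univ, ← setLIntegral_const,
    Measure.restrict_univ]
  refine lintegral_mono_ae ?_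
  filter_upwards [hq_ge] with y hy
  refine ENNReal.ofReal_le_ofReal ?_
  calc u ^ (q y / α) ≤ u ^ (1 : ℝ) :=
        Real.rpow_le_rpow_of_exponent_ge hu hu1.le ((one_le_div hα0).2 hy)
    _ = u := Real.rpow_one u

/-- The modular functional is determined by the norm on elements with one disjoint partner, if
the exponent is constant on both. -/
theorem ModularAgree.of_two {f g : nakano hp} {α β : ℝ} (hα : 1 ≤ α) (hβ : 1 ≤ β)
    (hf : (f : X →ₘ[μ] ℝ) ≠ 0) (hg : (g : X →ₘ[μ] ℝ) ≠ 0)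
    (hfg : ∀ᵐ x ∂μ, (f : X →ₘ[μ] ℝ) x * (g : X →ₘ[μ] ℝ) x = 0)
    (hpα : ∀ᵐ x ∂μ, (f : X →ₘ[μ] ℝ) x ≠ 0 → p x = α)
    (hpβ : ∀ᵐ x ∂μ, (g : X →ₘ[μ] ℝ) x ≠ 0 → p x = β) : ModularAgree θ f := by
  obtain ⟨a, ha, hfa⟩ := exists_modular_smul_eq hp hf one_pos
  obtain ⟨b, hb, hgb⟩ := exists_modular_smul_eq hp hg one_pos
  rw [ENNReal.ofReal_one, ← Submodule.coe_smul] at hfa hgb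
  refine ModularAgree.of_smul ha ?_
  have hd := ae_smul_mul_smul hfg a b
  rw [← Submodule.coe_smul, ← Submodule.coe_smul] at hd
  have hpα' : ∀ᵐ x ∂μ, ((a • f : nakano hp) : X →ₘ[μ] ℝ) x ≠ 0 → p x = α := by
    filter_upwards [hpα, smul_coe a f] with x h1 h2 h3
    rw [h2] at h3
    exact h1 (right_ne_zero_of_mul h3)
  have hpβ' : ∀ᵐ x ∂μ, ((b • g : nakano hp) : X →ₘ[μ] ℝ) x ≠ 0 → p x = β := by
    filter_upwards [hpβ, smul_coe b g] with x h1 h2 h3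
    rw [h2] at h3
    exact h1 (right_ne_zero_of_mul h3)
  obtain ⟨hsum, h1⟩ := modular_map_le_of_two (θ := θ) hα hβ hfa hgb hd hpα' hpβ'
  -- The upper bounds for the two summands, u and 1 - u, add up to the exact total 1, so both are
  -- equalities.
  obtain ⟨-, h2⟩ := modular_map_le_of_two (θ := θ) hβ hα hgb hfa
    (hd.mono fun x hx => by rwa [mul_comm]) hpβ' hpα'
  refine ⟨1, one_pos, fun c hc hc1 => ?_⟩
  have hα0 : 0 < α := by linarith
  have hu0 : 0 < c ^ α := Real.rpow_pos_of_pos hc _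
  have hu1 : c ^ α < 1 := Real.rpow_lt_one hc.le hc1 hα0
  have h3 := hsum (c ^ α) hu0.le hu1.le
  have h4 := h1 (c ^ α) hu0 hu1
  have h5 := h2 (1 - c ^ α) (by linarith) (by linarith)
  rw [modular_rpow_smul_of_const hpα' hc.le, hfa, mul_one]
  have h6 : (c ^ α) ^ (1 / α) = c := by
    rw [← Real.rpow_mul hc.le, mul_one_div_cancel hα0.ne', Real.rpow_one]
  rw [h6] at h3 h4
  refine le_antisymm h4 ?_
  refine ENNReal.le_of_add_le_add_right (a := ENNReal.ofReal (1 - c ^ α)) ENNReal.ofReal_ne_top ?_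
  rw [← ENNReal.ofReal_add hu0.le (by linarith), add_sub_cancel, ENNReal.ofReal_one, ← h3]
  gcongr

end Agreement

/-! ### Partition into three sets or two atoms, and the law of the exponent -/

section Preserve

variable {X : Type u} {Y : Type v} [MeasurableSpace X] [MeasurableSpace Y] {μ : Measure X}
  {ν : Measure Y} {p : X → ℝ} {q : Y → ℝ} {hp : IsExponent μ p} {hq : IsExponent ν q}

/-- Strict localisability excludes sets all of whose parts have measure 0 or ∞: some witness piece
meets A in a set of positive finite measure. -/
theorem exists_ne_zero_of_measure_ne_zero (hp : IsExponent μ p) (hμ : StrictlyLocalisable μ)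
    {A : Set X} (hA : MeasurableSet A) (h : μ A ≠ 0) :
    ∃ f : nakano hp, (f : X →ₘ[μ] ℝ) ≠ 0 ∧ ∀ᵐ x ∂μ, x ∉ A → (f : X →ₘ[μ] ℝ) x = 0 := by
  obtain ⟨ι, s, hs⟩ := hμ
  obtain ⟨i, hi⟩ := hs.exists_measure_inter_pos h
  have hAi := hA.inter (hs.measurable i)
  have hfin : μ (A ∩ s i) < ∞ := (measure_mono Set.inter_subset_right).trans_lt (hs.finite i)
  refine ⟨charN hp (A ∩ s i) hAi hfin, fun h0 => hi.ne' ?_, ?_⟩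
  · have : charFn μ (A ∩ s i) hAi = 0 := h0
    rw [← modular_charFn hp hAi, this, modular_zero hp]
  · filter_upwards [charFn_coe (μ := μ) hAi] with x hx hxA
    change charFn μ (A ∩ s i) hAi x = 0
    rw [hx, Set.indicator_of_notMem fun h => hxA h.1]

/-- When every measurable set is null or conull, a measurable function is almost everywhere
constant. The dimension hypothesis enters through the contrapositive. -/
theorem rank_le_one_of_trivial (hp : IsExponent μ p)
    (h : ∀ A, MeasurableSet A → μ A = 0 ∨ μ Aᶜ = 0) : Module.rank ℝ (nakano hp) ≤ 1 := by
  have hconst : ∀ f : nakano hp, ∃ c : ℝ, ∀ᵐ x ∂μ, (f : X →ₘ[μ] ℝ) x = c := by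
    intro f
    have hf : Measurable (f : X →ₘ[μ] ℝ) := (f : X →ₘ[μ] ℝ).stronglyMeasurable.measurable
    refine Filter.exists_eventuallyEq_const_of_forall_separating MeasurableSet fun U hU => ?_
    rcases h _ (hf hU) with h0 | h0
    · exact Or.inr (measure_eq_zero_iff_ae_notMem.1 h0)
    · exact Or.inl ((measure_eq_zero_iff_ae_notMem.1 h0).mono fun x hx => not_not.1 hx)
  rw [rank_le_one_iff]
  by_cases h0 : ∀ f : nakano hp, f = 0
  · exact ⟨0, fun f => ⟨0, by rw [h0 f, smul_zero]⟩⟩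
  · push Not at h0
    obtain ⟨f₀, hf₀⟩ := h0
    obtain ⟨c, hc⟩ := hconst f₀
    have hc0 : c ≠ 0 := by
      rintro rfl
      refine hf₀ (ext_ae ?_)
      filter_upwards [hc, zero_coe (hp := hp)] with x h1 h2
      rw [h1, h2]
    refine ⟨f₀, fun f => ?_⟩
    obtain ⟨d, hd⟩ := hconst f
    refine ⟨d / c, ext_ae ?_⟩
    filter_upwards [hc, hd, smul_coe (d / c) f₀] with x h1 h2 h3
    rw [h3, h1, h2, div_mul_cancel₀ _ hc0]

theorem band_eq_zero_of_notMem {A : Set X} (hA : MeasurableSet A) (f : nakano hp) :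
    ∀ᵐ x ∂μ, x ∉ A → (band A hA f : X →ₘ[μ] ℝ) x = 0 := by
  filter_upwards [band_coe hA f] with x hx hxA
  rw [hx, Set.indicator_of_notMem hxA]

theorem band_add_band_compl {A : Set X} (hA : MeasurableSet A) (f : nakano hp) :
    band A hA f + band Aᶜ hA.compl f = f := by
  refine ext_ae ?_
  filter_upwards [band_coe hA f, band_coe hA.compl f, add_coe (band A hA f)
    (band Aᶜ hA.compl f)] with x h1 h2 h3
  rw [h3, h1, h2]
  by_cases hx : x ∈ A <;> simp [hx]

theorem mul_ae_eq_zero_of_disjoint {A B : Set X} (hAB : Disjoint A B) {f g : X →ₘ[μ] ℝ}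
    (hf : ∀ᵐ x ∂μ, x ∉ A → f x = 0) (hg : ∀ᵐ x ∂μ, x ∉ B → g x = 0) :
    ∀ᵐ x ∂μ, f x * g x = 0 := by
  filter_upwards [hf, hg] with x h1 h2
  by_cases hx : x ∈ A
  · rw [h2 (Set.disjoint_left.1 hAB hx), mul_zero]
  · rw [h1 hx, zero_mul]

variable {θ : IsometricLatticeEmbedding hp hq}

theorem ModularAgree.of_compl {A B : Set X} (hA : MeasurableSet A)
    (h1 : ∀ f : nakano hp, (∀ᵐ x ∂μ, x ∉ A → (f : X →ₘ[μ] ℝ) x = 0) → ModularAgree θ f)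
    (h2 : ∀ f : nakano hp, (∀ᵐ x ∂μ, x ∉ B → (f : X →ₘ[μ] ℝ) x = 0) → ModularAgree θ f)
    (f : nakano hp) (hf : ∀ᵐ x ∂μ, x ∉ A ∪ B → (f : X →ₘ[μ] ℝ) x = 0) :
    ModularAgree θ f := by
  rw [← band_add_band_compl hA f]
  refine ModularAgree.add (h1 _ (band_eq_zero_of_notMem hA f)) (h2 _ ?_)
    (mul_ae_eq_zero_of_disjoint disjoint_compl_right (band_eq_zero_of_notMem hA f)
      (band_eq_zero_of_notMem hA.compl f))
  filter_upwards [band_coe hA.compl f, hf] with x h3 h4 hx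
  rw [h3]
  by_cases hxA : x ∈ A
  · simp [hxA]
  · rw [Set.indicator_of_mem hxA]
    exact h4 fun h => h.elim hxA hx

theorem modularAgree_of_disjoint_three (hμ : StrictlyLocalisable μ) {A B C : Set X}
    (hB : MeasurableSet B) (hC : MeasurableSet C)
    (hB0 : μ B ≠ 0) (hC0 : μ C ≠ 0) (hAB : Disjoint A B) (hAC : Disjoint A C)
    (hBC : Disjoint B C) (f : nakano hp) (hf : ∀ᵐ x ∂μ, x ∉ A → (f : X →ₘ[μ] ℝ) x = 0) :
    ModularAgree θ f := by
  by_cases hf0 : (f : X →ₘ[μ] ℝ) = 0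
  · have : f = 0 := Subtype.ext hf0
    rw [this]
    exact ModularAgree.zero
  obtain ⟨g, hg0, hg⟩ := exists_ne_zero_of_measure_ne_zero hp hμ hB hB0
  obtain ⟨h, hh0, hh⟩ := exists_ne_zero_of_measure_ne_zero hp hμ hC hC0
  exact ModularAgree.of_three hf0 hg0 hh0 (mul_ae_eq_zero_of_disjoint hAB hf hg)
    (mul_ae_eq_zero_of_disjoint hAC hf hh) (mul_ae_eq_zero_of_disjoint hBC hg hh)

theorem exists_ae_eq_const_of_trivial (hp : IsExponent μ p) {A : Set X} (hA : MeasurableSet A)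
    (hA0 : μ A ≠ 0) (h : ∀ B, MeasurableSet B → μ (A ∩ B) = 0 ∨ μ (A ∩ Bᶜ) = 0) :
    ∃ α : ℝ, 1 ≤ α ∧ ∀ᵐ x ∂μ, x ∈ A → p x = α := by
  obtain ⟨α, hα⟩ : ∃ α : ℝ, p =ᵐ[μ.restrict A] Function.const X α := by
    refine Filter.exists_eventuallyEq_const_of_forall_separating MeasurableSet fun U hU => ?_
    have hm := hp.measurable hU
    rcases h _ hm with h0 | h0
    · refine Or.inr ((ae_restrict_iff' hA).2 ?_)
      filter_upwards [measure_eq_zero_iff_ae_notMem.1 h0] with x hx hxA hxU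
      exact hx ⟨hxA, hxU⟩
    · refine Or.inl ((ae_restrict_iff' hA).2 ?_)
      filter_upwards [measure_eq_zero_iff_ae_notMem.1 h0] with x hx hxA
      by_contra hxU
      exact hx ⟨hxA, hxU⟩
  have hα' := (ae_restrict_iff' hA).1 hα
  refine ⟨α, ?_, hα'⟩
  by_contra hlt
  refine hA0 (measure_eq_zero_iff_ae_notMem.2 ?_)
  filter_upwards [hα'] with x hx hxA
  have h1 := hp.one_le x
  rw [hx hxA] at h1
  exact hlt h1

theorem modularAgree_of_disjoint_two (hμ : StrictlyLocalisable μ) {A B : Set X} {α β : ℝ}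
    (hα : 1 ≤ α) (hβ : 1 ≤ β) (hB : MeasurableSet B) (hB0 : μ B ≠ 0) (hAB : Disjoint A B)
    (hpA : ∀ᵐ x ∂μ, x ∈ A → p x = α) (hpB : ∀ᵐ x ∂μ, x ∈ B → p x = β)
    (f : nakano hp) (hf : ∀ᵐ x ∂μ, x ∉ A → (f : X →ₘ[μ] ℝ) x = 0) : ModularAgree θ f := by
  by_cases hf0 : (f : X →ₘ[μ] ℝ) = 0
  · have : f = 0 := Subtype.ext hf0
    rw [this]
    exact ModularAgree.zero
  obtain ⟨g, hg0, hg⟩ := exists_ne_zero_of_measure_ne_zero hp hμ hB hB0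
  refine ModularAgree.of_two hα hβ hf0 hg0 (mul_ae_eq_zero_of_disjoint hAB hf hg) ?_ ?_
  · filter_upwards [hf, hpA] with x h1 h2 h3
    exact h2 (by_contra fun h => h3 (h1 h))
  · filter_upwards [hg, hpB] with x h1 h2 h3
    exact h2 (by_contra fun h => h3 (h1 h))

/-- An isometric embedding of a Nakano space of dimension at least two is compatible with the
modular functionals. -/
theorem modularAgree_of_two_le_rank (hμ : StrictlyLocalisable μ)
    (hdim : 2 ≤ Module.rank ℝ (nakano hp)) (θ : IsometricLatticeEmbedding hp hq)
    (f : nakano hp) : ModularAgree θ f := by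
  obtain ⟨A, hA, hA0, hA0'⟩ : ∃ A, MeasurableSet A ∧ μ A ≠ 0 ∧ μ Aᶜ ≠ 0 := by
    by_contra! h
    have := hdim.trans (rank_le_one_of_trivial hp fun A hA => or_iff_not_imp_left.2 (h A hA))
    norm_num at this
  have hcover : ∀ᵐ x ∂μ, x ∉ A ∪ Aᶜ → (f : X →ₘ[μ] ℝ) x = 0 :=
    Filter.Eventually.of_forall fun x hx => absurd (by rw [Set.union_compl_self]; trivial) hx
  -- A splitting of E together with its complement partitions X into three non-null sets, so the
  -- part of f on each of them has two disjoint partners.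
  have hsplit : ∀ E : Set X, MeasurableSet E → μ Eᶜ ≠ 0 →
      (∃ B, MeasurableSet B ∧ μ (E ∩ B) ≠ 0 ∧ μ (E ∩ Bᶜ) ≠ 0) → ModularAgree θ f := by
    rintro E hE hE0 ⟨B, hB, hB1, hB2⟩
    have hm1 := hE.inter hB
    have hm2 := hE.inter hB.compl
    have d1 : Disjoint (E ∩ B) (E ∩ Bᶜ) :=
      disjoint_compl_right.mono Set.inter_subset_right Set.inter_subset_right
    have d2 : ∀ D : Set X, Disjoint (E ∩ D) Eᶜ := fun D =>
      disjoint_compl_right.mono_left Set.inter_subset_left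
    refine ModularAgree.of_compl hE (fun g hg => ModularAgree.of_compl (B := E ∩ Bᶜ) hm1
      (modularAgree_of_disjoint_three hμ hm2 hE.compl hB2 hE0 d1 (d2 _) (d2 _))
      (modularAgree_of_disjoint_three hμ hm1 hE.compl hB1 hE0 d1.symm (d2 _) (d2 _)) g
      (by rwa [Set.inter_union_compl]))
      (modularAgree_of_disjoint_three hμ hm1 hm2 hB1 hB2 (d2 _).symm (d2 _).symm d1) f
      (Filter.Eventually.of_forall fun x hx => absurd (by rw [Set.union_compl_self]; trivial) hx)
  by_cases h1 : ∃ B, MeasurableSet B ∧ μ (A ∩ B) ≠ 0 ∧ μ (A ∩ Bᶜ) ≠ 0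
  · exact hsplit A hA hA0' h1
  by_cases h2 : ∃ B, MeasurableSet B ∧ μ (Aᶜ ∩ B) ≠ 0 ∧ μ (Aᶜ ∩ Bᶜ) ≠ 0
  · exact hsplit Aᶜ hA.compl (by rwa [compl_compl]) h2
  -- What remains is a space made of two atoms, on each of which p is constant.
  push Not at h1 h2
  obtain ⟨α, hα, hpα⟩ := exists_ae_eq_const_of_trivial hp hA hA0
    fun B hB => or_iff_not_imp_left.2 (h1 B hB)
  obtain ⟨β, hβ, hpβ⟩ := exists_ae_eq_const_of_trivial hp hA.compl hA0'
    fun B hB => or_iff_not_imp_left.2 (h2 B hB)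
  exact ModularAgree.of_compl hA
    (modularAgree_of_disjoint_two hμ hα hβ hA.compl hA0' disjoint_compl_right hpα hpβ)
    (modularAgree_of_disjoint_two hμ hβ hα hA hA0 disjoint_compl_left hpβ hpα) f hcover

/-- An embedding which respects the distribution of the exponent with respect to
`|f| ^ p dμ`, and in particular the modular functional. -/
def PreservesEnergy (θ : IsometricLatticeEmbedding hp hq) : Prop :=
  ∀ f : nakano hp, (energy p (f : X →ₘ[μ] ℝ)).map p = (energy q (θ f : Y →ₘ[ν] ℝ)).map q

theorem preservesEnergy_of_two_le_rank (hμ : StrictlyLocalisable μ)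
    (hdim : 2 ≤ Module.rank ℝ (nakano hp)) (θ : IsometricLatticeEmbedding hp hq) :
    PreservesEnergy θ := by
  intro f
  obtain ⟨a₀, ha₀, h⟩ := modularAgree_of_two_le_rank hμ hdim θ f
  exact map_energy_eq hp hq f (θ f) ha₀ h

theorem PreservesEnergy.modular_map (hθ : PreservesEnergy θ) (f : nakano hp) :
    modular q (θ f : Y →ₘ[ν] ℝ) = modular p (f : X →ₘ[μ] ℝ) := by
  have h := congrArg (fun m => m Set.univ) (hθ f)
  simp only [Measure.map_apply hp.measurable MeasurableSet.univ,
    Measure.map_apply hq.measurable MeasurableSet.univ, Set.preimage_univ, energy_univ] at h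
  exact h.symm

theorem energy_eq_zero_iff (hp : IsExponent μ p) (f : X →ₘ[μ] ℝ) (A : Set X) :
    energy p f A = 0 ↔ ∀ᵐ x ∂μ, x ∈ A → f x = 0 := by
  rw [energy, withDensity_apply_eq_zero (measurable_modular_integrand hp.measurable f),
    measure_eq_zero_iff_ae_notMem]
  refine Filter.eventually_congr (Filter.Eventually.of_forall fun x => ?_)
  have hp0 : p x ≠ 0 := by linarith [hp.one_le x]
  have : ENNReal.ofReal (|f x| ^ p x) ≠ 0 ↔ f x ≠ 0 := by
    rw [ne_eq, ENNReal.ofReal_eq_zero, not_le]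
    constructor
    · intro h h0
      rw [h0, abs_zero, Real.zero_rpow hp0] at h
      exact lt_irrefl _ h
    · exact fun h => Real.rpow_pos_of_pos (abs_pos.2 h) _
  simp only [Set.mem_inter_iff, Set.mem_ofPred_eq, this]
  tauto

/-- The law of p under |f|^p dμ gives no mass to the complement of C, and it is also the law of q
under |θ f|^q dν. -/
theorem PreservesEnergy.exponent_mem (hθ : PreservesEnergy θ) {f : nakano hp} {C : Set ℝ}
    (hC : MeasurableSet C) (h : ∀ᵐ x ∂μ, (f : X →ₘ[μ] ℝ) x ≠ 0 → p x ∈ C) :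
    ∀ᵐ y ∂ν, (θ f : Y →ₘ[ν] ℝ) y ≠ 0 → q y ∈ C := by
  have h0 : energy p (f : X →ₘ[μ] ℝ) (p ⁻¹' Cᶜ) = 0 := by
    rw [energy_eq_zero_iff hp]
    filter_upwards [h] with x h1 h2
    exact by_contra fun h3 => h2 (h1 h3)
  have h1 := congrArg (fun m => m Cᶜ) (hθ f)
  simp only [Measure.map_apply hp.measurable hC.compl,
    Measure.map_apply hq.measurable hC.compl, h0] at h1
  filter_upwards [(energy_eq_zero_iff hq _ _).1 h1.symm] with y h2 h3
  exact by_contra fun h4 => h3 (h2 h4)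

end Preserve

/-! ### Order continuity of embeddings along a witness -/

section Continuity

variable {X : Type u} {Y : Type v} [MeasurableSpace X] [MeasurableSpace Y] {μ : Measure X}
  {ν : Measure Y} {p : X → ℝ} {q : Y → ℝ} {hp : IsExponent μ p} {hq : IsExponent ν q}
  {θ : IsometricLatticeEmbedding hp hq} {ι : Type u} {s : ι → Set X}

theorem band_union_of_disjoint {A B : Set X} (hA : MeasurableSet A) (hB : MeasurableSet B)
    (h : Disjoint A B) (f : nakano hp) :
    band (A ∪ B) (hA.union hB) f = band A hA f + band B hB f := by
  refine ext_ae ?_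
  filter_upwards [band_coe hA f, band_coe hB f, band_coe (hA.union hB) f,
    add_coe (band A hA f) (band B hB f)] with x h1 h2 h3 h4
  rw [h3, h4, h1, h2]
  by_cases hxA : x ∈ A
  · simp [hxA, Set.disjoint_left.1 h hxA]
  · by_cases hxB : x ∈ B <;> simp [hxA, hxB]

theorem modular_band {A : Set X} (hA : MeasurableSet A) (f : nakano hp) :
    modular p (band A hA f : X →ₘ[μ] ℝ) = ∫⁻ x in A, ENNReal.ofReal
      (|(f : X →ₘ[μ] ℝ) x| ^ p x) ∂μ := by
  rw [modular, ← lintegral_indicator hA]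
  refine lintegral_congr_ae ?_
  filter_upwards [band_coe hA f] with x hx
  have hp0 : p x ≠ 0 := by linarith [hp.one_le x]
  rw [hx]
  by_cases hxA : x ∈ A <;> simp [hxA, Real.zero_rpow hp0]

theorem map_band_biUnion_eq_zero (hs : IsWitness μ s) (f : nakano hp) {d : Y → ℝ}
    (h : ∀ i, ∀ᵐ y ∂ν, d y * (θ (band (s i) (hs.measurable i) f) : Y →ₘ[ν] ℝ) y = 0)
    (F : Finset ι) (hF : MeasurableSet (⋃ i ∈ F, s i)) :
    ∀ᵐ y ∂ν, d y * (θ (band (⋃ i ∈ F, s i) hF f) : Y →ₘ[ν] ℝ) y = 0 := by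
  classical
  induction F using Finset.induction_on with
  | empty =>
    have h0 : band (⋃ i ∈ (∅ : Finset ι), s i) hF f = 0 := by
      refine ext_ae ?_
      filter_upwards [band_eq_zero_of_notMem hF f, zero_coe (hp := hp)] with x h1 h2
      rw [h2]
      exact h1 (by simp)
    rw [h0, map_zero]
    filter_upwards [zero_coe (hp := hq)] with y hy
    rw [hy, mul_zero]
  | insert i F hi ih =>
    have hF' : MeasurableSet (⋃ i ∈ F, s i) :=
      F.measurableSet_biUnion fun i _ => hs.measurable i
    have hd : Disjoint (s i) (⋃ i ∈ F, s i) := by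
      rw [Set.disjoint_iUnion₂_right]
      exact fun j hj => hs.disjoint fun h => hi (h ▸ hj)
    have he : band (⋃ j ∈ insert i F, s j) hF f
        = band (s i) (hs.measurable i) f + band (⋃ i ∈ F, s i) hF' f := by
      rw [← band_union_of_disjoint (hs.measurable i) hF' hd f]
      congr 1
      exact Finset.set_biUnion_insert i F s
    rw [he, map_add]
    filter_upwards [h i, ih hF', add_coe (θ (band (s i) (hs.measurable i) f))
      (θ (band (⋃ i ∈ F, s i) hF' f))] with y h1 h2 h3
    rw [h3, mul_add, h1, h2, add_zero]

/-- This passes from the pieces of a witness to the whole space. On {d ≠ 0} the image of finitely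
many pieces of f vanishes, so θ f agrees there with the image of the tail; the tail has small
modular, and θ preserves the modular. -/
theorem PreservesEnergy.mul_map_eq_zero (hθ : PreservesEnergy θ) (hs : IsWitness μ s)
    (f : nakano hp) {d : Y → ℝ} (hd : Measurable d)
    (h : ∀ i, ∀ᵐ y ∂ν, d y * (θ (band (s i) (hs.measurable i) f) : Y →ₘ[ν] ℝ) y = 0) :
    ∀ᵐ y ∂ν, d y * (θ f : Y →ₘ[ν] ℝ) y = 0 := by
  have hD : MeasurableSet {y | d y ≠ 0} := (hd (measurableSet_singleton 0)).compl
  have h0 : energy q (θ f : Y →ₘ[ν] ℝ) {y | d y ≠ 0} = 0 := by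
    refine le_antisymm (le_of_forall_gt fun ε hε => ?_) bot_le
    obtain ⟨F, hF⟩ := hs.exists_finset_lintegral_lt
      (f := fun x => ENNReal.ofReal (|(f : X →ₘ[μ] ℝ) x| ^ p x)) f.2.ne hε
    have hm : MeasurableSet (⋃ i ∈ F, s i) := F.measurableSet_biUnion fun i _ => hs.measurable i
    refine lt_of_le_of_lt ?_ hF
    rw [← modular_band hm.compl, ← hθ.modular_map, energy, withDensity_apply _ hD]
    refine (setLIntegral_mono_ae' hD ?_).trans (setLIntegral_le_lintegral _ _)
    have hadd := band_add_band_compl hm f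
    have hadd' := congrArg (fun u => (θ u)) hadd
    simp only [map_add] at hadd'
    filter_upwards [map_band_biUnion_eq_zero hs f h F hm, ae_eq_of_eq hadd',
      add_coe (θ (band _ hm f)) (θ (band _ hm.compl f))] with y h1 h2 h3 hy
    rw [h3, (mul_eq_zero.1 h1).resolve_left hy, zero_add] at h2
    rw [h2]
  filter_upwards [(energy_eq_zero_iff hq _ _).1 h0] with y hy
  by_cases h1 : d y = 0
  · rw [h1, zero_mul]
  · rw [hy h1, mul_zero]

theorem charN_coe (hp : IsExponent μ p) {A : Set X} (hA : MeasurableSet A) (hfin : μ A < ∞) :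
    ∀ᵐ x ∂μ, (charN hp A hA hfin : X →ₘ[μ] ℝ) x = A.indicator (fun _ => (1 : ℝ)) x :=
  charFn_coe hA

theorem band_charN_comm (hp : IsExponent μ p) {A B : Set X} (hA : MeasurableSet A)
    (hB : MeasurableSet B) (hAf : μ A < ∞) (hBf : μ B < ∞) :
    band A hA (charN hp B hB hBf) = band B hB (charN hp A hA hAf) := by
  refine ext_ae ?_
  filter_upwards [band_coe hA (charN hp B hB hBf), band_coe hB (charN hp A hA hAf),
    charN_coe hp hA hAf, charN_coe hp hB hBf] with x h1 h2 h3 h4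
  rw [h1, h2]
  by_cases hxA : x ∈ A <;> by_cases hxB : x ∈ B <;> simp [hxA, hxB, h3, h4]

theorem band_mul_band_compl {A : Set X} (hA : MeasurableSet A) (f g : nakano hp) :
    ∀ᵐ x ∂μ, (band A hA f : X →ₘ[μ] ℝ) x * (band Aᶜ hA.compl g : X →ₘ[μ] ℝ) x = 0 :=
  mul_ae_eq_zero_of_disjoint disjoint_compl_right (band_eq_zero_of_notMem hA f)
    (band_eq_zero_of_notMem hA.compl g)

/-- If the characteristic functions of the pieces of a witness are sent to characteristic
functions, then so are those of all sets of finite measure. -/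
theorem PreservesEnergy.exists_eq_charFn (hθ : PreservesEnergy θ) (hs : IsWitness μ s)
    (h01 : ∀ i, ∀ᵐ y ∂ν, (θ (charN hp (s i) (hs.measurable i) (hs.finite i)) : Y →ₘ[ν] ℝ) y = 0 ∨
      (θ (charN hp (s i) (hs.measurable i) (hs.finite i)) : Y →ₘ[ν] ℝ) y = 1)
    (A : Set X) (hA : MeasurableSet A) (hfin : μ A < ∞) :
    ∃ (B : Set Y) (hB : MeasurableSet B),
      (θ (charN hp A hA hfin) : Y →ₘ[ν] ℝ) = charFn ν B hB := by
  set v : Y →ₘ[ν] ℝ := (θ (charN hp A hA hfin) : Y →ₘ[ν] ℝ) with hv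
  have hvm : Measurable v := v.stronglyMeasurable.measurable
  -- The equation says that v takes only the values 0 and 1, in the form required by
  -- `mul_map_eq_zero` with d = v (1 - v).
  have key : ∀ᵐ y ∂ν, (v y * (1 - v y)) * v y = 0 := by
    refine hθ.mul_map_eq_zero hs _ (hvm.mul (measurable_const.sub hvm)) fun i => ?_
    have hi := hs.measurable i
    have e1 := congrArg (fun u => θ u) (band_add_band_compl hi (charN hp A hA hfin))
    have e2 := congrArg (fun u => θ u) (band_add_band_compl hA (charN hp (s i) hi (hs.finite i)))
    simp only [map_add] at e1 e2
    rw [band_charN_comm hp hA hi hfin (hs.finite i)] at e2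
    have d1 := θ.map_disjoint_ae
      (band_mul_band_compl hi (charN hp A hA hfin) (charN hp A hA hfin))
    have d2 := θ.map_disjoint_ae
      (band_mul_band_compl hA (charN hp (s i) hi (hs.finite i)) (charN hp (s i) hi (hs.finite i)))
    rw [band_charN_comm hp hA hi hfin (hs.finite i)] at d2
    filter_upwards [h01 i, ae_eq_of_eq e1, ae_eq_of_eq e2, d1, d2,
      add_coe (θ (band (s i) hi (charN hp A hA hfin)))
        (θ (band (s i)ᶜ hi.compl (charN hp A hA hfin))),
      add_coe (θ (band (s i) hi (charN hp A hA hfin)))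
        (θ (band Aᶜ hA.compl (charN hp (s i) hi (hs.finite i))))] with y h1 h2 h3 h4 h5 h6 h7
    rw [h6] at h2
    rw [h7] at h3
    -- Where the image of χ_{A ∩ s i} is non-zero, the images of χ_A off s i and of χ_{s i} off A
    -- vanish by disjointness; so v equals the image of χ_{s i} there, hence 1.
    by_cases h8 : (θ (band (s i) hi (charN hp A hA hfin)) : Y →ₘ[ν] ℝ) y = 0
    · rw [h8, mul_zero]
    · rw [(mul_eq_zero.1 h4).resolve_left h8, add_zero] at h2
      rw [(mul_eq_zero.1 h5).resolve_left h8, add_zero] at h3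
      rw [← h3] at h1
      rw [hv, ← h2, h1.resolve_left h8]
      norm_num
  have hB : MeasurableSet {y | v y = 1} := hvm (measurableSet_singleton 1)
  refine ⟨{y | v y = 1}, hB, AEEqFun.ext ?_⟩
  filter_upwards [key, charFn_coe (μ := ν) hB] with y h1 h2
  rw [h2]
  by_cases h3 : v y = 1
  · simp [h3]
  · have : v y = 0 := by
      rcases mul_eq_zero.1 h1 with h4 | h4
      · exact (mul_eq_zero.1 h4).resolve_right fun h5 => h3 (by linarith)
      · exact h4
    simp [this]

end Continuity

/-! ### The density change -/

section DensityChange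

variable {Y : Type v} [MeasurableSpace Y] {ν ν' : Measure Y} {q ζ : Y → ℝ}

theorem norm_densityChange (hq : IsExponent ν q) (hζ : IsDensity ν ν' ζ) (f : nakano hq) :
    ‖densityChange hq hζ f‖ = ‖f‖ := by
  rw [norm_def, norm_def]
  congr 1
  ext c
  have : modular q (c⁻¹ • (densityChange hq hζ f : Y →ₘ[ν'] ℝ))
      = modular q (c⁻¹ • (f : Y →ₘ[ν] ℝ)) := by
    rw [← Submodule.coe_smul, ← map_smul]
    exact modular_densityChangeFn hq hζ _
  rw [Set.mem_ofPred_eq, Set.mem_ofPred_eq, this]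

theorem densityChange_coe (hq : IsExponent ν q) (hζ : IsDensity ν ν' ζ) (f : nakano hq) :
    ∀ᵐ y ∂ν', (densityChange hq hζ f : Y →ₘ[ν'] ℝ) y = ζ y ^ (1 / q y) * (f : Y →ₘ[ν] ℝ) y :=
  densityChangeFn_coe hq hζ f

variable {X : Type u} [MeasurableSpace X] {μ : Measure X} {p : X → ℝ} {hp : IsExponent μ p}

/-- The composition of an embedding with a density change. -/
noncomputable def IsometricLatticeEmbedding.densityChange {hq : IsExponent ν q}
    (θ : IsometricLatticeEmbedding hp hq) (hζ : IsDensity ν ν' ζ) :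
    IsometricLatticeEmbedding hp (hq.of_isDensity hζ) where
  toLinearMap := NakanoSpace.densityChange hq hζ ∘ₗ θ.toLinearMap
  map_sup' f g := by
    change NakanoSpace.densityChange hq hζ (θ (f ⊔ g)) = NakanoSpace.densityChange hq hζ (θ f) ⊔
      NakanoSpace.densityChange hq hζ (θ g)
    rw [θ.map_sup]
    refine ext_ae ?_
    filter_upwards [densityChange_coe hq hζ (θ f ⊔ θ g), densityChange_coe hq hζ (θ f),
      densityChange_coe hq hζ (θ g), hζ.ac'.ae_le (sup_coe (θ f) (θ g)),
      sup_coe (NakanoSpace.densityChange hq hζ (θ f)) (NakanoSpace.densityChange hq hζ (θ g))]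
      with y h1 h2 h3 h4 h5
    rw [h1, h5, h2, h3, h4, mul_max_of_nonneg _ _ (Real.rpow_nonneg (hζ.pos y).le _)]
  map_inf' f g := by
    change NakanoSpace.densityChange hq hζ (θ (f ⊓ g)) = NakanoSpace.densityChange hq hζ (θ f) ⊓
      NakanoSpace.densityChange hq hζ (θ g)
    rw [θ.map_inf]
    refine ext_ae ?_
    filter_upwards [densityChange_coe hq hζ (θ f ⊓ θ g), densityChange_coe hq hζ (θ f),
      densityChange_coe hq hζ (θ g), hζ.ac'.ae_le (inf_coe (θ f) (θ g)),
      inf_coe (NakanoSpace.densityChange hq hζ (θ f)) (NakanoSpace.densityChange hq hζ (θ g))]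
      with y h1 h2 h3 h4 h5
    rw [h1, h5, h2, h3, h4, mul_min_of_nonneg _ _ (Real.rpow_nonneg (hζ.pos y).le _)]
  norm_map' f := (norm_densityChange hq hζ (θ f)).trans (θ.norm_map' f)

theorem IsWitness.withDensity {κ : Type v} {t : κ → Set Y} (ht : IsWitness ν t) {w : Y → ℝ≥0∞}
    (hw : ∀ j, ∫⁻ y in t j, w y ∂ν < ∞) : IsWitness (ν.withDensity w) t where
  disjoint := ht.disjoint
  iUnion_eq := ht.iUnion_eq
  measurable := ht.measurable
  finite j := by rw [withDensity_apply _ (ht.measurable j)]; exact hw j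
  measurable_of_inter := ht.measurable_of_inter
  measure_eq_tsum A hA := by
    have h : ν.restrict A = Measure.sum fun j => ν.restrict (A ∩ t j) := by
      conv_lhs => rw [ht.measure_eq_sum]
      rw [Measure.restrict_sum _ hA]
      congr 1
      ext1 j
      rw [Measure.restrict_restrict hA]
    rw [withDensity_apply _ hA, h, lintegral_sum_measure]
    exact tsum_congr fun j => (withDensity_apply _ (hA.inter (ht.measurable j))).symm

/-- A strictly positive measurable function is the density of an equivalent strictly localisable
measure. -/
theorem StrictlyLocalisable.equivalent_withDensity (hν : StrictlyLocalisable ν) {w : Y → ℝ}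
    (hw : Measurable w) (hpos : ∀ y, 0 < w y) :
    Equivalent ν (ν.withDensity fun y => ENNReal.ofReal (w y)) ∧
      IsDensity ν (ν.withDensity fun y => ENNReal.ofReal (w y)) (fun y => (w y)⁻¹) := by
  obtain ⟨κ, t, ht⟩ := hν
  have hD : IsDensity ν (ν.withDensity fun y => ENNReal.ofReal (w y)) (fun y => (w y)⁻¹) := by
    have hwi : Measurable fun y => (w y)⁻¹ := hw.inv
    refine ⟨hwi, fun y => inv_pos.2 (hpos y), ?_⟩
    rw [← withDensity_mul ν hw.ennreal_ofReal hwi.ennreal_ofReal]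
    have : ((fun y => ENNReal.ofReal (w y)) * fun y => ENNReal.ofReal (w y)⁻¹) = 1 := by
      ext1 y
      rw [Pi.mul_apply, ← ENNReal.ofReal_mul (hpos y).le, mul_inv_cancel₀ (hpos y).ne',
        ENNReal.ofReal_one, Pi.one_apply]
    rw [this, withDensity_one]
  -- On pieces where the integer part of w is fixed w is bounded, so they have finite measure for
  -- both measures.
  have ht' := ht.subdivide (fun _ y => ⌊w y⌋₊) (fun _ => Nat.measurable_floor.comp hw)
  have ht'' : IsWitness (ν.withDensity fun y => ENNReal.ofReal (w y)) _ :=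
    ht'.withDensity fun z => by
      refine (setLIntegral_mono_ae' (g := fun _ => ENNReal.ofReal (z.2 + 1)) (ht'.measurable z)
        (Filter.Eventually.of_forall fun y hy => ?_)).trans_lt ?_
      · refine ENNReal.ofReal_le_ofReal ?_
        have h1 : ⌊w y⌋₊ = z.2 := hy.2
        rw [← h1]
        exact (Nat.lt_floor_add_one _).le
      · rw [setLIntegral_const]
        exact ENNReal.mul_lt_top ENNReal.ofReal_lt_top (ht'.finite z)
  exact ⟨⟨⟨_, _, ht'', ht', fun i => hD.ac.restrict _⟩,
    ⟨_, _, ht', ht'', fun i => hD.ac'.restrict _⟩⟩, hD⟩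

theorem Equivalent.strictlyLocalisable_right (h : Equivalent ν ν') : StrictlyLocalisable ν' := by
  obtain ⟨κ, t, h1, -, -⟩ := h.1
  exact ⟨κ, t, h1⟩

/-- After a suitable density change, an embedding sends the characteristic functions of the pieces
of a witness to characteristic functions. -/
theorem exists_densityChange {hq : IsExponent ν q} (θ : IsometricLatticeEmbedding hp hq)
    (hν : StrictlyLocalisable ν) {ι : Type u} {s : ι → Set X} (hs : IsWitness μ s) :
    ∃ (ν' : Measure Y) (ζ : Y → ℝ) (hζ : IsDensity ν ν' ζ), Equivalent ν ν' ∧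
      ∀ i, ∀ᵐ y ∂ν', (θ.densityChange hζ (charN hp (s i) (hs.measurable i) (hs.finite i))
          : Y →ₘ[ν'] ℝ) y = 0 ∨
        (θ.densityChange hζ (charN hp (s i) (hs.measurable i) (hs.finite i)) : Y →ₘ[ν'] ℝ) y
          = 1 := by
  set g : ι → Y →ₘ[ν] ℝ := fun i => (θ (charN hp (s i) (hs.measurable i) (hs.finite i))
    : Y →ₘ[ν] ℝ) with hg
  have hgm : ∀ i, Measurable (g i) := fun i => (g i).stronglyMeasurable.measurable
  have hg0 : ∀ i, ∀ᵐ y ∂ν, 0 ≤ g i y := by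
    intro i
    refine θ.map_nonneg_ae ?_
    filter_upwards [charN_coe hp (hs.measurable i) (hs.finite i)] with x hx
    rw [hx]
    exact Set.indicator_nonneg (fun _ _ => zero_le_one) x
  have hgd : Pairwise fun i j => ν ({y | 0 < g i y} ∩ {y | 0 < g j y}) = 0 := by
    intro i j hij
    have h1 : ∀ᵐ y ∂ν, g i y * g j y = 0 := by
      refine θ.map_disjoint_ae (mul_ae_eq_zero_of_disjoint (hs.disjoint hij) ?_ ?_)
      · filter_upwards [charN_coe hp (hs.measurable i) (hs.finite i)] with x hx h
        rw [hx, Set.indicator_of_notMem h]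
      · filter_upwards [charN_coe hp (hs.measurable j) (hs.finite j)] with x hx h
        rw [hx, Set.indicator_of_notMem h]
    refine measure_eq_zero_iff_ae_notMem.2 ?_
    filter_upwards [h1] with y hy
    rintro ⟨h2, h3⟩
    exact (mul_pos h2 h3).ne' hy
  obtain ⟨κ, t, ht⟩ := id hν
  -- The images of the pieces are essentially disjoint and combine into one function.
  obtain ⟨U, f, -, hf, hfg, -, -⟩ := ht.exists_glue (fun i => {y | 0 < g i y})
    (fun i => measurableSet_lt measurable_const (hgm i)) hgd (fun i => g i) hgm
  -- The default 1 keeps h positive. With ν' = h^q ν the density dν/dν' is h^{-q}, so D is division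
  -- by h and turns each image into a 0-1 function.
  set h : Y → ℝ := fun y => if 0 < f y then f y else 1 with hh
  have hhm : Measurable h := Measurable.ite (measurableSet_lt measurable_const hf) hf
    measurable_const
  have hpos : ∀ y, 0 < h y := by
    intro y
    simp only [hh]
    split_ifs with h1
    · exact h1
    · exact one_pos
  obtain ⟨heq, hD⟩ := hν.equivalent_withDensity (w := fun y => h y ^ q y) (hhm.pow hq.measurable)
    (fun y => Real.rpow_pos_of_pos (hpos y) _)
  set ν₁ := ν.withDensity fun y => ENNReal.ofReal (h y ^ q y)
  refine ⟨ν₁, _, hD, heq, fun i => ?_⟩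
  filter_upwards [densityChange_coe hq hD (θ (charN hp (s i) (hs.measurable i) (hs.finite i))),
    hD.ac'.ae_le (hg0 i), hD.ac'.ae_le (hfg i)] with y h1 h2 h3
  change (NakanoSpace.densityChange hq hD (θ (charN hp (s i) (hs.measurable i) (hs.finite i)))
      : Y →ₘ[ν₁] ℝ) y = 0 ∨ (NakanoSpace.densityChange hq hD
        (θ (charN hp (s i) (hs.measurable i) (hs.finite i))) : Y →ₘ[ν₁] ℝ) y = 1
  rw [h1]
  change _ * g i y = 0 ∨ _ * g i y = 1
  rcases h2.eq_or_lt with h4 | h4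
  · left
    rw [← h4, mul_zero]
  · right
    have h5 : h y = g i y := by
      have := (h3 h4).2
      simp only [hh]
      rw [this, if_pos h4]
    have hq0 : q y ≠ 0 := by linarith [hq.one_le y]
    rw [h5, ← Real.rpow_neg h4.le, ← Real.rpow_mul h4.le, neg_mul, mul_one_div_cancel hq0,
      Real.rpow_neg_one, inv_mul_cancel₀ h4.ne']

end DensityChange

/-! ### The extension to all measurable functions -/

section Extension

variable {X : Type u} {Y : Type v} [MeasurableSpace X] [MeasurableSpace Y] {μ : Measure X}
  {ν : Measure Y} {p : X → ℝ} {q : Y → ℝ} {hp : IsExponent μ p} {hq : IsExponent ν q}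
  {θ : IsometricLatticeEmbedding hp hq} {ι : Type u} {s : ι → Set X}

/-- The embedding `θ` preserves energy and sends the characteristic function of a set `A` of finite
measure to that of `b A`. -/
structure IsSetImage (θ : IsometricLatticeEmbedding hp hq) (b : Set X → Set Y) : Prop where
  preserves : PreservesEnergy θ
  measurable : ∀ A, MeasurableSet (b A)
  map_charN : ∀ A (hA : MeasurableSet A) (hfin : μ A < ∞),
    (θ (charN hp A hA hfin) : Y →ₘ[ν] ℝ) = charFn ν (b A) (measurable A)

theorem PreservesEnergy.exists_isSetImage (hθ : PreservesEnergy θ)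
    (h : ∀ A (hA : MeasurableSet A) (hfin : μ A < ∞), ∃ (B : Set Y) (hB : MeasurableSet B),
      (θ (charN hp A hA hfin) : Y →ₘ[ν] ℝ) = charFn ν B hB) : ∃ b, IsSetImage θ b := by
  have : ∀ A : Set X, ∃ B : Set Y, ∃ hB : MeasurableSet B, ∀ (hA : MeasurableSet A)
      (hfin : μ A < ∞), (θ (charN hp A hA hfin) : Y →ₘ[ν] ℝ) = charFn ν B hB := by
    intro A
    by_cases hA : MeasurableSet A ∧ μ A < ∞
    · obtain ⟨B, hB, h1⟩ := h A hA.1 hA.2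
      exact ⟨B, hB, fun _ _ => h1⟩
    · exact ⟨∅, MeasurableSet.empty, fun h1 h2 => absurd ⟨h1, h2⟩ hA⟩
  choose b hb h1 using this
  exact ⟨b, hθ, hb, h1⟩

variable {b : Set X → Set Y}

theorem IsSetImage.map_charN_coe (hb : IsSetImage θ b) {A : Set X} (hA : MeasurableSet A)
    (hfin : μ A < ∞) : ∀ᵐ y ∂ν, (θ (charN hp A hA hfin) : Y →ₘ[ν] ℝ) y
      = (b A).indicator (fun _ => (1 : ℝ)) y := by
  rw [hb.map_charN A hA hfin]
  exact charFn_coe _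

/-- Off b A the image of χ_A f vanishes: on pieces with |f| ≤ n + 1 it is dominated by (n + 1) χ_{b
A}, and continuity along the witness collects them. On b A the image of the rest of f vanishes,
being disjoint from θ χ_A. -/
theorem IsSetImage.map_band_coe (hb : IsSetImage θ b) (hs : IsWitness μ s) {A : Set X}
    (hA : MeasurableSet A) (hfin : μ A < ∞) (f : nakano hp) :
    ∀ᵐ y ∂ν, (θ (band A hA f) : Y →ₘ[ν] ℝ) y = (b A).indicator (θ f : Y →ₘ[ν] ℝ) y := by
  have hfm : Measurable (f : X →ₘ[μ] ℝ) := (f : X →ₘ[μ] ℝ).stronglyMeasurable.measurable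
  have hout : ∀ᵐ y ∂ν, (1 - (b A).indicator (fun _ => (1 : ℝ)) y)
      * (θ (band A hA f) : Y →ₘ[ν] ℝ) y = 0 := by
    have hs' := hs.subdivide (fun _ x => ⌊|(f : X →ₘ[μ] ℝ) x|⌋₊)
      (fun _ => Nat.measurable_floor.comp (measurable_abs.comp hfm))
    refine hb.preserves.mul_map_eq_zero hs' _
      (measurable_const.sub (measurable_const.indicator (hb.measurable A))) fun z => ?_
    have hle : ∀ᵐ x ∂μ, |(band _ (hs'.measurable z) (band A hA f) : X →ₘ[μ] ℝ) x|
        ≤ ((((z.2 : ℝ) + 1) • charN hp A hA hfin : nakano hp) : X →ₘ[μ] ℝ) x := by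
      filter_upwards [band_coe (hs'.measurable z) (band A hA f), band_coe hA f,
        smul_coe ((z.2 : ℝ) + 1) (charN hp A hA hfin), charN_coe hp hA hfin] with x h1 h2 h3 h4
      rw [h1, h3, h4]
      by_cases hx : x ∈ s z.1 ∩ (fun x => ⌊|(f : X →ₘ[μ] ℝ) x|⌋₊) ⁻¹' {z.2}
      · rw [Set.indicator_of_mem hx, h2]
        have h5 : ⌊|(f : X →ₘ[μ] ℝ) x|⌋₊ = z.2 := hx.2
        by_cases hxA : x ∈ A
        · simp only [hxA, Set.indicator_of_mem, mul_one]
          rw [← h5]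
          exact (Nat.lt_floor_add_one _).le
        · simp [hxA]
      · rw [Set.indicator_of_notMem hx, abs_zero]
        exact mul_nonneg (by positivity) (Set.indicator_nonneg (fun _ _ => zero_le_one) x)
    filter_upwards [θ.map_abs_le_ae hle, hb.map_charN_coe hA hfin,
      smul_coe ((z.2 : ℝ) + 1) (θ (charN hp A hA hfin))] with y h1 h2 h3
    rw [map_smul, h3, h2] at h1
    by_cases hy : y ∈ b A
    · simp [hy]
    · rw [Set.indicator_of_notMem hy, mul_zero] at h1
      rw [abs_nonpos_iff.1 h1, mul_zero]
  have hin : ∀ᵐ y ∂ν, (θ (charN hp A hA hfin) : Y →ₘ[ν] ℝ) y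
      * (θ (band Aᶜ hA.compl f) : Y →ₘ[ν] ℝ) y = 0 := by
    refine θ.map_disjoint_ae (mul_ae_eq_zero_of_disjoint (disjoint_compl_right (a := A)) ?_
      (band_eq_zero_of_notMem hA.compl f))
    filter_upwards [charN_coe hp hA hfin] with x hx hxA
    rw [hx, Set.indicator_of_notMem hxA]
  have hadd := congrArg (fun u => θ u) (band_add_band_compl hA f)
  simp only [map_add] at hadd
  filter_upwards [hout, hin, hb.map_charN_coe hA hfin, ae_eq_of_eq hadd,
    add_coe (θ (band A hA f)) (θ (band Aᶜ hA.compl f))] with y h1 h2 h3 h4 h5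
  by_cases hy : y ∈ b A
  · rw [h3, Set.indicator_of_mem hy, one_mul] at h2
    rw [h5, h2, add_zero] at h4
    rw [h4, Set.indicator_of_mem hy]
  · rw [Set.indicator_of_notMem hy, sub_zero, one_mul] at h1
    rw [h1, Set.indicator_of_notMem hy]

theorem IsSetImage.inter (hb : IsSetImage θ b) (hs : IsWitness μ s) {A B : Set X}
    (hA : MeasurableSet A) (hB : MeasurableSet B) (hAf : μ A < ∞) (hBf : μ B < ∞) :
    ∀ᵐ y ∂ν, y ∈ b (A ∩ B) ↔ y ∈ b A ∧ y ∈ b B := by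
  have hABf : μ (A ∩ B) < ∞ := (measure_mono Set.inter_subset_left).trans_lt hAf
  have he : band A hA (charN hp B hB hBf) = charN hp (A ∩ B) (hA.inter hB) hABf := by
    refine ext_ae ?_
    filter_upwards [band_coe hA (charN hp B hB hBf), charN_coe hp hB hBf,
      charN_coe hp (hA.inter hB) hABf] with x h1 h2 h3
    rw [h1, h3]
    by_cases hxA : x ∈ A <;> by_cases hxB : x ∈ B <;> simp [hxA, hxB, h2]
  filter_upwards [hb.map_band_coe hs hA hAf (charN hp B hB hBf), hb.map_charN_coe hB hBf,
    hb.map_charN_coe (hA.inter hB) hABf] with y h1 h2 h3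
  rw [he, h3] at h1
  by_cases hyA : y ∈ b A <;> by_cases hyB : y ∈ b B <;> by_cases hy : y ∈ b (A ∩ B) <;>
    simp_all

theorem IsSetImage.mono (hb : IsSetImage θ b) (hs : IsWitness μ s) {A B : Set X}
    (hA : MeasurableSet A) (hB : MeasurableSet B) (hBf : μ B < ∞) (hAB : A ⊆ B) :
    ∀ᵐ y ∂ν, y ∈ b A → y ∈ b B := by
  filter_upwards [hb.inter hs hA hB ((measure_mono hAB).trans_lt hBf) hBf] with y hy h
  rw [Set.inter_eq_left.2 hAB] at hy
  exact (hy.1 h).2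

/-- The sets b (A ∩ s i) essentially exhaust b A. For an uncountable witness this is no union of
null sets but continuity, applied with d the indicator of the failure of P. -/
theorem IsSetImage.ae_of_witness (hb : IsSetImage θ b) (hs : IsWitness μ s) {A : Set X}
    (hA : MeasurableSet A) (hfin : μ A < ∞) {P : Y → Prop} (hP : MeasurableSet {y | P y})
    (h : ∀ i, ∀ᵐ y ∂ν, y ∈ b (A ∩ s i) → P y) : ∀ᵐ y ∂ν, y ∈ b A → P y := by
  have key : ∀ᵐ y ∂ν, {y | P y}ᶜ.indicator (fun _ => (1 : ℝ)) y
      * (θ (charN hp A hA hfin) : Y →ₘ[ν] ℝ) y = 0 := by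
    refine hb.preserves.mul_map_eq_zero hs _ (measurable_const.indicator hP.compl) fun i => ?_
    filter_upwards [h i, hb.map_band_coe hs (hs.measurable i) (hs.finite i) (charN hp A hA hfin),
      hb.map_charN_coe hA hfin, hb.inter hs hA (hs.measurable i) hfin (hs.finite i)]
      with y h1 h2 h3 h4
    rw [h2]
    by_cases h5 : y ∈ b (s i)
    · by_cases h6 : y ∈ b A
      · have : y ∉ {y | P y}ᶜ := fun h7 => h7 (h1 (h4.2 ⟨h6, h5⟩))
        rw [Set.indicator_of_notMem this, zero_mul]
      · rw [Set.indicator_of_mem h5, h3, Set.indicator_of_notMem h6, mul_zero]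
    · rw [Set.indicator_of_notMem h5, mul_zero]
  filter_upwards [key, hb.map_charN_coe hA hfin] with y h1 h2 h3
  by_contra h4
  have h5 : y ∈ {y | P y}ᶜ := h4
  rw [h2, Set.indicator_of_mem h3, Set.indicator_of_mem h5] at h1
  norm_num at h1

/-- `U` is the essential union of the images of the sets of finite measure. -/
structure IsRange (θ : IsometricLatticeEmbedding hp hq) (b : Set X → Set Y) (U : Set Y) :
    Prop where
  measurable : MeasurableSet U
  subset : ∀ A, MeasurableSet A → μ A < ∞ → ∀ᵐ y ∂ν, y ∈ b A → y ∈ U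
  null_of_forall : ∀ B : Set Y, (∀ A, MeasurableSet A → μ A < ∞ → ν (B ∩ b A) = 0) →
    ν (B ∩ U) = 0
  support : ∀ f : nakano hp, ∀ᵐ y ∂ν, y ∉ U → (θ f : Y →ₘ[ν] ℝ) y = 0

theorem IsSetImage.pairwise_null (hb : IsSetImage θ b) (hs : IsWitness μ s) :
    Pairwise fun i j => ν (b (s i) ∩ b (s j)) = 0 := by
  intro i j hij
  have h1 := θ.map_disjoint_ae (f := charN hp (s i) (hs.measurable i) (hs.finite i))
    (g := charN hp (s j) (hs.measurable j) (hs.finite j))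
    (mul_ae_eq_zero_of_disjoint (hs.disjoint hij)
      (by
        filter_upwards [charN_coe hp (hs.measurable i) (hs.finite i)] with x hx hxA
        rw [hx, Set.indicator_of_notMem hxA])
      (by
        filter_upwards [charN_coe hp (hs.measurable j) (hs.finite j)] with x hx hxA
        rw [hx, Set.indicator_of_notMem hxA]))
  refine measure_eq_zero_iff_ae_notMem.2 ?_
  filter_upwards [h1, hb.map_charN_coe (hs.measurable i) (hs.finite i),
    hb.map_charN_coe (hs.measurable j) (hs.finite j)] with y h2 h3 h4
  rintro ⟨h5, h6⟩
  rw [h3, h4, Set.indicator_of_mem h5, Set.indicator_of_mem h6] at h2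
  norm_num at h2

theorem IsSetImage.exists_isRange (hb : IsSetImage θ b) (hs : IsWitness μ s)
    (hν : StrictlyLocalisable ν) : ∃ U, IsRange θ b U := by
  obtain ⟨κ, t, ht⟩ := hν
  -- Gluing zero functions is a device for obtaining the essential union of a possibly uncountable
  -- family.
  obtain ⟨U, f, hU, -, h1, -, h2⟩ := ht.exists_glue (fun i => b (s i)) (fun i => hb.measurable _)
    (hb.pairwise_null hs) (fun _ _ => 0) (fun _ => measurable_const)
  refine ⟨U, hU, fun A hA hfin => ?_, fun B hB => ?_, fun f => ?_⟩
  · refine hb.ae_of_witness hs hA hfin hU fun i => ?_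
    filter_upwards [h1 i, hb.mono hs (hA.inter (hs.measurable i)) (hs.measurable i) (hs.finite i)
      Set.inter_subset_right] with y h3 h4 h5
    exact (h3 (h4 h5)).1
  · exact h2 B fun i => hB _ (hs.measurable i) (hs.finite i)
  · have : ∀ᵐ y ∂ν, Uᶜ.indicator (fun _ => (1 : ℝ)) y * (θ f : Y →ₘ[ν] ℝ) y = 0 := by
      refine hb.preserves.mul_map_eq_zero hs f (measurable_const.indicator hU.compl) fun i => ?_
      filter_upwards [h1 i, hb.map_band_coe hs (hs.measurable i) (hs.finite i) f] with y h3 h4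
      rw [h4]
      by_cases h5 : y ∈ b (s i)
      · have : y ∉ Uᶜ := fun h6 => h6 (h3 h5).1
        rw [Set.indicator_of_notMem this, zero_mul]
      · rw [Set.indicator_of_notMem h5, mul_zero]
    filter_upwards [this] with y h3 h4
    have h5 : y ∈ Uᶜ := h4
    rwa [Set.indicator_of_mem h5, one_mul] at h3

/-- The graph of the extension of `θ` to `L_0(X, μ)`. -/
structure ExtendsTo (θ : IsometricLatticeEmbedding hp hq) (b : Set X → Set Y) (U : Set Y)
    (f : X →ₘ[μ] ℝ) (g : Y →ₘ[ν] ℝ) : Prop where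
  eq_indicator : ∀ A (hA : MeasurableSet A), μ A < ∞ → ∀ hm : charFn μ A hA * f ∈ nakano hp,
    ∀ᵐ y ∂ν, (θ ⟨charFn μ A hA * f, hm⟩ : Y →ₘ[ν] ℝ) y = (b A).indicator g y
  support : ∀ᵐ y ∂ν, y ∉ U → g y = 0

theorem charFn_mul_mem (hp : IsExponent μ p) {A : Set X} (hA : MeasurableSet A) (hfin : μ A < ∞)
    {f : X →ₘ[μ] ℝ} {c : ℝ} (h : ∀ᵐ x ∂μ, x ∈ A → |f x| ≤ c) : charFn μ A hA * f ∈ nakano hp := by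
  refine mem_nakano_of_abs_le (c • charN hp A hA hfin).2 ?_
  filter_upwards [h, charFn_mul_coe hA f, smul_coe c (charN hp A hA hfin),
    charN_coe hp hA hfin] with x h1 h2 h3 h4
  rw [h2, h3, h4]
  by_cases hx : x ∈ A
  · simpa [hx] using (h1 hx).trans (le_abs_self c)
  · simp [hx]

variable {U : Set Y}

/-- Testing on subsets of single pieces is enough, because agreement of two measurable functions on
b A can be checked along any witness. -/
theorem ExtendsTo.of_witness (hb : IsSetImage θ b) (hs : IsWitness μ s) {f : X →ₘ[μ] ℝ}
    {g : Y →ₘ[ν] ℝ}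
    (h : ∀ i A (hA : MeasurableSet A), A ⊆ s i → ∀ hm : charFn μ A hA * f ∈ nakano hp,
      ∀ᵐ y ∂ν, (θ ⟨charFn μ A hA * f, hm⟩ : Y →ₘ[ν] ℝ) y = (b A).indicator g y)
    (hsupp : ∀ᵐ y ∂ν, y ∉ U → g y = 0) : ExtendsTo θ b U f g := by
  refine ⟨fun A hA hfin hm => ?_, hsupp⟩
  set w : nakano hp := ⟨charFn μ A hA * f, hm⟩ with hw
  have hbw : band A hA w = w := by
    refine ext_ae ?_
    filter_upwards [band_coe hA w, charFn_mul_coe hA f] with x h1 h2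
    rw [h1]
    by_cases hx : x ∈ A
    · simp [hx]
    · rw [Set.indicator_of_notMem hx] at h2 ⊢
      exact h2.symm
  have hin : ∀ᵐ y ∂ν, y ∈ b A → (θ w : Y →ₘ[ν] ℝ) y = g y := by
    refine hb.ae_of_witness hs hA hfin (P := fun y => (θ w : Y →ₘ[ν] ℝ) y = g y)
      (measurableSet_eq_fun (θ w : Y →ₘ[ν] ℝ).stronglyMeasurable.measurable
      g.stronglyMeasurable.measurable) fun i => ?_
    have hAi := hA.inter (hs.measurable i)
    have he : (band (A ∩ s i) hAi w : X →ₘ[μ] ℝ) = charFn μ (A ∩ s i) hAi * f := by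
      refine AEEqFun.ext ?_
      filter_upwards [band_coe hAi w, charFn_mul_coe hAi f, charFn_mul_coe hA f] with x h1 h2 h3
      rw [h1, h2]
      by_cases hx : x ∈ A ∩ s i
      · rw [Set.indicator_of_mem hx, Set.indicator_of_mem hx]
        rw [Set.indicator_of_mem hx.1] at h3
        exact h3
      · rw [Set.indicator_of_notMem hx, Set.indicator_of_notMem hx]
    have hm' : charFn μ (A ∩ s i) hAi * f ∈ nakano hp := he ▸ (band (A ∩ s i) hAi w).2
    have he' : band (A ∩ s i) hAi w = ⟨charFn μ (A ∩ s i) hAi * f, hm'⟩ := Subtype.ext he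
    have hfin' : μ (A ∩ s i) < ∞ := (measure_mono Set.inter_subset_left).trans_lt hfin
    filter_upwards [h i _ hAi Set.inter_subset_right hm', hb.map_band_coe hs hAi hfin' w]
      with y h1 h2 h3
    rw [he', h1, Set.indicator_of_mem h3, Set.indicator_of_mem h3] at h2
    exact h2.symm
  filter_upwards [hin, hb.map_band_coe hs hA hfin w] with y h1 h2
  rw [hbw] at h2
  by_cases hy : y ∈ b A
  · rw [Set.indicator_of_mem hy, h1 hy]
  · rw [h2, Set.indicator_of_notMem hy, Set.indicator_of_notMem hy]

theorem IsWitness.subdivide_abs (hs : IsWitness μ s) (f : X →ₘ[μ] ℝ) :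
    IsWitness μ (fun z : ι × ℕ => s z.1 ∩ (fun x => ⌊|f x|⌋₊) ⁻¹' {z.2}) :=
  hs.subdivide (fun _ x => ⌊|f x|⌋₊)
    (fun _ => Nat.measurable_floor.comp (measurable_abs.comp f.stronglyMeasurable.measurable))

theorem abs_le_of_mem_subdivide {Z κ : Type*} {t : κ → Set Z} {f : Z → ℝ} {z : κ × ℕ} {x : Z}
    (h : x ∈ t z.1 ∩ (fun x => ⌊|f x|⌋₊) ⁻¹' {z.2}) : |f x| ≤ z.2 + 1 := by
  have : ⌊|f x|⌋₊ = z.2 := h.2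
  rw [← this]
  exact (Nat.lt_floor_add_one _).le

/-- After subdivision f is bounded on each piece, so its restrictions lie in the Nakano space. Their
images are glued over the essentially disjoint images of the pieces. -/
theorem IsSetImage.exists_extendsTo (hb : IsSetImage θ b) (hU : IsRange θ b U)
    (hs : IsWitness μ s) (hν : StrictlyLocalisable ν) (f : X →ₘ[μ] ℝ) :
    ∃ g : Y →ₘ[ν] ℝ, ExtendsTo θ b U f g := by
  obtain ⟨κ, t, ht⟩ := hν
  have hs' := hs.subdivide_abs f
  have hm : ∀ z, charFn μ _ (hs'.measurable z) * f ∈ nakano hp := fun z =>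
    charFn_mul_mem hp _ (hs'.finite z)
      (Filter.Eventually.of_forall fun x hx => abs_le_of_mem_subdivide hx)
  obtain ⟨V, g, hV, hg, h1, h2, h3⟩ := ht.exists_glue (fun z : ι × ℕ => b _)
    (fun z => hb.measurable _) (hb.pairwise_null hs')
    (fun z => (θ ⟨_, hm z⟩ : Y →ₘ[ν] ℝ))
    (fun z => (θ ⟨_, hm z⟩ : Y →ₘ[ν] ℝ).stronglyMeasurable.measurable)
  refine ⟨AEEqFun.mk g hg.aestronglyMeasurable, ExtendsTo.of_witness hb hs' ?_ ?_⟩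
  · intro z A hA hAz hm'
    have hfin : μ A < ∞ := (measure_mono hAz).trans_lt (hs'.finite z)
    have he : (⟨charFn μ A hA * f, hm'⟩ : nakano hp) = band A hA ⟨_, hm z⟩ := by
      refine ext_ae ?_
      filter_upwards [charFn_mul_coe hA f, band_coe hA (⟨_, hm z⟩ : nakano hp),
        charFn_mul_coe (hs'.measurable z) f] with x h4 h5 h6
      rw [h4, h5]
      by_cases hx : x ∈ A
      · rw [Set.indicator_of_mem hx, Set.indicator_of_mem hx, h6, Set.indicator_of_mem (hAz hx)]
      · rw [Set.indicator_of_notMem hx, Set.indicator_of_notMem hx]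
    rw [he]
    filter_upwards [hb.map_band_coe hs hA hfin ⟨_, hm z⟩, h1 z,
      AEEqFun.coeFn_mk g hg.aestronglyMeasurable (μ := ν),
      hb.mono hs hA (hs'.measurable z) (hs'.finite z) hAz] with y h4 h5 h6 h7
    rw [h4]
    by_cases hy : y ∈ b A
    · rw [Set.indicator_of_mem hy, Set.indicator_of_mem hy, h6, (h5 (h7 hy)).2]
    · rw [Set.indicator_of_notMem hy, Set.indicator_of_notMem hy]
  -- The glued function lives on V, the essential union of the images of the subdivided pieces,
  -- which lies in U up to a null set.
  · have h4 : ν (Uᶜ ∩ V) = 0 := by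
      refine h3 _ fun z => measure_eq_zero_iff_ae_notMem.2 ?_
      filter_upwards [hU.subset _ (hs'.measurable z) (hs'.finite z)] with y h5 h6
      exact h6.1 (h5 h6.2)
    filter_upwards [measure_eq_zero_iff_ae_notMem.1 h4,
      AEEqFun.coeFn_mk g hg.aestronglyMeasurable (μ := ν)] with y h5 h6 h7
    rw [h6]
    exact h2 y fun h8 => h5 ⟨h7, h8⟩

theorem IsRange.ae_of_forall (hU : IsRange θ b U) {P : Y → Prop}
    (h : ∀ A, MeasurableSet A → μ A < ∞ → ∀ᵐ y ∂ν, y ∈ b A → P y)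
    (h' : ∀ᵐ y ∂ν, y ∉ U → P y) : ∀ᵐ y ∂ν, P y := by
  have h1 : ν ({y | ¬ P y} ∩ U) = 0 := by
    refine hU.null_of_forall _ fun A hA hfin => measure_eq_zero_iff_ae_notMem.2 ?_
    filter_upwards [h A hA hfin] with y h2 h3
    exact h3.1 (h2 h3.2)
  filter_upwards [measure_eq_zero_iff_ae_notMem.1 h1, h'] with y h2 h3
  by_contra h4
  exact h2 ⟨h4, by_contra fun h5 => h4 (h3 h5)⟩

theorem ExtendsTo.unique (hb : IsSetImage θ b) (hU : IsRange θ b U) (hs : IsWitness μ s)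
    {f : X →ₘ[μ] ℝ} {g g' : Y →ₘ[ν] ℝ} (h : ExtendsTo θ b U f g) (h' : ExtendsTo θ b U f g') :
    g = g' := by
  refine AEEqFun.ext (hU.ae_of_forall (fun A hA hfin => ?_) ?_)
  · have hs' := hs.subdivide_abs f
    refine hb.ae_of_witness hs' hA hfin (measurableSet_eq_fun g.stronglyMeasurable.measurable
      g'.stronglyMeasurable.measurable) fun z => ?_
    have hAz := hA.inter (hs'.measurable z)
    have hAzf : μ (A ∩ _) < ∞ := (measure_mono Set.inter_subset_right).trans_lt (hs'.finite z)
    have hm := charFn_mul_mem hp hAz hAzf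
      (Filter.Eventually.of_forall fun x hx => abs_le_of_mem_subdivide (f := f) hx.2)
    filter_upwards [h.eq_indicator _ hAz hAzf hm, h'.eq_indicator _ hAz hAzf hm] with y h1 h2 h3
    rw [h1, Set.indicator_of_mem h3, Set.indicator_of_mem h3] at h2
    exact h2
  · filter_upwards [h.support, h'.support] with y h1 h2 h3
    rw [h1 h3, h2 h3]

/-- The extension of `θ` respects the point-wise operations which `θ` respects. -/
theorem ExtendsTo.binary (hb : IsSetImage θ b) (hs : IsWitness μ s) (op : ℝ → ℝ → ℝ)
    (h0 : op 0 0 = 0)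
    (hop : ∀ u v w : nakano hp,
      (∀ᵐ x ∂μ, (w : X →ₘ[μ] ℝ) x = op ((u : X →ₘ[μ] ℝ) x) ((v : X →ₘ[μ] ℝ) x)) →
      ∀ᵐ y ∂ν, (θ w : Y →ₘ[ν] ℝ) y = op ((θ u : Y →ₘ[ν] ℝ) y) ((θ v : Y →ₘ[ν] ℝ) y))
    {f₁ f₂ f : X →ₘ[μ] ℝ} {g₁ g₂ g : Y →ₘ[ν] ℝ} (h₁ : ExtendsTo θ b U f₁ g₁)
    (h₂ : ExtendsTo θ b U f₂ g₂) (hf : ∀ᵐ x ∂μ, f x = op (f₁ x) (f₂ x))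
    (hg : ∀ᵐ y ∂ν, g y = op (g₁ y) (g₂ y)) : ExtendsTo θ b U f g := by
  -- Both functions must be bounded on each piece for θ to apply to both restrictions.
  have hs' := (hs.subdivide_abs f₁).subdivide_abs f₂
  refine ExtendsTo.of_witness hb hs' (fun z A hA hAz hm => ?_) ?_
  · have hfin : μ A < ∞ := (measure_mono hAz).trans_lt (hs'.finite z)
    have hm₁ := charFn_mul_mem hp hA hfin (f := f₁) (c := z.1.2 + 1)
      (Filter.Eventually.of_forall fun x hx => abs_le_of_mem_subdivide (f := f₁) (hAz hx).1)
    have hm₂ := charFn_mul_mem hp hA hfin (f := f₂)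
      (Filter.Eventually.of_forall fun x hx => abs_le_of_mem_subdivide (f := f₂)
        (t := fun z : ι × ℕ => s z.1 ∩ (fun x => ⌊|f₁ x|⌋₊) ⁻¹' {z.2}) (hAz hx))
    have h3 := hop ⟨_, hm₁⟩ ⟨_, hm₂⟩ ⟨_, hm⟩ (by
      filter_upwards [hf, charFn_mul_coe hA f, charFn_mul_coe hA f₁, charFn_mul_coe hA f₂]
        with x h4 h5 h6 h7
      rw [h5, h6, h7]
      by_cases hx : x ∈ A
      · simpa [hx] using h4
      · simp [hx, h0])
    filter_upwards [h3, h₁.eq_indicator A hA hfin hm₁, h₂.eq_indicator A hA hfin hm₂, hg]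
      with y h4 h5 h6 h7
    rw [h4, h5, h6]
    by_cases hy : y ∈ b A
    · simp [hy, h7]
    · simp [hy, h0]
  · filter_upwards [h₁.support, h₂.support, hg] with y h3 h4 h5 h6
    rw [h5, h3 h6, h4 h6, h0]

theorem ExtendsTo.add (hb : IsSetImage θ b) (hs : IsWitness μ s) {f₁ f₂ : X →ₘ[μ] ℝ}
    {g₁ g₂ : Y →ₘ[ν] ℝ} (h₁ : ExtendsTo θ b U f₁ g₁) (h₂ : ExtendsTo θ b U f₂ g₂) :
    ExtendsTo θ b U (f₁ + f₂) (g₁ + g₂) := by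
  refine ExtendsTo.binary hb hs (· + ·) (add_zero 0) (fun u v w h => ?_) h₁ h₂
    (AEEqFun.coeFn_add f₁ f₂) (AEEqFun.coeFn_add g₁ g₂)
  have : w = u + v := ext_ae (by
    filter_upwards [h, add_coe u v] with x h1 h2
    rw [h1, h2])
  rw [this, map_add]
  exact add_coe _ _

theorem ExtendsTo.smul (hb : IsSetImage θ b) (hs : IsWitness μ s) (c : ℝ) {f : X →ₘ[μ] ℝ}
    {g : Y →ₘ[ν] ℝ} (h : ExtendsTo θ b U f g) : ExtendsTo θ b U (c • f) (c • g) := by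
  refine ExtendsTo.binary hb hs (fun a _ => c * a) (mul_zero c) (fun u v w h => ?_) h h
    (AEEqFun.coeFn_smul c f) (AEEqFun.coeFn_smul c g)
  have : w = c • u := ext_ae (by
    filter_upwards [h, smul_coe c u] with x h1 h2
    rw [h1, h2])
  rw [this, map_smul]
  exact smul_coe _ _

theorem ExtendsTo.sup (hb : IsSetImage θ b) (hs : IsWitness μ s) {f₁ f₂ : X →ₘ[μ] ℝ}
    {g₁ g₂ : Y →ₘ[ν] ℝ} (h₁ : ExtendsTo θ b U f₁ g₁) (h₂ : ExtendsTo θ b U f₂ g₂) :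
    ExtendsTo θ b U (f₁ ⊔ f₂) (g₁ ⊔ g₂) := by
  refine ExtendsTo.binary hb hs (· ⊔ ·) (sup_idem 0) (fun u v w h => ?_) h₁ h₂
    (AEEqFun.coeFn_sup f₁ f₂) (AEEqFun.coeFn_sup g₁ g₂)
  have : w = u ⊔ v := ext_ae (by
    filter_upwards [h, sup_coe u v] with x h1 h2
    rw [h1, h2])
  rw [this, θ.map_sup]
  exact sup_coe _ _

theorem ExtendsTo.inf (hb : IsSetImage θ b) (hs : IsWitness μ s) {f₁ f₂ : X →ₘ[μ] ℝ}
    {g₁ g₂ : Y →ₘ[ν] ℝ} (h₁ : ExtendsTo θ b U f₁ g₁) (h₂ : ExtendsTo θ b U f₂ g₂) :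
    ExtendsTo θ b U (f₁ ⊓ f₂) (g₁ ⊓ g₂) := by
  refine ExtendsTo.binary hb hs (· ⊓ ·) (inf_idem 0) (fun u v w h => ?_) h₁ h₂
    (AEEqFun.coeFn_inf f₁ f₂) (AEEqFun.coeFn_inf g₁ g₂)
  have : w = u ⊓ v := ext_ae (by
    filter_upwards [h, inf_coe u v] with x h1 h2
    rw [h1, h2])
  rw [this, θ.map_inf]
  exact inf_coe _ _

theorem IsSetImage.extendsTo_self (hb : IsSetImage θ b) (hU : IsRange θ b U)
    (hs : IsWitness μ s) (f : nakano hp) : ExtendsTo θ b U f (θ f) :=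
  ⟨fun _ hA hfin _ => hb.map_band_coe hs hA hfin f, hU.support f⟩

theorem IsSetImage.extendsTo_charFn_univ (hb : IsSetImage θ b) (hU : IsRange θ b U) :
    ExtendsTo θ b U (charFn μ Set.univ MeasurableSet.univ) (charFn ν U hU.measurable) := by
  refine ⟨fun A hA hfin hm => ?_, ?_⟩
  · have he : (⟨_, hm⟩ : nakano hp) = charN hp A hA hfin := by
      refine ext_ae ?_
      filter_upwards [charFn_mul_coe hA (charFn μ Set.univ MeasurableSet.univ),
        charFn_coe (μ := μ) MeasurableSet.univ, charN_coe hp hA hfin] with x h1 h2 h3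
      rw [h1, h3]
      by_cases hx : x ∈ A <;> simp [hx, h2]
    rw [he]
    filter_upwards [hb.map_charN_coe hA hfin, charFn_coe (μ := ν) hU.measurable,
      hU.subset A hA hfin] with y h1 h2 h3
    rw [h1]
    by_cases hy : y ∈ b A
    · rw [Set.indicator_of_mem hy, Set.indicator_of_mem hy, h2, Set.indicator_of_mem (h3 hy)]
    · rw [Set.indicator_of_notMem hy, Set.indicator_of_notMem hy]
  · filter_upwards [charFn_coe (μ := ν) hU.measurable] with y h1 h2
    rw [h1, Set.indicator_of_notMem h2]

theorem ExtendsTo.charFn_mul (hb : IsSetImage θ b) (hs : IsWitness μ s) {C : Set X}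
    (hC : MeasurableSet C) (hCf : μ C < ∞) {f : X →ₘ[μ] ℝ} {g : Y →ₘ[ν] ℝ}
    (h : ExtendsTo θ b U f g) :
    ExtendsTo θ b U (charFn μ C hC * f) (charFn ν (b C) (hb.measurable C) * g) := by
  refine ⟨fun A hA hfin hm => ?_, ?_⟩
  · have he : charFn μ A hA * (charFn μ C hC * f) = charFn μ (A ∩ C) (hA.inter hC) * f := by
      refine AEEqFun.ext ?_
      filter_upwards [charFn_mul_coe hA (charFn μ C hC * f), charFn_mul_coe hC f,
        charFn_mul_coe (hA.inter hC) f] with x h1 h2 h3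
      rw [h1, h3]
      by_cases hxA : x ∈ A <;> by_cases hxC : x ∈ C <;> simp [hxA, hxC, h2]
    have hm' : charFn μ (A ∩ C) (hA.inter hC) * f ∈ nakano hp := he ▸ hm
    have he' : (⟨_, hm⟩ : nakano hp) = ⟨_, hm'⟩ := Subtype.ext he
    rw [he']
    filter_upwards [h.eq_indicator _ (hA.inter hC)
      ((measure_mono Set.inter_subset_left).trans_lt hfin) hm',
      hb.inter hs hA hC hfin hCf, charFn_mul_coe (hb.measurable C) g] with y h1 h2 h3
    rw [h1]
    by_cases hyA : y ∈ b A <;> by_cases hyC : y ∈ b C <;> simp [h2, hyA, hyC, h3]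
  · filter_upwards [h.support, charFn_mul_coe (hb.measurable C) g] with y h1 h2 h3
    rw [h2]
    by_cases hy : y ∈ b C <;> simp [hy, h1 h3]

theorem IsSetImage.extendsTo_exponent (hb : IsSetImage θ b) (hU : IsRange θ b U)
    (hs : IsWitness μ s) :
    ExtendsTo θ b U (AEEqFun.mk p hp.measurable.aestronglyMeasurable)
      (AEEqFun.mk q hq.measurable.aestronglyMeasurable * charFn ν U hU.measurable) := by
  have hg : ∀ᵐ y ∂ν, (AEEqFun.mk q hq.measurable.aestronglyMeasurable
      * charFn ν U hU.measurable : Y →ₘ[ν] ℝ) y = U.indicator q y := by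
    rw [mul_comm]
    filter_upwards [charFn_mul_coe hU.measurable
      (AEEqFun.mk q hq.measurable.aestronglyMeasurable : Y →ₘ[ν] ℝ),
      AEEqFun.coeFn_mk q hq.measurable.aestronglyMeasurable (μ := ν)] with y h1 h2
    rw [h1]
    by_cases hy : y ∈ U <;> simp [hy, h2]
  refine ⟨fun A hA hfin hm => ?_, ?_⟩
  · set w : nakano hp := ⟨_, hm⟩
    have hwp : ∀ᵐ x ∂μ, (w : X →ₘ[μ] ℝ) x = A.indicator p x := by
      filter_upwards [charFn_mul_coe hA (AEEqFun.mk p hp.measurable.aestronglyMeasurable),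
        AEEqFun.coeFn_mk p hp.measurable.aestronglyMeasurable (μ := μ)] with x h1 h2
      rw [h1]
      by_cases hx : x ∈ A <;> simp [hx, h2]
    have hbw : band A hA w = w := by
      refine ext_ae ?_
      filter_upwards [band_coe hA w, hwp] with x h1 h2
      rw [h1]
      by_cases hx : x ∈ A
      · simp [hx]
      · rw [h2]
        simp [hx]
    have hε : ∀ ε : ℝ, 0 < ε → ∀ᵐ y ∂ν, y ∈ b A → |(θ w : Y →ₘ[ν] ℝ) y - q y| ≤ ε := by
      intro ε hε
      have hs' := hs.subdivide (fun _ x => ⌊p x / ε⌋₊)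
        (fun _ => Nat.measurable_floor.comp (hp.measurable.div_const ε))
      refine hb.ae_of_witness hs' hA hfin
        (P := fun y => |(θ w : Y →ₘ[ν] ℝ) y - q y| ≤ ε) (measurableSet_le (measurable_abs.comp
        ((θ w : Y →ₘ[ν] ℝ).stronglyMeasurable.measurable.sub hq.measurable)) measurable_const)
        fun z => ?_
      set C := A ∩ (s z.1 ∩ (fun x => ⌊p x / ε⌋₊) ⁻¹' {z.2}) with hCdef
      have hC : MeasurableSet C := hA.inter (hs'.measurable z)
      have hCf : μ C < ∞ := (measure_mono Set.inter_subset_left).trans_lt hfin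
      have hpC : ∀ x ∈ C, z.2 * ε ≤ p x ∧ p x < (z.2 + 1) * ε := by
        intro x hx
        have h1 : ⌊p x / ε⌋₊ = z.2 := hx.2.2
        have h2 := Nat.floor_le (div_nonneg (zero_le_one.trans (hp.one_le x)) hε.le)
        have h3 := Nat.lt_floor_add_one (p x / ε)
        rw [h1] at h2 h3
        exact ⟨(le_div_iff₀ hε).1 h2, (div_lt_iff₀ hε).1 h3⟩
      have hbC : ∀ᵐ x ∂μ, (band C hC w : X →ₘ[μ] ℝ) x = C.indicator p x := by
        filter_upwards [band_coe hC w, hwp] with x h1 h2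
        rw [h1]
        by_cases hx : x ∈ C
        · rw [Set.indicator_of_mem hx, Set.indicator_of_mem hx, h2, Set.indicator_of_mem hx.1]
        · rw [Set.indicator_of_notMem hx, Set.indicator_of_notMem hx]
      have hlo := θ.map_mono_ae (f := ((z.2 : ℝ) * ε) • charN hp C hC hCf) (g := band C hC w) (by
        filter_upwards [hbC, smul_coe ((z.2 : ℝ) * ε) (charN hp C hC hCf), charN_coe hp hC hCf]
          with x h1 h2 h3
        rw [h1, h2, h3]
        by_cases hx : x ∈ C
        · simpa [hx] using (hpC x hx).1
        · simp [hx])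
      have hhi := θ.map_mono_ae (f := band C hC w) (g := (((z.2 : ℝ) + 1) * ε) • charN hp C hC hCf)
        (by
          filter_upwards [hbC, smul_coe (((z.2 : ℝ) + 1) * ε) (charN hp C hC hCf),
            charN_coe hp hC hCf] with x h1 h2 h3
          rw [h1, h2, h3]
          by_cases hx : x ∈ C
          · simpa [hx] using (hpC x hx).2.le
          · simp [hx])
      have hqC := hb.preserves.exponent_mem (f := charN hp C hC hCf)
        (C := Set.Ico ((z.2 : ℝ) * ε) (((z.2 : ℝ) + 1) * ε)) measurableSet_Ico (by
          filter_upwards [charN_coe hp hC hCf] with x h1 h2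
          have hx : x ∈ C := by
            by_contra hx
            rw [Set.indicator_of_notMem hx] at h1
            exact h2 h1
          exact hpC x hx)
      rw [map_smul] at hlo hhi
      filter_upwards [hlo, hhi, hqC, hb.map_charN_coe hC hCf, hb.map_band_coe hs hC hCf w,
        smul_coe ((z.2 : ℝ) * ε) (θ (charN hp C hC hCf)),
        smul_coe (((z.2 : ℝ) + 1) * ε) (θ (charN hp C hC hCf))] with y h1 h2 h3 h4 h5 h6 h7 hy
      rw [Set.indicator_of_mem hy] at h4 h5
      rw [h6, h4, h5, mul_one] at h1
      rw [h7, h4, h5, mul_one] at h2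
      obtain ⟨h8, h9⟩ := h3 (by rw [h4]; exact one_ne_zero)
      rw [abs_le]
      constructor <;> linarith
    have hall : ∀ᵐ y ∂ν, ∀ n : ℕ, y ∈ b A → |(θ w : Y →ₘ[ν] ℝ) y - q y| ≤ 1 / ((n : ℝ) + 1) :=
      ae_all_iff.2 fun n => hε _ (by positivity)
    filter_upwards [hall, hg, hU.subset A hA hfin, hb.map_band_coe hs hA hfin w] with y h1 h2 h3 h4
    by_cases hy : y ∈ b A
    · rw [Set.indicator_of_mem hy, h2, Set.indicator_of_mem (h3 hy)]
      have : |(θ w : Y →ₘ[ν] ℝ) y - q y| ≤ 0 :=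
        ge_of_tendsto' (tendsto_one_div_add_atTop_nhds_zero_nat (𝕜 := ℝ)) fun n => h1 n hy
      exact sub_eq_zero.1 (abs_nonpos_iff.1 this)
    · rw [hbw] at h4
      rw [h4, Set.indicator_of_notMem hy, Set.indicator_of_notMem hy]
  · filter_upwards [hg] with y h1 h2
    rw [h1, Set.indicator_of_notMem h2]

end Extension

/-! ### Exhaustion for suprema in `L_0` -/

section Suprema

variable {X : Type u} [MeasurableSpace X] {μ : Measure X} {ι : Type u} {s : ι → Set X}

/-- On a set of finite measure, a supremum in `L_0` is approximated by countably many elements. -/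
theorem exists_seq_approx_of_isLUB {S : Set (X →ₘ[μ] ℝ)} {f : X →ₘ[μ] ℝ} (hS : S.Nonempty)
    (hf : IsLUB S f) {A : Set X} (hA : MeasurableSet A) (hfin : μ A < ∞) {ε : ℝ} (hε : 0 < ε) :
    ∃ σ : ℕ → X →ₘ[μ] ℝ, (∀ n, σ n ∈ S) ∧ ∀ᵐ x ∂μ, x ∈ A → ∃ n, f x - ε < σ n x := by
  classical
  have hfm : Measurable f := f.stronglyMeasurable.measurable
  set E : (X →ₘ[μ] ℝ) → Set X := fun g => A ∩ {x | f x - ε < g x} with hE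
  have hEm : ∀ g, MeasurableSet (E g) := fun g =>
    hA.inter (measurableSet_lt (hfm.sub measurable_const) g.stronglyMeasurable.measurable)
  obtain ⟨g₀, hg₀⟩ := hS
  -- Exhaustion: the largest measure obtainable by a countable union of the sets E g is attained, by
  -- merging a maximising sequence of sequences through a pairing of the naturals.
  set V : Set ℝ≥0∞ := {r | ∃ σ : ℕ → X →ₘ[μ] ℝ, (∀ n, σ n ∈ S) ∧ r = μ (⋃ n, E (σ n))} with hV
  have hVne : V.Nonempty := ⟨_, fun _ => g₀, fun _ => hg₀, rfl⟩
  obtain ⟨r, -, hr, hrV⟩ := exists_seq_tendsto_sSup hVne (OrderTop.bddAbove V)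
  choose τ hτS hτ using hrV
  set σ : ℕ → X →ₘ[μ] ℝ := fun n => τ n.unpair.1 n.unpair.2 with hσ
  have hσS : ∀ n, σ n ∈ S := fun n => hτS _ _
  have hsub : ∀ m n, E (τ m n) ⊆ ⋃ k, E (σ k) := by
    intro m n x hx
    refine Set.mem_iUnion.2 ⟨Nat.pair m n, ?_⟩
    simpa [hσ] using hx
  have hmax : sSup V ≤ μ (⋃ k, E (σ k)) := by
    refine le_of_tendsto' hr fun m => ?_
    rw [hτ m]
    exact measure_mono (Set.iUnion_subset (hsub m))
  have hWm : MeasurableSet (⋃ k, E (σ k)) := MeasurableSet.iUnion fun k => hEm _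
  have hWfin : μ (⋃ k, E (σ k)) ≠ ∞ :=
    ((measure_mono (Set.iUnion_subset fun k => Set.inter_subset_left)).trans_lt hfin).ne
  -- Prepending g to σ cannot increase the maximal, finite measure.
  have hnull : ∀ g ∈ S, μ (E g \ ⋃ k, E (σ k)) = 0 := by
    intro g hg
    have h1 : μ ((⋃ k, E (σ k)) ∪ E g) ≤ sSup V := by
      refine le_sSup ⟨fun n => Nat.casesOn n g σ, fun n => ?_, ?_⟩
      · cases n
        · exact hg
        · exact hσS _
      · congr 1
        ext x
        simp only [Set.mem_union, Set.mem_iUnion]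
        constructor
        · rintro (⟨k, hk⟩ | h)
          · exact ⟨k + 1, hk⟩
          · exact ⟨0, h⟩
        · rintro ⟨_ | k, hk⟩
          · exact Or.inr hk
          · exact Or.inl ⟨k, hk⟩
    rw [measure_sdiff' _ hWm.nullMeasurableSet hWfin, tsub_eq_zero_iff_le, Set.union_comm]
    exact h1.trans hmax
  refine ⟨σ, hσS, ?_⟩
  set D : Set X := A \ ⋃ k, E (σ k) with hD
  have hDm : MeasurableSet D := hA.diff hWm
  -- On the unexhausted part D no member of S essentially exceeds f - ε. Lowering f there still
  -- gives an upper bound, so D is null.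
  have hub : f - ε • charFn μ D hDm ∈ upperBounds S := by
    intro g hg
    rw [← AEEqFun.coeFn_le]
    filter_upwards [AEEqFun.coeFn_le.2 (hf.1 hg), measure_eq_zero_iff_ae_notMem.1 (hnull g hg),
      AEEqFun.coeFn_sub f (ε • charFn μ D hDm), AEEqFun.coeFn_smul ε (charFn μ D hDm),
      charFn_coe (μ := μ) hDm] with x h1 h2 h3 h4 h5
    rw [h3, Pi.sub_apply, h4, Pi.smul_apply, h5, smul_eq_mul]
    by_cases hx : x ∈ D
    · rw [Set.indicator_of_mem hx, mul_one]
      by_contra h6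
      exact h2 ⟨⟨hx.1, not_le.1 h6⟩, hx.2⟩
    · rw [Set.indicator_of_notMem hx, mul_zero, sub_zero]
      exact h1
  filter_upwards [AEEqFun.coeFn_le.2 (hf.2 hub), AEEqFun.coeFn_sub f (ε • charFn μ D hDm),
    AEEqFun.coeFn_smul ε (charFn μ D hDm), charFn_coe (μ := μ) hDm] with x h1 h3 h4 h5 hx
  rw [h3, Pi.sub_apply, h4, Pi.smul_apply, h5, smul_eq_mul] at h1
  by_contra! h6
  have hxD : x ∈ D := by
    refine ⟨hx, fun h => ?_⟩
    obtain ⟨k, hk⟩ := Set.mem_iUnion.1 h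
    exact absurd hk.2 (not_lt.2 (h6 k))
  rw [Set.indicator_of_mem hxD] at h1
  linarith

end Suprema

/-! ### The extension operator: suprema and uniqueness -/

section ExtensionOperator

variable {X : Type u} {Y : Type v} [MeasurableSpace X] [MeasurableSpace Y] {μ : Measure X}
  {ν : Measure Y} {p : X → ℝ} {q : Y → ℝ} {hp : IsExponent μ p} {hq : IsExponent ν q}
  {θ : IsometricLatticeEmbedding hp hq} {ι : Type u} {s : ι → Set X} {b : Set X → Set Y}
  {U : Set Y}

theorem IsSetImage.exists_extension (hb : IsSetImage θ b) (hU : IsRange θ b U)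
    (hs : IsWitness μ s) (hν : StrictlyLocalisable ν) :
    ∃ T : (X →ₘ[μ] ℝ) →ₗ[ℝ] (Y →ₘ[ν] ℝ), ∀ f, ExtendsTo θ b U f (T f) := by
  choose T hT using hb.exists_extendsTo hU hs hν
  exact ⟨{ toFun := T
           map_add' := fun f g => (hT (f + g)).unique hb hU hs ((hT f).add hb hs (hT g))
           map_smul' := fun c f => (hT (c • f)).unique hb hU hs ((hT f).smul hb hs c) }, hT⟩

variable {T : (X →ₘ[μ] ℝ) →ₗ[ℝ] (Y →ₘ[ν] ℝ)}

theorem monotone_of_map_sup (h : ∀ f g, T (f ⊔ g) = T f ⊔ T g) : Monotone T := by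
  intro f g hfg
  rw [← sup_eq_right, ← h, sup_eq_right.2 hfg]

/-- Multiplication by χ_C becomes multiplication by χ_{b C}, and the constant ε is sent to ε χ_U,
which is at most ε. -/
theorem IsSetImage.map_le_add (hb : IsSetImage θ b) (hU : IsRange θ b U) (hs : IsWitness μ s)
    (hT : ∀ f, ExtendsTo θ b U f (T f)) {C : Set X} (hC : MeasurableSet C) (hCf : μ C < ∞)
    {f g : X →ₘ[μ] ℝ} {ε : ℝ} (hε : 0 ≤ ε) (h : ∀ᵐ x ∂μ, x ∈ C → f x ≤ g x + ε) :
    ∀ᵐ y ∂ν, y ∈ b C → T f y ≤ T g y + ε := by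
  have hmono : Monotone T := monotone_of_map_sup fun f g =>
    (hT _).unique hb hU hs ((hT f).sup hb hs (hT g))
  have h1 : charFn μ C hC * f ≤ charFn μ C hC
      * (g + ε • charFn μ Set.univ MeasurableSet.univ) := by
    rw [← AEEqFun.coeFn_le]
    filter_upwards [h, charFn_mul_coe hC f,
      charFn_mul_coe hC (g + ε • charFn μ Set.univ MeasurableSet.univ),
      AEEqFun.coeFn_add g (ε • charFn μ Set.univ MeasurableSet.univ),
      AEEqFun.coeFn_smul ε (charFn μ Set.univ MeasurableSet.univ),
      charFn_coe (μ := μ) MeasurableSet.univ] with x h2 h3 h4 h5 h6 h7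
    rw [h3, h4]
    by_cases hx : x ∈ C
    · rw [Set.indicator_of_mem hx, Set.indicator_of_mem hx, h5, Pi.add_apply, h6, Pi.smul_apply,
        h7]
      simpa using h2 hx
    · rw [Set.indicator_of_notMem hx, Set.indicator_of_notMem hx]
  have h2 := hmono h1
  have e1 : T (charFn μ Set.univ MeasurableSet.univ) = charFn ν U hU.measurable :=
    (hT _).unique hb hU hs (hb.extendsTo_charFn_univ hU)
  rw [(hT _).unique hb hU hs ((hT f).charFn_mul hb hs hC hCf),
    (hT _).unique hb hU hs ((hT _).charFn_mul hb hs hC hCf), map_add, map_smul, e1,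
    ← AEEqFun.coeFn_le] at h2
  filter_upwards [h2, charFn_mul_coe (hb.measurable C) (T f),
    charFn_mul_coe (hb.measurable C) (T g + ε • charFn ν U hU.measurable),
    AEEqFun.coeFn_add (T g) (ε • charFn ν U hU.measurable),
    AEEqFun.coeFn_smul ε (charFn ν U hU.measurable), charFn_coe (μ := ν) hU.measurable]
    with y h3 h4 h5 h6 h7 h8 hy
  rw [h4, h5, Set.indicator_of_mem hy, Set.indicator_of_mem hy, h6, Pi.add_apply, h7,
    Pi.smul_apply, h8, smul_eq_mul] at h3
  refine h3.trans ?_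
  gcongr
  exact mul_le_of_le_one_right hε (Set.indicator_le_self' (fun _ _ => zero_le_one) y)

/-- Each witness piece is cut by the first member of an approximating sequence in S that comes
within ε of f. On such a part f ≤ g + ε for a single g in S, so T f exceeds any upper bound of the
images by at most ε. -/
theorem IsSetImage.isLUB_image (hb : IsSetImage θ b) (hU : IsRange θ b U) (hs : IsWitness μ s)
    (hT : ∀ f, ExtendsTo θ b U f (T f)) {S : Set (X →ₘ[μ] ℝ)} {f : X →ₘ[μ] ℝ}
    (hS : S.Nonempty) (hf : IsLUB S f) : IsLUB (T '' S) (T f) := by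
  classical
  have hmono : Monotone T := monotone_of_map_sup fun f g =>
    (hT _).unique hb hU hs ((hT f).sup hb hs (hT g))
  refine ⟨?_, fun G hG => ?_⟩
  · rintro _ ⟨g, hg, rfl⟩
    exact hmono (hf.1 hg)
  have hGS : ∀ g ∈ S, ∀ᵐ y ∂ν, T g y ≤ G y := fun g hg =>
    AEEqFun.coeFn_le.2 (hG ⟨g, hg, rfl⟩)
  have hfm : Measurable f := f.stronglyMeasurable.measurable
  have hε : ∀ ε : ℝ, 0 < ε → ∀ᵐ y ∂ν, T f y ≤ G y + ε := by
    intro ε hε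
    choose σ hσS hσ using fun i => exists_seq_approx_of_isLUB hS hf (hs.measurable i)
      (hs.finite i) hε
    have hσm : ∀ i n, MeasurableSet {x | f x - ε < σ i n x} := fun i n =>
      measurableSet_lt (hfm.sub measurable_const) (σ i n).stronglyMeasurable.measurable
    -- The second alternative makes the least index defined everywhere, with default 0; inside `s i`
    -- it occurs only on a null set.
    have hex : ∀ i x, ∃ n, f x - ε < σ i n x ∨ ∀ m, ¬ f x - ε < σ i m x := by
      intro i x
      by_cases h : ∃ n, f x - ε < σ i n x
      · obtain ⟨n, hn⟩ := h
        exact ⟨n, Or.inl hn⟩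
      · push Not at h
        exact ⟨0, Or.inr fun m => not_lt.2 (h m)⟩
    have hs' := hs.subdivide (fun i x => Nat.find (hex i x)) fun i => by
      refine measurable_find (hex i) fun n => ?_
      have : {x | f x - ε < σ i n x ∨ ∀ m, ¬ f x - ε < σ i m x}
          = {x | f x - ε < σ i n x} ∪ ⋂ m, {x | f x - ε < σ i m x}ᶜ := by
        ext x
        simp
      rw [this]
      exact (hσm i n).union (MeasurableSet.iInter fun m => (hσm i m).compl)
    refine hU.ae_of_forall (fun A hA hfin => ?_) ?_
    · refine hb.ae_of_witness hs' hA hfin (P := fun y => T f y ≤ G y + ε)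
        (measurableSet_le (T f).stronglyMeasurable.measurable
          (G.stronglyMeasurable.measurable.add measurable_const)) fun z => ?_
      have hC := hA.inter (hs'.measurable z)
      have hCf := (measure_mono (μ := μ) (Set.inter_subset_left (s := A)
        (t := s z.1 ∩ (fun x => Nat.find (hex z.1 x)) ⁻¹' {z.2}))).trans_lt hfin
      have hle : ∀ᵐ x ∂μ, x ∈ A ∩ (s z.1 ∩ (fun x => Nat.find (hex z.1 x)) ⁻¹' {z.2}) →
          f x ≤ σ z.1 z.2 x + ε := by
        filter_upwards [hσ z.1] with x h1 h2
        have h3 : Nat.find (hex z.1 x) = z.2 := h2.2.2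
        have h4 := Nat.find_spec (hex z.1 x)
        rw [h3] at h4
        rcases h4 with h4 | h4
        · linarith
        · obtain ⟨n, hn⟩ := h1 h2.2.1
          exact absurd hn (h4 n)
      filter_upwards [hb.map_le_add hU hs hT hC hCf hε.le hle, hGS _ (hσS z.1 z.2)] with y h1 h2 h3
      linarith [h1 h3]
    -- Off U every image vanishes. Non-emptiness of S is needed here to give G ≥ 0.
    · obtain ⟨g, hg⟩ := hS
      filter_upwards [hGS g hg, (hT g).support, (hT f).support] with y h1 h2 h3 hy
      rw [h3 hy]
      rw [h2 hy] at h1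
      linarith
  rw [← AEEqFun.coeFn_le]
  have hall : ∀ᵐ y ∂ν, ∀ n : ℕ, T f y ≤ G y + 1 / ((n : ℝ) + 1) :=
    ae_all_iff.2 fun n => hε _ (by positivity)
  filter_upwards [hall] with y hy
  have h1 := (tendsto_one_div_add_atTop_nhds_zero_nat (𝕜 := ℝ)).const_add (G y)
  rw [add_zero] at h1
  exact ge_of_tendsto' h1 hy

/-- A positive function is the supremum of its restrictions which belong to a Nakano space. -/
theorem isLUB_charFn_mul (hp : IsExponent μ p) (hs : IsWitness μ s) {f : X →ₘ[μ] ℝ}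
    (hf : ∀ᵐ x ∂μ, 0 ≤ f x) : IsLUB {g | g ∈ nakano hp ∧ ∃ (A : Set X) (hA : MeasurableSet A),
      g = charFn μ A hA * f} f := by
  refine ⟨?_, fun G hG => ?_⟩
  · rintro _ ⟨-, A, hA, rfl⟩
    rw [← AEEqFun.coeFn_le]
    filter_upwards [charFn_mul_coe hA f, hf] with x h1 h2
    rw [h1]
    exact Set.indicator_le_self' (fun _ _ => h2) x
  · rw [← AEEqFun.coeFn_le]
    have hs' := hs.subdivide_abs f
    refine hs'.ae_of_forall fun z => ?_
    have hm := charFn_mul_mem hp (hs'.measurable z) (hs'.finite z)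
      (Filter.Eventually.of_forall fun x hx => abs_le_of_mem_subdivide (f := f) hx)
    filter_upwards [AEEqFun.coeFn_le.2 (hG ⟨hm, _, _, rfl⟩),
      charFn_mul_coe (hs'.measurable z) f] with x h1 h2 h3
    rw [h2, Set.indicator_of_mem h3] at h1
    exact h1

/-- A non-negative function is the supremum of its restrictions in the Nakano space, where both
extensions equal θ; the general case follows from positive and negative parts. The supremum may be
uncountable, which is why all existing suprema are required. -/
theorem IsExtension.unique {θ : nakano hp →ₗ[ℝ] nakano hq} (hs : IsWitness μ s)
    {T T' : (X →ₘ[μ] ℝ) →ₗ[ℝ] (Y →ₘ[ν] ℝ)} (h : IsExtension θ T) (h' : IsExtension θ T') :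
    T' = T := by
  have hpos : ∀ f : X →ₘ[μ] ℝ, (∀ᵐ x ∂μ, 0 ≤ f x) → T' f = T f := by
    intro f hf
    have hne : {g | g ∈ nakano hp ∧ ∃ (A : Set X) (hA : MeasurableSet A),
        g = charFn μ A hA * f}.Nonempty := by
      -- The empty set contributes the member 0, since only suprema of non-empty sets are known to
      -- be preserved.
      refine ⟨_, ?_, ∅, MeasurableSet.empty, rfl⟩
      exact charFn_mul_mem hp MeasurableSet.empty (c := 0) (by simp)
        (Filter.Eventually.of_forall fun x hx => absurd hx (Set.notMem_empty x))
    have h1 := h.map_isLUB _ f hne (isLUB_charFn_mul hp hs hf)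
    have h2 := h'.map_isLUB _ f hne (isLUB_charFn_mul hp hs hf)
    have he : T' '' {g | g ∈ nakano hp ∧ ∃ (A : Set X) (hA : MeasurableSet A),
        g = charFn μ A hA * f} = T '' {g | g ∈ nakano hp ∧ ∃ (A : Set X) (hA : MeasurableSet A),
        g = charFn μ A hA * f} :=
      Set.image_congr fun g hg => (h'.extends_map ⟨g, hg.1⟩).trans (h.extends_map ⟨g, hg.1⟩).symm
    rw [he] at h2
    exact h2.unique h1
  refine LinearMap.ext fun f => ?_
  have hdec : f = (f ⊔ 0) - ((-f) ⊔ 0) := by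
    refine AEEqFun.ext ?_
    filter_upwards [AEEqFun.coeFn_sub (f ⊔ 0) ((-f) ⊔ 0), AEEqFun.coeFn_sup f 0,
      AEEqFun.coeFn_sup (-f) 0, AEEqFun.coeFn_neg f,
      AEEqFun.coeFn_zero (α := X) (β := ℝ) (μ := μ)] with x h1 h2 h3 h4 h5
    rw [h1, Pi.sub_apply, h2, h3, h4, h5, Pi.neg_apply, Pi.zero_apply]
    rcases le_total 0 (f x) with h6 | h6
    · rw [sup_eq_left.2 h6, sup_eq_right.2 (neg_nonpos.2 h6), sub_zero]
    · rw [sup_eq_right.2 h6, sup_eq_left.2 (neg_nonneg.2 h6), zero_sub, neg_neg]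
  have hsup : ∀ g : X →ₘ[μ] ℝ, ∀ᵐ x ∂μ, 0 ≤ (g ⊔ 0) x := by
    intro g
    filter_upwards [AEEqFun.coeFn_sup g 0, AEEqFun.coeFn_zero (α := X) (β := ℝ) (μ := μ)]
      with x h1 h2
    rw [h1, h2]
    exact le_sup_right
  rw [hdec, map_sub, map_sub, hpos _ (hsup _), hpos _ (hsup _)]

end ExtensionOperator

end NakanoSpace
-- The theorem on isometric embeddings
open NakanoSpace in
theorem theorem1p10 {X : Type u} {Y : Type v} [MeasurableSpace X] [MeasurableSpace Y]
    (μ : Measure X) (ν : Measure Y) (hμ : StrictlyLocalisable μ) (hν : StrictlyLocalisable ν)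
    (p : X → ℝ) (q : Y → ℝ) (hp : IsExponent μ p) (hq : IsExponent ν q)
    (hdim : 2 ≤ Module.rank ℝ (nakano hp)) (θ : IsometricLatticeEmbedding hp hq) :
    ∃ (ν' : Measure Y) (ζ : Y → ℝ) (hζ : IsDensity ν ν' ζ),
      Equivalent ν ν' ∧
      -- characteristic functions are sent to characteristic functions
      (∀ (A : Set X) (hA : MeasurableSet A) (hfin : μ A < ⊤),
        ∃ (B : Set Y) (hB : MeasurableSet B),
          (densityChange hq hζ (θ.toLinearMap (charN hp A hA hfin)) : Y →ₘ[ν'] ℝ)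
            = charFn ν' B hB) ∧
      -- the extension exists, is unique, and sends `p` to `q` times the image of `1`
      (∃ T : (X →ₘ[μ] ℝ) →ₗ[ℝ] (Y →ₘ[ν'] ℝ),
        IsExtension (densityChange hq hζ ∘ₗ θ.toLinearMap) T ∧
        (∀ T', IsExtension (densityChange hq hζ ∘ₗ θ.toLinearMap) T' → T' = T) ∧
        ∃ (Y₀ : Set Y) (hY₀ : MeasurableSet Y₀),
          T (charFn μ Set.univ MeasurableSet.univ) = charFn ν' Y₀ hY₀ ∧
          T (AEEqFun.mk p hp.measurable.aestronglyMeasurable)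
            = AEEqFun.mk q hq.measurable.aestronglyMeasurable * charFn ν' Y₀ hY₀) ∧
      -- the measure of sets of finite measure is preserved
      (∀ (A : Set X) (hA : MeasurableSet A) (hfin : μ A < ⊤) (B : Set Y) (hB : MeasurableSet B),
        (densityChange hq hζ (θ.toLinearMap (charN hp A hA hfin)) : Y →ₘ[ν'] ℝ)
            = charFn ν' B hB →
          ν' B = μ A) := by
  obtain ⟨ι, s, hs⟩ := id hμ
  obtain ⟨ν', ζ, hζ, heq, h01⟩ := exists_densityChange θ hν hs
  -- The density change is itself a lattice isometry, so the composite is an isometric embedding of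
  -- the same kind and the result on the modular applies to it directly.
  have hE : PreservesEnergy (θ.densityChange hζ) := preservesEnergy_of_two_le_rank hμ hdim _
  have hchar := hE.exists_eq_charFn hs h01
  obtain ⟨b, hb⟩ := hE.exists_isSetImage hchar
  have hν' := heq.strictlyLocalisable_right
  obtain ⟨U, hU⟩ := hb.exists_isRange hs hν'
  obtain ⟨T, hT⟩ := hb.exists_extension hU hs hν'
  have hext : IsExtension (densityChange hq hζ ∘ₗ θ.toLinearMap) T :=
    { extends_map := fun f => (hT f).unique hb hU hs (hb.extendsTo_self hU hs f)
      map_sup := fun f g => (hT _).unique hb hU hs ((hT f).sup hb hs (hT g))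
      map_inf := fun f g => (hT _).unique hb hU hs ((hT f).inf hb hs (hT g))
      map_isLUB := fun S f hS hf => hb.isLUB_image hU hs hT hS hf }
  refine ⟨ν', ζ, hζ, heq, hchar, ⟨T, hext, fun T' hT' => hext.unique hs hT', U, hU.measurable,
    (hT _).unique hb hU hs (hb.extendsTo_charFn_univ hU),
    (hT _).unique hb hU hs (hb.extendsTo_exponent hU hs)⟩, fun A hA hfin B hB hAB => ?_⟩
  -- The modular of a characteristic function is the measure of its set, whatever the exponent.
  have h := hE.modular_map (charN hp A hA hfin)
  rw [show ((θ.densityChange hζ) (charN hp A hA hfin) : Y →ₘ[ν'] ℝ) = charFn ν' B hB from hAB,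
    modular_charFn (hq.of_isDensity hζ) hB] at h
  rw [h]
  exact modular_charFn hp hA
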